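/- For a finite graph $G$, a vertex $v$ and a set $A\subseteq V(G)$, let $N_G(v)$ denote the neighbourhood of $v$ and put $d_G(v,A)=|N_G(v)\cap A|$. Logarithms are natural. **Theorem.** Let $\alpha\in(0,1)$ and $C_0>0$ be any constants. There exist constants $\gamma',c>0$ such that for every $\gamma\in(0,\gamma')$ and every large enough integer $n$ the following holds. Let $G=(V,E)$ be a graph on $n$ vertices with the following properties. 1. (Partition) There is a partition $V=V_1\cup V_2$ with $|V_2|=500\lfloor\gamma n\rfloor$. 2. (Suitable star) There are a vertex $x^*$ and disjoint sets $R^*,S^*\subseteq V_1$ such that: (a) $|S^*|=\lfloor 25C_0\log n\rfloor$ and $S^*\subseteq N_G(x^*)$; (b) $|R^*|\le 25$, and each $v\in R^*$ that is not adjacent to $x^*$ is adjacent to a vertex $s_v\in S^*$, where $s_v\ne s_w$ if $v\ne w$; (c) $d_G(w,S^*)\ge 2C_0\log n$ for all $w\in V\setminus(R^*\cup S^*)$. 3. (Pair degrees) For every $v\in V$ there are at most $\log n$ vertices $w\in V$ such that $|N_G(v)\cap N_G(w)\cap V_1|<\alpha n$. 4. (Edges between sets) Between every two disjoint sets $A\subseteq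 V_1$ and $B\subseteq V$, both of size $\lfloor C_0\log n\rfloor$, there is an edge of $G$. 5. (Suitable clique factor) In $G[V_2]$ there is a collection $\mathcal K$ of $100\lfloor\gamma n\rfloor$ vertex-disjoint copies of $K_5$ such that: (a) there is a partition $\mathcal K=\mathcal K_{good}\cup\mathcal K_{bad}$ with $|\mathcal K_{bad}|=\lfloor\gamma n\rfloor$; (b) every vertex $v\in V$ that is not in a clique of $\mathcal K_{good}$ satisfies $d_G(v,V_2)\ge 40\lfloor\gamma n\rfloor$; (c) for every $K\in\mathcal K_{good}$ there are at most $\gamma n$ cliques $K'\in\mathcal K_{good}\setminus\{K\}$ such that $G$ does not have a matching of size $3$ between $V(K)$ and $V(K')$. Then $G$ contains a copy of every tree $T$ on $n$ vertices with maximum degree $\Delta(T)\le \frac{cn}{\log n}$. -/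

import Mathlib

namespace TreeUniversality

/-- `d_G(v, A)`: the number of neighbours of `v` in the set `A`. -/
noncomputable def degIn {V : Type*} (G : SimpleGraph V) (v : V) (A : Finset V) : ℕ :=
  open Classical in (A.filter fun u => G.Adj v u).card

/-- `|N_G(v) ∩ N_G(w) ∩ A|`: the number of common neighbours of `v` and `w` in the set `A`. -/
noncomputable def pairDegIn {V : Type*} (G : SimpleGraph V) (v w : V) (A : Finset V) : ℕ :=
  open Classical in (A.filter fun u => G.Adj v u ∧ G.Adj w u).card

/-- For disjoint sets `A` and `B`: the graph `G` has a matching of size `k` between `A` and `B`,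
namely the `k` pairwise disjoint edges `a i – b i` with `a i ∈ A` and `b i ∈ B`. -/
def HasMatchingBetween {V : Type*} (G : SimpleGraph V) (k : ℕ) (A B : Finset V) : Prop :=
  ∃ a b : Fin k → V, Function.Injective a ∧ Function.Injective b ∧
    ∀ i, a i ∈ A ∧ b i ∈ B ∧ G.Adj (a i) (b i)

/-- Suitable star: the star with centre `x` and leaf set `S ⊆ V₁`, together with the
exceptional set `R ⊆ V₁`. -/
structure IsSuitableStar {V : Type*} (G : SimpleGraph V) (n : ℕ) (C₀ : ℝ) (V₁ : Finset V)
    (x : V) (S R : Finset V) : Prop where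
  S_subset : S ⊆ V₁
  R_subset : R ⊆ V₁
  disjoint : Disjoint R S
  card_S : S.card = ⌊25 * C₀ * Real.log n⌋₊
  S_adj : ∀ s ∈ S, G.Adj x s
  card_R : R.card ≤ 25
  /-- The vertices of `R` not adjacent to `x` have pairwise distinct neighbours in `S`. -/
  exists_rep : ∃ s : V → V,
    (∀ v ∈ R, ¬ G.Adj v x → s v ∈ S ∧ G.Adj v (s v)) ∧
    (∀ v ∈ R, ∀ w ∈ R, ¬ G.Adj v x → ¬ G.Adj w x → v ≠ w → s v ≠ s w)
  degIn_S : ∀ w : V, w ∉ R → w ∉ S → 2 * C₀ * Real.log n ≤ (degIn G w S : ℝ)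

/-- Pair degree conditions: for every `v` there are at most `log n` vertices `w`
(`w = v` is not excluded) having fewer than `α n` common neighbours with `v` in `V₁`. -/
def PairDegreeCondition {V : Type*} [Fintype V] (G : SimpleGraph V) (n : ℕ) (α : ℝ)
    (V₁ : Finset V) : Prop :=
  ∀ v : V, open Classical in
    ((Finset.univ.filter fun w : V => (pairDegIn G v w V₁ : ℝ) < α * n).card : ℝ) ≤ Real.log n

/-- Edges between sets: there is an edge between every two disjoint sets `A ⊆ V₁` and `B ⊆ V`
of size `⌊C₀ log n⌋`. -/
def EdgesBetweenSets {V : Type*} (G : SimpleGraph V) (n : ℕ) (C₀ : ℝ) (V₁ : Finset V) : Prop :=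
  ∀ A B : Finset V, A ⊆ V₁ → Disjoint A B →
    A.card = ⌊C₀ * Real.log n⌋₊ → B.card = ⌊C₀ * Real.log n⌋₊ →
    ∃ a ∈ A, ∃ b ∈ B, G.Adj a b

/-- Suitable clique factor: `𝒦` is a collection of vertex-disjoint `K₅`-copies in `G[V₂]`, each
given by its vertex set, which is partitioned into `good` and `bad`. -/
structure IsSuitableCliqueFactor {V : Type*} (G : SimpleGraph V) (n : ℕ) (γ : ℝ)
    (V₂ : Finset V) (𝒦 good bad : Finset (Finset V)) : Prop where
  card_all : 𝒦.card = 100 * ⌊γ * n⌋₊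
  isClique : ∀ K ∈ 𝒦, K ⊆ V₂ ∧ G.IsNClique 5 K
  pairwiseDisjoint : ∀ K ∈ 𝒦, ∀ K' ∈ 𝒦, K ≠ K' → Disjoint K K'
  good_disjoint_bad : Disjoint good bad
  good_or_bad : ∀ K, K ∈ 𝒦 ↔ K ∈ good ∨ K ∈ bad
  card_bad : bad.card = ⌊γ * n⌋₊
  degIn_V₂ : ∀ v : V, (∀ K ∈ good, v ∉ K) → 40 * ⌊γ * n⌋₊ ≤ degIn G v V₂
  few_unmatched : ∀ K ∈ good, open Classical in
    ((good.filter fun K' => K' ≠ K ∧ ¬ HasMatchingBetween G 3 K K').card : ℝ) ≤ γ * n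

/-- The conjunction of all five properties required of the `n`-vertex graph `G`. -/
def UniversalityCondition {V : Type*} [Fintype V] (G : SimpleGraph V) (n : ℕ) (α C₀ γ : ℝ) :
    Prop :=
  ∃ V₁ V₂ : Finset V,
    (Disjoint V₁ V₂ ∧ (∀ v : V, v ∈ V₁ ∨ v ∈ V₂) ∧ V₂.card = 500 * ⌊γ * n⌋₊) ∧
    (∃ (x : V) (S R : Finset V), IsSuitableStar G n C₀ V₁ x S R) ∧
    PairDegreeCondition G n α V₁ ∧
    EdgesBetweenSets G n C₀ V₁ ∧
    ∃ 𝒦 good bad : Finset (Finset V), IsSuitableCliqueFactor G n γ V₂ 𝒦 good bad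

end TreeUniversality

/-! Write m for ⌊C₀ log n⌋, g for ⌊γn⌋ and D for the degree bound of T.

Vertices are embedded one at a time in the manner of Friedman, Pippenger and Haxell. `Extendable`
asks that every set of at most 2m vertices have enough free neighbours for the total demand of its
members. Sets with at least m vertices satisfy this with room to spare, because m-sets are joined by
edges, so only small sets can be tight. Tight small sets are closed under union by submodularity,
and hence some free neighbour can always be taken (`Extendable.exists_extend`). This embeds almost
spanning forests (`exists_embedding`) and, since two disjoint m-sets of fresh leaves span an edge,
also connects given vertices by paths of given lengths (`Joined.exists_paths`). What remains is to
use every vertex of G. There are two cases, according to whether T has more than n/7098 leaves.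

Few leaves: T contains linearly many disjoint bare paths with 505 interior vertices
(`Rooting.exists_bare_paths`). The rest of T, with these paths contracted to edges, is embedded into
V₁. All but g of the bare paths are realised inside V₁, and the other g pass through the clique
factor. Counting leaves exactly g unused vertices in V₁. Each of the g clique paths absorbs one of
them, one bad clique and 99 good cliques, which is 501 vertices (`exists_clique_paths`). Matchings
of size 3 let a path run through three consecutive cliques with prescribed ends, and the order of
the cliques comes from Hall's theorem.

Many leaves: T without its leaves is embedded, and Hall's theorem places the leaves on the unused
vertices (`Rooting.isContained_of_leaves`). Residual extendability handles small sets of parents.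
For large sets, fewer than m unused vertices can be missed, and it suffices that every unused vertex
sees the parents of at least m leaves. This is arranged in one of two ways. If some non-leaf of T
has many neighbours adjacent to leaves, it is placed at the centre of the suitable star, and the
leaf set of the star serves as those parents (`isContained_of_star`). Otherwise the leaf parents are
spread over many grandparents. They are then placed inside a small reservoir by a derandomised
greedy choice, with an exponential potential ensuring that every vertex is hit m times
(`isContained_of_spread`). The pair degree condition supplies common neighbours, and keeping the
conflict sets of the grandparents disjoint limits the loss. -/

namespace TreeUniversality

/-! ### Extendability and top-down embedding of forests -/

open Finset
open scoped Classical

/-- The set of all vertices with a neighbour in `U`. -/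
noncomputable def nbrs {V : Type*} [Fintype V] (G : SimpleGraph V) (U : Finset V) : Finset V :=
  univ.filter fun v => ∃ u ∈ U, G.Adj u v

/-- Small vertex sets have enough neighbours outside the occupied set `O` to meet the demands
`f`. -/
def Extendable {V : Type*} [Fintype V] (G : SimpleGraph V) (M : ℕ) (O : Finset V)
    (f : V → ℕ) : Prop :=
  ∀ U : Finset V, U.card ≤ M → ∑ u ∈ U, f u ≤ (nbrs G U \ O).card

section Extend

variable {V : Type*} [Fintype V] {G : SimpleGraph V}

@[simp] lemma mem_nbrs {U : Finset V} {v : V} : v ∈ nbrs G U ↔ ∃ u ∈ U, G.Adj u v := by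
  simp [nbrs]

lemma nbrs_mono {U U' : Finset V} (h : U ⊆ U') : nbrs G U ⊆ nbrs G U' := by
  intro v; simp only [mem_nbrs]; rintro ⟨u, hu, huv⟩; exact ⟨u, h hu, huv⟩

lemma Extendable.mono {M : ℕ} {O : Finset V} {f g : V → ℕ} (h : Extendable G M O f)
    (hg : ∀ v, g v ≤ f v) : Extendable G M O g :=
  fun U hU => (sum_le_sum fun u _ => hg u).trans (h U hU)

/-- Submodularity of the free neighbourhood size, which makes tight sets closed under union. -/
lemma card_nbrs_union_add {U U' O : Finset V} :
    (nbrs G (U ∪ U') \ O).card + (nbrs G (U ∩ U') \ O).card ≤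
      (nbrs G U \ O).card + (nbrs G U' \ O).card := by
  rw [← card_union_add_card_inter (nbrs G U \ O) (nbrs G U' \ O)]
  apply Nat.add_le_add <;> apply card_le_card <;> intro v <;>
    simp only [mem_union, mem_inter, mem_sdiff, mem_nbrs]
  · rintro ⟨⟨u, hu | hu, huv⟩, hv⟩
    · exact Or.inl ⟨⟨u, hu, huv⟩, hv⟩
    · exact Or.inr ⟨⟨u, hu, huv⟩, hv⟩
  · rintro ⟨⟨u, ⟨hu, hu'⟩, huv⟩, hv⟩
    exact ⟨⟨⟨u, hu, huv⟩, hv⟩, ⟨u, hu', huv⟩, hv⟩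

/-- A vertex with positive demand can be given a new neighbour so that extendability persists. -/
lemma Extendable.exists_extend {m : ℕ} {O : Finset V} {f : V → ℕ} (hm : 1 ≤ m)
    (h : Extendable G (2 * m) O f)
    (hlarge : ∀ U : Finset V, m ≤ U.card → U.card ≤ 2 * m → ∑ u ∈ U, f u < (nbrs G U \ O).card)
    {s : V} (hs : 0 < f s) :
    ∃ y, y ∉ O ∧ G.Adj s y ∧
      Extendable G (2 * m) (insert y O) (Function.update f s (f s - 1)) := by
  by_contra hcon
  push Not at hcon
  -- Each rejected y is blamed on a set U that was already tight. Occupying y costs U one neighbour;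
  -- if s were in U, its lowered demand would compensate. Slack for sizes between m and 2m forces
  -- |U| < m.
  have key : ∀ y, y ∉ O → G.Adj s y → ∃ U : Finset V, U.card < m ∧ s ∉ U ∧ y ∈ nbrs G U ∧
      (nbrs G U \ O).card ≤ ∑ u ∈ U, f u := by
    intro y hy hsy
    have := hcon y hy hsy
    simp only [Extendable] at this
    push Not at this
    obtain ⟨U, hU, hlt⟩ := this
    have hbase := h U hU
    have hle : ∑ u ∈ U, Function.update f s (f s - 1) u ≤ ∑ u ∈ U, f u :=
      sum_le_sum fun u _ => by
        by_cases hu : u = s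
        · subst hu; simp
        · simp [hu]
    have hsub : (nbrs G U \ O).card ≤ (nbrs G U \ insert y O).card + 1 := by
      have : nbrs G U \ O ⊆ insert y (nbrs G U \ insert y O) := by
        intro v; simp only [mem_sdiff, mem_insert]; tauto
      exact (card_le_card this).trans (card_insert_le _ _)
    have hsU : s ∉ U := by
      intro hsU
      have : ∑ u ∈ U, Function.update f s (f s - 1) u + 1 = ∑ u ∈ U, f u := by
        rw [← add_sum_erase U _ hsU, ← add_sum_erase U f hsU]
        have : ∑ x ∈ U.erase s, Function.update f s (f s - 1) x = ∑ x ∈ U.erase s, f x :=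
          sum_congr rfl fun x hx => by simp [(mem_erase.1 hx).1]
        rw [this]; simp; omega
      omega
    have hyU : y ∈ nbrs G U := by
      by_contra hyU
      have : nbrs G U \ insert y O = nbrs G U \ O := by
        ext v; simp only [mem_sdiff, mem_insert]
        constructor
        · tauto
        · rintro ⟨h1, h2⟩; exact ⟨h1, by rintro (rfl | h3) <;> tauto⟩
      rw [this] at hlt; omega
    have hcrit : (nbrs G U \ O).card ≤ ∑ u ∈ U, f u := by omega
    refine ⟨U, ?_, hsU, hyU, hcrit⟩
    by_contra hge
    exact absurd (hlarge U (by omega) hU) (by omega)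
  -- The union of two tight sets of size below m is tight and has at most 2m members, so by `hlarge`
  -- its size is again below m. Hence one tight set can take the blame for all candidates.
  have key2 : ∀ Y : Finset V, (∀ y ∈ Y, y ∉ O ∧ G.Adj s y) →
      ∃ U : Finset V, U.card < m ∧ s ∉ U ∧ Y ⊆ nbrs G U ∧
      (nbrs G U \ O).card ≤ ∑ u ∈ U, f u := by
    intro Y
    induction Y using Finset.induction_on with
    | empty => intro _; exact ⟨∅, by simp; omega, by simp, by simp, by simp [nbrs]⟩
    | insert y Y _ ih =>
      intro hY
      obtain ⟨U, hU, hsU, hYU, hUc⟩ := ih fun z hz => hY z (mem_insert_of_mem hz)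
      obtain ⟨U', hU', hsU', hyU', hUc'⟩ :=
        key y (hY y (mem_insert_self _ _)).1 (hY y (mem_insert_self _ _)).2
      have hsubm := card_nbrs_union_add (G := G) (U := U) (U' := U') (O := O)
      have hint := h (U ∩ U') (by
        have := card_le_card (inter_subset_left : U ∩ U' ⊆ U); omega)
      have hsum := sum_union_inter (s₁ := U) (s₂ := U') (f := f)
      have hcr : (nbrs G (U ∪ U') \ O).card ≤ ∑ u ∈ U ∪ U', f u := by omega
      have hcard := card_union_le U U'
      refine ⟨U ∪ U', ?_, by simp [hsU, hsU'], ?_, hcr⟩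
      · by_contra hge
        exact absurd (hlarge (U ∪ U') (by omega) (by omega)) (by omega)
      · apply insert_subset
        · exact nbrs_mono subset_union_right hyU'
        · exact hYU.trans (nbrs_mono subset_union_left)
  obtain ⟨U, hU, hsU, hYU, hUc⟩ := key2 (univ.filter fun y => y ∉ O ∧ G.Adj s y) (by simp)
  -- All free neighbours of s are already neighbours of the tight set U, so adding s raises the
  -- demand without adding free neighbours.
  have h1 := h (insert s U) (by rw [card_insert_of_notMem hsU]; omega)
  rw [sum_insert hsU] at h1
  have : nbrs G (insert s U) \ O ⊆ nbrs G U \ O := by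
    intro v
    simp only [mem_sdiff, mem_nbrs, mem_insert]
    rintro ⟨⟨u, rfl | hu, huv⟩, hv⟩
    · have := hYU (by simp [hv, huv] : v ∈ _)
      exact ⟨by simpa using this, hv⟩
    · exact ⟨⟨u, hu, huv⟩, hv⟩
  have := card_le_card this
  omega

/-- Every two disjoint sets of size `m`, one of which lies in `V₁`, are joined by an edge. -/
def Joined {V : Type*} (G : SimpleGraph V) (m : ℕ) (V₁ : Finset V) : Prop :=
  ∀ A B : Finset V, A ⊆ V₁ → Disjoint A B → A.card = m → B.card = m → ∃ a ∈ A, ∃ b ∈ B, G.Adj a b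

/-- Fix m vertices of U. Fewer than m vertices of V₁ lie outside both these and N(U), since m of
them would have to be joined to the fixed ones. Hence the loss of at most 2m. -/
lemma Joined.card_le {m : ℕ} {V₁ : Finset V} (hJ : Joined G m V₁)
    {U : Finset V} (hU : m ≤ U.card) (O : Finset V) :
    (V₁ \ O).card ≤ (nbrs G U \ O).card + 2 * m := by
  obtain ⟨U', hU', hcard⟩ := exists_subset_card_eq hU
  have hlt : (V₁ \ (nbrs G U ∪ U')).card < m := by
    by_contra hge
    obtain ⟨A, hA, hAc⟩ := exists_subset_card_eq (not_lt.1 hge)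
    obtain ⟨a, ha, b, hb, hab⟩ := hJ A U' (fun x hx => (mem_sdiff.1 (hA hx)).1)
      (disjoint_left.2 fun x hx hx' => (mem_sdiff.1 (hA hx)).2 (mem_union_right _ hx')) hAc hcard
    exact (mem_sdiff.1 (hA ha)).2 (mem_union_left _ (mem_nbrs.2 ⟨b, hU' hb, hab.symm⟩))
  have hsub : V₁ \ O ⊆ (nbrs G U \ O) ∪ U' ∪ (V₁ \ (nbrs G U ∪ U')) := by
    intro v; simp only [mem_sdiff, mem_union]; tauto
  have h1 := card_le_card hsub
  have h2 := card_union_le ((nbrs G U \ O) ∪ U') (V₁ \ (nbrs G U ∪ U'))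
  have h3 := card_union_le (nbrs G U \ O) U'
  omega

/-- Ample room in V₁ yields the strict slack for sets of size between m and 2m, since their total
demand is at most 2mF. -/
lemma Joined.exists_extend {m F : ℕ} {V₁ : Finset V} (hJ : Joined G m V₁) (hm : 1 ≤ m)
    {O : Finset V} {f : V → ℕ} (h : Extendable G (2 * m) O f) (hf : ∀ v, f v ≤ F)
    (hroom : F * (2 * m) + 2 * m < (V₁ \ O).card) {s : V} (hs : 0 < f s) :
    ∃ y, y ∉ O ∧ G.Adj s y ∧
      Extendable G (2 * m) (insert y O) (Function.update f s (f s - 1)) := by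
  refine h.exists_extend hm (fun U hU hU' => ?_) hs
  have h1 := hJ.card_le hU O
  have h2 : ∑ u ∈ U, f u ≤ F * (2 * m) := by
    calc ∑ u ∈ U, f u ≤ ∑ _u ∈ U, F := sum_le_sum fun u _ => hf u
      _ = U.card * F := by simp
      _ ≤ F * (2 * m) := by rw [mul_comm]; exact Nat.mul_le_mul_left _ hU'
  omega

/-- A sufficient condition for extendability with constant demand. -/
lemma extendable_const_of_degree {M F : ℕ} {O : Finset V}
    (h : ∀ v, F * M ≤ (nbrs G {v} \ O).card) : Extendable G M O fun _ => F := by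
  intro U hU
  rcases U.eq_empty_or_nonempty with rfl | ⟨u, hu⟩
  · simp
  · calc ∑ _u ∈ U, F = F * U.card := by simp [mul_comm]
      _ ≤ F * M := Nat.mul_le_mul_left _ hU
      _ ≤ (nbrs G {u} \ O).card := h u
      _ ≤ _ := card_le_card (sdiff_subset_sdiff (nbrs_mono (by simpa using hu)) subset_rfl)

end Extend

/-- Top-down embedding of a rooted forest (parent function `par`, height function `h`). Vertices of
`S` are placed in the reserved part of `O₀` by a strategy that maintains the invariant `Inv`;
all other vertices are placed outside `O₀`. -/
lemma exists_embedding {V W : Type*} [Fintype V] [Fintype W] {G : SimpleGraph V} {m F : ℕ}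
    {V₁ : Finset V} (hJ : Joined G m V₁) (hm : 1 ≤ m)
    {O₀ : Finset V} (hO₀ : Extendable G (2 * m) O₀ fun _ => F)
    (par : W → W) (h : W → ℕ) (r : W) (C S : Finset W) (hrC : r ∈ C) (hrS : r ∈ S)
    (hpar : ∀ t ∈ C, t ≠ r → par t ∈ C ∧ h (par t) < h t)
    (hdeg : ∀ t ∈ C, (C.filter fun x => x ∉ S ∧ par x = t).card ≤ F)
    (hroom : F * (2 * m) + 2 * m + C.card < (V₁ \ O₀).card)
    (Inv : Finset W → (W → V) → Prop) (v₀ : V) (hv₀ : v₀ ∈ O₀)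
    (hInv₀ : Inv {r} fun _ => v₀)
    (hInv₁ : ∀ (s : Finset W) (φ : W → V) (t : W) (y : V), s ⊆ C → t ∈ C → t ∉ S → t ∉ s →
      par t ∈ s → y ∉ O₀ → Inv s φ → Inv (insert t s) (Function.update φ t y))
    (hInv₂ : ∀ (s : Finset W) (φ : W → V) (t : W), r ∈ s → s ⊆ C → t ∈ C → t ∈ S → t ∉ s →
      par t ∈ s → (∀ x ∈ s, x ∉ S → φ x ∉ O₀) → Inv s φ →
      ∃ y ∈ O₀, (∀ x ∈ s, x ∈ S → φ x ≠ y) ∧ G.Adj (φ (par t)) y ∧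
        Inv (insert t s) (Function.update φ t y)) :
    ∃ φ : W → V, Set.InjOn φ C ∧ (∀ t ∈ C, t ≠ r → G.Adj (φ (par t)) (φ t)) ∧
      (∀ t ∈ C, t ∉ S → φ t ∉ O₀) ∧ (∀ t ∈ C, t ∈ S → φ t ∈ O₀) ∧ Inv C φ ∧ φ r = v₀ ∧
      Extendable G (2 * m) (O₀ ∪ C.image φ)
        (fun v => F - (C.filter fun x => x ∉ S ∧ φ (par x) = v).card) := by
  -- Generalised to parent-closed sets, for induction on height: a member of maximal height has no
  -- child in the set and can be removed.
  suffices H : ∀ s : Finset W, s ⊆ C → r ∉ s → (∀ t ∈ s, par t ∈ insert r s) →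
      ∃ φ : W → V, Set.InjOn φ (insert r s : Finset W) ∧ (∀ t ∈ s, G.Adj (φ (par t)) (φ t)) ∧
      (∀ t ∈ s, t ∉ S → φ t ∉ O₀) ∧ (∀ t ∈ s, t ∈ S → φ t ∈ O₀) ∧ Inv (insert r s) φ ∧ φ r = v₀ ∧
      Extendable G (2 * m) (O₀ ∪ (insert r s).image φ)
        (fun v => F - (s.filter fun x => x ∉ S ∧ φ (par x) = v).card) by
    obtain ⟨φ, h1, h2, h3, h4, h5, h6, h7⟩ := H (C.erase r) (erase_subset _ _) (by simp) (by
      intro t ht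
      rw [insert_erase hrC]
      exact (hpar t (mem_erase.1 ht).2 (mem_erase.1 ht).1).1)
    rw [insert_erase hrC] at h1 h5 h7
    refine ⟨φ, h1, fun t ht htr => h2 t (mem_erase.2 ⟨htr, ht⟩),
      fun t ht htS => h3 t (mem_erase.2 ⟨fun e => htS (e ▸ hrS), ht⟩) htS, fun t ht htS => ?_,
      h5, h6, h7.mono fun v => ?_⟩
    · by_cases htr : t = r
      · rw [htr, h6]; exact hv₀
      · exact h4 t (mem_erase.2 ⟨htr, ht⟩) htS
    · apply Nat.sub_le_sub_left
      apply card_le_card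
      intro x
      simp only [mem_filter, mem_erase]
      tauto
  intro s
  induction s using Finset.induction_on_max_value h with
  | empty =>
    intro _ _ _
    refine ⟨fun _ => v₀, by simp, by simp, by simp, by simp, by simpa using hInv₀, rfl, ?_⟩
    have : O₀ ∪ (insert r ∅ : Finset W).image (fun _ => v₀) = O₀ := by
      simp [hv₀]
    rw [this]
    exact hO₀.mono fun v => by simp
  | insert t s hts hmax ih =>
    intro hsC hrs hcl
    have htC : t ∈ C := hsC (mem_insert_self _ _)
    have hsC' : s ⊆ C := fun x hx => hsC (mem_insert_of_mem hx)
    have htr : t ≠ r := fun e => hrs (e ▸ mem_insert_self _ _)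
    have hrs' : r ∉ s := fun hx => hrs (mem_insert_of_mem hx)
    have hpt : par t ∈ insert r s := by
      have h1 := hcl t (mem_insert_self _ _)
      have h2 : par t ≠ t := fun e => by have := (hpar t htC htr).2; rw [e] at this; omega
      simp only [mem_insert] at h1 ⊢; tauto
    have hcl' : ∀ x ∈ s, par x ∈ insert r s := by
      intro x hx
      have h1 := hcl x (mem_insert_of_mem hx)
      have hxr : x ≠ r := fun e => hrs' (e ▸ hx)
      have h2 : par x ≠ t := fun e => by
        have := (hpar x (hsC' hx) hxr).2; rw [e] at this; have := hmax x hx; omega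
      simp only [mem_insert] at h1 ⊢; tauto
    obtain ⟨φ, h1, h2, h3, h4, h5, h6, h7⟩ := ih hsC' hrs' hcl'
    have hrsC : insert r s ⊆ C := insert_subset hrC hsC'
    have htrs : t ∉ insert r s := by simp [htr, hts]
    have hupd : ∀ y, ∀ x ∈ insert r s, Function.update φ t y x = φ x := by
      intro y x hx
      exact Function.update_of_ne (fun e => htrs (by rw [← e]; exact hx)) _ _
    have hins : insert r (insert t s) = insert t (insert r s) := by
      ext; simp only [mem_insert]; tauto
    have himg : ∀ y, (insert r (insert t s)).image (Function.update φ t y) =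
        insert y ((insert r s).image φ) := by
      intro y
      rw [hins, image_insert, Function.update_self]
      congr 1
      exact image_congr fun x hx => hupd y x hx
    have hinj : ∀ y, (∀ x ∈ insert r s, φ x ≠ y) →
        Set.InjOn (Function.update φ t y) (insert r (insert t s) : Finset W) := by
      intro y hy
      rw [hins]
      intro a ha b hb hab
      rw [mem_coe, mem_insert] at ha hb
      rcases ha with rfl | ha <;> rcases hb with rfl | hb
      · rfl
      · rw [Function.update_self, hupd y b hb] at hab
        exact absurd hab.symm (hy b hb)
      · rw [Function.update_self, hupd y a ha] at hab
        exact absurd hab (hy a ha)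
      · rw [hupd y a ha, hupd y b hb] at hab
        exact h1 ha hb hab
    have hadj : ∀ y, G.Adj (φ (par t)) y → ∀ x ∈ insert t s,
        G.Adj (Function.update φ t y (par x)) (Function.update φ t y x) := by
      intro y hy x hx
      rcases mem_insert.1 hx with rfl | hx
      · rw [hupd y _ hpt, Function.update_self]; exact hy
      · rw [hupd y _ (hcl' x hx), hupd y x (mem_insert_of_mem hx)]; exact h2 x hx
    have hroot : ∀ y, Function.update φ t y r = v₀ := fun y => by
      rw [hupd y r (mem_insert_self _ _), h6]
    have hfilt : ∀ y v, (s.filter fun x => x ∉ S ∧ Function.update φ t y (par x) = v) =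
        s.filter fun x => x ∉ S ∧ φ (par x) = v := by
      intro y v
      apply filter_congr
      intro x hx
      rw [hupd y _ (hcl' x hx)]
    by_cases htS : t ∈ S
    · have hx3 : ∀ x ∈ insert r s, x ∉ S → φ x ∉ O₀ := by
        intro x hx hxS
        rcases mem_insert.1 hx with rfl | hx
        · exact absurd hrS hxS
        · exact h3 x hx hxS
      obtain ⟨y, hyO, hyne, hyadj, hyInv⟩ := hInv₂ (insert r s) φ t (mem_insert_self _ _) hrsC htC
        htS htrs hpt hx3 h5
      refine ⟨Function.update φ t y, hinj y ?_, hadj y hyadj, ?_, ?_, by rwa [hins], hroot y, ?_⟩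
      · intro x hx
        by_cases hxS : x ∈ S
        · exact hyne x hx hxS
        · exact fun e => hx3 x hx hxS (e ▸ hyO)
      · intro x hx hxS
        rcases mem_insert.1 hx with rfl | hx
        · exact absurd htS hxS
        · rw [hupd y x (mem_insert_of_mem hx)]; exact h3 x hx hxS
      · intro x hx hxS
        rcases mem_insert.1 hx with rfl | hx
        · rw [Function.update_self]; exact hyO
        · rw [hupd y x (mem_insert_of_mem hx)]; exact h4 x hx hxS
      -- A vertex of S lands in O₀, which counted as occupied from the start, so neither the
      -- occupied set nor the demand changes.
      · rw [himg y]
        have : O₀ ∪ insert y ((insert r s).image φ) = O₀ ∪ (insert r s).image φ := by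
          ext v; simp only [mem_union, mem_insert]
          constructor
          · rintro (h | rfl | h)
            · exact Or.inl h
            · exact Or.inl hyO
            · exact Or.inr h
          · tauto
        rw [this]
        refine h7.mono fun v => Nat.sub_le_sub_left ?_ _
        rw [← hfilt y v]
        exact card_le_card (filter_subset_filter _ (subset_insert _ _))
    -- The child t is counted in `hdeg` but not yet embedded, so the image of its parent still has
    -- positive demand.
    · have hcount : (s.filter fun x => x ∉ S ∧ φ (par x) = φ (par t)).card < F := by
        refine lt_of_lt_of_le ?_ (hdeg (par t) (hrsC hpt))
        apply card_lt_card
        rw [ssubset_iff_of_subset]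
        · refine ⟨t, by simp [htC, htS], by simp [hts]⟩
        · intro x hx
          simp only [mem_filter] at hx ⊢
          exact ⟨hsC' hx.1, hx.2.1, h1 (hcl' x hx.1) hpt hx.2.2⟩
      have hroom' : F * (2 * m) + 2 * m < (V₁ \ (O₀ ∪ (insert r s).image φ)).card := by
        have e : V₁ \ (O₀ ∪ (insert r s).image φ) = (V₁ \ O₀) \ (insert r s).image φ := by
          ext; simp only [mem_sdiff, mem_union]; tauto
        have e1 := le_card_sdiff ((insert r s).image φ) (V₁ \ O₀)
        have e2 : ((insert r s).image φ).card ≤ C.card := card_image_le.trans (card_le_card hrsC)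
        rw [e]; omega
      obtain ⟨y, hyO, hyadj, hyE⟩ := hJ.exists_extend hm h7 (fun v => Nat.sub_le _ _) hroom'
        (s := φ (par t)) (by omega)
      rw [mem_union, not_or] at hyO
      have hyne : ∀ x ∈ insert r s, φ x ≠ y := fun x hx e =>
        hyO.2 (e ▸ mem_image_of_mem φ hx)
      refine ⟨Function.update φ t y, hinj y hyne, hadj y hyadj, ?_, ?_, ?_, hroot y, ?_⟩
      · intro x hx hxS
        rcases mem_insert.1 hx with rfl | hx
        · rw [Function.update_self]; exact hyO.1
        · rw [hupd y x (mem_insert_of_mem hx)]; exact h3 x hx hxS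
      · intro x hx hxS
        rcases mem_insert.1 hx with rfl | hx
        · exact absurd hxS htS
        · rw [hupd y x (mem_insert_of_mem hx)]; exact h4 x hx hxS
      · rw [hins]; exact hInv₁ (insert r s) φ t y hrsC htC htS htrs hpt hyO.1 h5
      · rw [himg y]
        have : O₀ ∪ insert y ((insert r s).image φ) = insert y (O₀ ∪ (insert r s).image φ) := by
          ext v; simp only [mem_union, mem_insert]; tauto
        rw [this]
        refine hyE.mono fun v => ?_
        rw [filter_insert]
        by_cases hv : φ (par t) = v
        · subst hv
          rw [if_pos ⟨htS, hupd y _ hpt⟩, card_insert_of_notMem (by simp [hts]), hfilt,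
            Function.update_self]
          omega
        · rw [if_neg (by rw [hupd y _ hpt]; tauto), hfilt, Function.update_of_ne (Ne.symm hv)]

end TreeUniversality

/-! ### Connecting paths of prescribed lengths -/

namespace TreeUniversality

open Finset
open scoped Classical

section Connect

variable {V : Type*}

/-- Demand `m` at the vertices of `A`, and none elsewhere. -/
noncomputable def demandOn (m : ℕ) (A : Finset V) : V → ℕ := fun v => if v ∈ A then m else 0

lemma card_sdiff_union_ge (V₁ O P : Finset V) :
    (V₁ \ O).card ≤ (V₁ \ (O ∪ P)).card + P.card := by
  have e : V₁ \ (O ∪ P) = (V₁ \ O) \ P := by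
    ext; simp only [mem_sdiff, mem_union]; tauto
  have e1 := le_card_sdiff P (V₁ \ O)
  rw [e]; omega

variable [Fintype V] {G : SimpleGraph V}

lemma Joined.exists_leaves {m F : ℕ} {V₁ : Finset V} (hJ : Joined G m V₁) (hm : 1 ≤ m)
    {O : Finset V} {f : V → ℕ} (h : Extendable G (2 * m) O f) (hf : ∀ v, f v ≤ F) {s : V} (j : ℕ)
    (hroom : F * (2 * m) + 2 * m + j < (V₁ \ O).card) (hs : j ≤ f s) :
    ∃ P : Finset V, P.card = j ∧ (∀ p ∈ P, p ∉ O ∧ G.Adj s p) ∧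
      Extendable G (2 * m) (O ∪ P) (Function.update f s (f s - j)) := by
  induction j with
  | zero => exact ⟨∅, by simp, by simp, by simpa using h⟩
  | succ j ih =>
    obtain ⟨P, hPc, hP, hE⟩ := ih (by omega) (by omega)
    have h1 := card_sdiff_union_ge V₁ O P
    obtain ⟨y, hy, hsy, hE'⟩ := hJ.exists_extend hm hE (F := F) (fun v => by
      by_cases hv : v = s
      · subst hv; simp only [Function.update_self]; have := hf v; omega
      · simp only [Function.update_of_ne hv]; exact hf v) (by omega) (s := s) (by simp; omega)
    rw [mem_union, not_or] at hy
    refine ⟨insert y P, by rw [card_insert_of_notMem hy.2, hPc], ?_, ?_⟩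
    · intro p hp
      rcases mem_insert.1 hp with rfl | hp
      · exact ⟨hy.1, hsy⟩
      · exact hP p hp
    · rw [union_insert]
      refine hE'.mono fun v => ?_
      by_cases hv : v = s
      · subst hv; simp only [Function.update_self]; omega
      · simp [Function.update_of_ne hv]

/-- Two active vertices are connected by a path with two new interior vertices. -/
lemma Joined.exists_connect {m : ℕ} {V₁ : Finset V} (hJ : Joined G m V₁) (hm : 1 ≤ m)
    {O A : Finset V} (h : Extendable G (2 * m) O (demandOn m A)) (hO : ∀ v, v ∉ O → v ∈ V₁)
    {a b : V} (ha : a ∈ A) (hb : b ∈ A) (hab : a ≠ b)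
    (hroom : 2 * m * m + 4 * m < (V₁ \ O).card) :
    ∃ p q, p ∉ O ∧ q ∉ O ∧ p ≠ q ∧ G.Adj a p ∧ G.Adj p q ∧ G.Adj q b ∧
      Extendable G (2 * m) (O ∪ {p, q}) (demandOn m (A \ {a, b})) := by
  have hring : m * (2 * m) = 2 * m * m := by ring
  have hle : ∀ v, demandOn m A v ≤ m := fun v => by unfold demandOn; split_ifs <;> simp
  obtain ⟨P, hPc, hP, hE⟩ := hJ.exists_leaves hm h hle (s := a) m (by omega)
    (by simp [demandOn, ha])
  have h1 := card_sdiff_union_ge V₁ O P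
  obtain ⟨Q, hQc, hQ, hE'⟩ := hJ.exists_leaves hm hE (F := m) (fun v => by
      by_cases hv : v = a
      · subst hv; simp only [Function.update_self]; have := hle v; omega
      · simp only [Function.update_of_ne hv]; exact hle v) (s := b) m (by omega)
      (by simp [demandOn, hb, hab.symm])
  have hdisj : Disjoint P Q := disjoint_left.2 fun x hx hx' =>
    (hQ x hx').1 (mem_union_right _ hx)
  obtain ⟨p, hp, q, hq, hpq⟩ := hJ P Q (fun x hx => hO x (hP x hx).1) hdisj hPc hQc
  have hqO : q ∉ O := fun hh => (hQ q hq).1 (mem_union_left _ hh)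
  refine ⟨p, q, (hP p hp).1, hqO, fun e => disjoint_left.1 hdisj hp (e ▸ hq), (hP p hp).2, hpq,
    (hQ q hq).2.symm, ?_⟩
  intro U hU
  have h2 := hE' U hU
  have ha' : (if a ∈ U then m - 1 else 0) ≤ (nbrs G U ∩ P.erase p).card := by
    split_ifs with haU
    · rw [← hPc, ← card_erase_of_mem hp]
      apply card_le_card
      intro x hx
      exact mem_inter.2 ⟨mem_nbrs.2 ⟨a, haU, (hP x (mem_of_mem_erase hx)).2⟩, hx⟩
    · simp
  have hb' : (if b ∈ U then m - 1 else 0) ≤ (nbrs G U ∩ Q.erase q).card := by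
    split_ifs with hbU
    · rw [← hQc, ← card_erase_of_mem hq]
      apply card_le_card
      intro x hx
      exact mem_inter.2 ⟨mem_nbrs.2 ⟨b, hbU, (hQ x (mem_of_mem_erase hx)).2⟩, hx⟩
    · simp
  have hsum : ∑ u ∈ U, demandOn m (A \ {a, b}) u ≤
      ∑ u ∈ U, Function.update (Function.update (demandOn m A) a (demandOn m A a - m)) b
        (Function.update (demandOn m A) a (demandOn m A a - m) b - m) u := by
    apply sum_le_sum
    intro u _
    by_cases h1 : u = b
    · subst h1; simp [demandOn]
    · by_cases h2 : u = a
      · subst h2; simp [demandOn]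
      · rw [Function.update_of_ne h1, Function.update_of_ne h2]
        simp [demandOn, h1, h2]
  -- Only p and q of the 2m auxiliary leaves stay occupied. Releasing the others merely enlarges
  -- free neighbourhoods, and a and b have no demand left.
  have hsub : nbrs G U \ (O ∪ P ∪ Q) ⊆ nbrs G U \ (O ∪ {p, q}) := by
    intro x
    simp only [mem_sdiff, mem_union, mem_insert, mem_singleton]
    rintro ⟨h1, h2⟩
    refine ⟨h1, ?_⟩
    rintro (h3 | rfl | rfl) <;> tauto
  exact hsum.trans (h2.trans (card_le_card hsub))

/-- The path grows from a by j vertices, and a connection with two interior vertices finishes it.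
Every vertex left behind becomes inactive, while `hA` keeps each fresh vertex active when it is
reached. -/
lemma Joined.exists_path {m : ℕ} {V₁ : Finset V} (hJ : Joined G m V₁) (hm : 1 ≤ m) (j : ℕ)
    {O A : Finset V} (h : Extendable G (2 * m) O (demandOn m A)) (hO : ∀ v, v ∉ O → v ∈ V₁)
    (hA : ∀ v, v ∉ O → v ∈ A) {a b : V} (ha : a ∈ A) (haO : a ∈ O) (hb : b ∈ A) (hbO : b ∈ O)
    (hab : a ≠ b) (hroom : 2 * m * m + 4 * m + j < (V₁ \ O).card) :
    ∃ l : List V, l.length = j + 2 ∧ l.Nodup ∧ (∀ v ∈ l, v ∉ O) ∧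
      (a :: l ++ [b]).IsChain G.Adj ∧
      Extendable G (2 * m) (O ∪ l.toFinset) (demandOn m ((A \ {a, b}) \ l.toFinset)) := by
  have hring : m * (2 * m) = 2 * m * m := by ring
  induction j generalizing O A a with
  | zero =>
    obtain ⟨p, q, hp, hq, hpq, h1, h2, h3, hE⟩ := hJ.exists_connect hm h hO ha hb hab (by omega)
    refine ⟨[p, q], rfl, by simp [hpq], by simp [hp, hq], by simp [h1, h2, h3], ?_⟩
    have : [p, q].toFinset = {p, q} := by ext; simp
    rw [this]
    refine hE.mono fun v => ?_
    simp only [demandOn]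
    split_ifs with h1 h2
    · exact le_rfl
    · exact absurd (mem_sdiff.1 h1).1 h2
    · simp
    · simp
  | succ j ih =>
    obtain ⟨y, hy, hay, hE⟩ := hJ.exists_extend hm h (F := m) (s := a)
      (fun v => by unfold demandOn; split_ifs <;> simp) (by omega) (by simp [demandOn, ha]; omega)
    have hyb : y ≠ b := fun e => hy (e ▸ hbO)
    have hya : y ≠ a := fun e => G.loopless.irrefl _ (e ▸ hay)
    have hE1 : Extendable G (2 * m) (insert y O) (demandOn m (A \ {a})) := by
      refine hE.mono fun v => ?_
      by_cases hv : v = a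
      · subst hv; simp [demandOn]
      · rw [Function.update_of_ne hv]
        simp [demandOn, hv]
    have h1 := card_sdiff_union_ge V₁ O {y}
    rw [union_comm, ← insert_eq, card_singleton] at h1
    obtain ⟨l, hl1, hl2, hl3, hl4, hl5⟩ := ih (O := insert y O) (A := A \ {a}) (a := y) hE1
      (fun v hv => hO v fun hh => hv (mem_insert_of_mem hh))
      (fun v hv => by
        rw [mem_insert, not_or] at hv
        simp only [mem_sdiff, mem_singleton]
        exact ⟨hA v hv.2, fun e => hv.2 (e ▸ haO)⟩)
      (by simp [hA y hy, hya]) (mem_insert_self _ _) (by simp [hb, hab.symm])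
      (mem_insert_of_mem hbO) hyb (by omega)
    refine ⟨y :: l, by simp [hl1], ?_, ?_, ?_, ?_⟩
    · exact List.nodup_cons.2 ⟨fun hh => hl3 y hh (mem_insert_self _ _), hl2⟩
    · intro v hv
      rcases List.mem_cons.1 hv with rfl | hv
      · exact hy
      · exact fun hh => hl3 v hv (mem_insert_of_mem hh)
    · simp only [List.cons_append, List.isChain_cons_cons] at hl4 ⊢
      exact ⟨hay, hl4⟩
    · have e : O ∪ (y :: l).toFinset = insert y O ∪ l.toFinset := by
        ext; simp only [List.toFinset_cons, mem_union, mem_insert]; tauto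
      rw [e]
      refine hl5.mono fun v => ?_
      have : (A \ {a, b}) \ (y :: l).toFinset ⊆ ((A \ {a}) \ {y, b}) \ l.toFinset := by
        intro x
        simp only [mem_sdiff, mem_insert, mem_singleton, List.toFinset_cons]; tauto
      simp only [demandOn]
      split_ifs with h1 h2
      · exact le_rfl
      · exact absurd (this h1) h2
      · simp
      · simp

/-- Disjoint connecting paths of prescribed lengths for a family of requests. -/
lemma Joined.exists_paths {ι : Type*} {m : ℕ} {V₁ : Finset V} (hJ : Joined G m V₁) (hm : 1 ≤ m)
    (a b : ι → V) (j : ι → ℕ) (I : Finset ι) {O A : Finset V}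
    (h : Extendable G (2 * m) O (demandOn m A)) (hO : ∀ v, v ∉ O → v ∈ V₁)
    (hA : ∀ v, v ∉ O → v ∈ A)
    (ha : ∀ i ∈ I, a i ∈ A ∧ a i ∈ O) (hb : ∀ i ∈ I, b i ∈ A ∧ b i ∈ O) (hab : ∀ i ∈ I, a i ≠ b i)
    (hne : ∀ i ∈ I, ∀ k ∈ I, i ≠ k → a i ≠ a k ∧ a i ≠ b k ∧ b i ≠ b k)
    (hroom : 2 * m * m + 4 * m + ∑ i ∈ I, (j i + 2) < (V₁ \ O).card) :
    ∃ l : ι → List V, (∀ i ∈ I, (l i).length = j i + 2 ∧ (l i).Nodup ∧ (∀ v ∈ l i, v ∉ O) ∧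
      (a i :: l i ++ [b i]).IsChain G.Adj) ∧
      ∀ i ∈ I, ∀ k ∈ I, i ≠ k → ∀ v ∈ l i, v ∉ l k := by
  induction I using Finset.induction_on generalizing O A with
  | empty => exact ⟨fun _ => [], by simp, by simp⟩
  | insert i I hi ih =>
    rw [sum_insert hi] at hroom
    have hiI := mem_insert_self i I
    obtain ⟨p, hp1, hp2, hp3, hp4, hp5⟩ := hJ.exists_path hm (j i) h hO hA (ha i hiI).1 (ha i hiI).2
      (hb i hiI).1 (hb i hiI).2 (hab i hiI) (by omega)
    have h1 := card_sdiff_union_ge V₁ O p.toFinset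
    have h2 : p.toFinset.card = j i + 2 := by rw [List.toFinset_card_of_nodup hp2, hp1]
    have hact : ∀ v, v ∈ A → v ∈ O → v ≠ a i → v ≠ b i →
        v ∈ (A \ {a i, b i}) \ p.toFinset := by
      intro v hvA hvO h1 h2
      simp only [mem_sdiff, mem_insert, mem_singleton, List.mem_toFinset]
      exact ⟨⟨hvA, by tauto⟩, fun hh => hp3 v hh hvO⟩
    obtain ⟨l, hl1, hl2⟩ := ih (O := O ∪ p.toFinset) (A := (A \ {a i, b i}) \ p.toFinset) hp5
      (fun v hv => hO v fun hh => hv (mem_union_left _ hh))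
      (fun v hv => by
        rw [mem_union, not_or] at hv
        simp only [mem_sdiff, mem_insert, mem_singleton]
        refine ⟨⟨hA v hv.1, ?_⟩, hv.2⟩
        rintro (rfl | rfl)
        · exact hv.1 (ha i hiI).2
        · exact hv.1 (hb i hiI).2)
      (fun k hk => by
        have hik : i ≠ k := fun e => hi (e ▸ hk)
        have hkI := mem_insert_of_mem (b := i) hk
        exact ⟨hact _ (ha k hkI).1 (ha k hkI).2 (hne i hiI k hkI hik).1.symm
          (hne k hkI i hiI hik.symm).2.1, mem_union_left _ (ha k hkI).2⟩)
      (fun k hk => by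
        have hik : i ≠ k := fun e => hi (e ▸ hk)
        have hkI := mem_insert_of_mem (b := i) hk
        exact ⟨hact _ (hb k hkI).1 (hb k hkI).2 (hne i hiI k hkI hik).2.1.symm
          (hne i hiI k hkI hik).2.2.symm, mem_union_left _ (hb k hkI).2⟩)
      (fun k hk => hab k (mem_insert_of_mem hk))
      (fun k hk k' hk' => hne k (mem_insert_of_mem hk) k' (mem_insert_of_mem hk'))
      (by omega)
    have hupd : ∀ k ∈ I, Function.update l i p k = l k := fun k hk =>
      Function.update_of_ne (fun e => hi (by rw [← e]; exact hk)) _ _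
    have hnew : ∀ k ∈ I, ∀ v ∈ l k, v ∉ O ∧ v ∉ p := fun k hk v hv => by
      have := (hl1 k hk).2.2.1 v hv
      simpa [not_or] using this
    refine ⟨Function.update l i p, ?_, ?_⟩
    · intro k hk
      rcases mem_insert.1 hk with rfl | hk
      · rw [Function.update_self]; exact ⟨hp1, hp2, hp3, hp4⟩
      · rw [hupd k hk]
        exact ⟨(hl1 k hk).1, (hl1 k hk).2.1, fun v hv => (hnew k hk v hv).1, (hl1 k hk).2.2.2⟩
    · intro k hk k' hk' hkk'
      rcases mem_insert.1 hk with rfl | h1 <;> rcases mem_insert.1 hk' with rfl | h2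
      · exact absurd rfl hkk'
      · rw [Function.update_self, hupd k' h2]
        exact fun v hv hv' => (hnew k' h2 v hv').2 hv
      · rw [Function.update_self, hupd k h1]
        exact fun v hv => (hnew k h1 v hv).2
      · rw [hupd k h1, hupd k' h2]; exact hl2 k h1 k' h2 hkk'

end Connect
end TreeUniversality

/-! ### Rooted trees, degree counts and bare paths -/

namespace TreeUniversality

open Finset
open scoped Classical

/-- The tree `T` rooted at `r`, with parent function `par` and height function `h`. -/
structure Rooting {W : Type*} (T : SimpleGraph W) (r : W) (par : W → W) (h : W → ℕ) : Prop where
  par_root : par r = r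
  height_root : h r = 0
  adj : ∀ t, t ≠ r → T.Adj (par t) t
  height : ∀ t, t ≠ r → h t = h (par t) + 1
  edge : ∀ a b, T.Adj a b → (a ≠ r ∧ par a = b) ∨ (b ≠ r ∧ par b = a)

section Rooting

variable {W : Type*} {T : SimpleGraph W}

/-- The height is the distance to r. A neighbour closer to r exists on a geodesic, and it is unique
because two of them would give two different paths to r. -/
lemma exists_rooting (hT : T.IsTree) (r : W) : ∃ par h, Rooting T r par h := by
  have hex : ∀ t, t ≠ r → ∃ u, T.Adj u t ∧ T.dist t r = T.dist u r + 1 := by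
    intro t htr
    obtain ⟨p, hp⟩ := hT.connected.exists_walk_length_eq_dist t r
    cases p with
    | nil => exact absurd rfl htr
    | @cons _ u _ hadj p =>
      refine ⟨u, hadj.symm, ?_⟩
      rw [SimpleGraph.Walk.length_cons] at hp
      have h1 := SimpleGraph.dist_le p
      have h2 := hT.dist_eq_dist_add_one_of_adj r hadj
      rw [SimpleGraph.dist_comm (u := r), SimpleGraph.dist_comm (u := r)] at h2
      omega
  have huniq : ∀ t u u', T.Adj u t → T.Adj u' t → T.dist t r = T.dist u r + 1 →
      T.dist t r = T.dist u' r + 1 → u = u' := by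
    intro t u u' h1 h2 h3 h4
    obtain ⟨p, hp⟩ := hT.connected.exists_walk_length_eq_dist u r
    obtain ⟨p', hp'⟩ := hT.connected.exists_walk_length_eq_dist u' r
    have hP : (SimpleGraph.Walk.cons h1.symm p).IsPath :=
      SimpleGraph.Walk.isPath_of_length_eq_dist _ (by simp [hp, h3])
    have hP' : (SimpleGraph.Walk.cons h2.symm p').IsPath :=
      SimpleGraph.Walk.isPath_of_length_eq_dist _ (by simp [hp', h4])
    have := (hT.isAcyclic.subsingleton_path t r).elim ⟨_, hP⟩ ⟨_, hP'⟩
    have := congrArg (fun q : T.Path t r => q.1.snd) this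
    simpa using this
  choose! par hpar using hex
  refine ⟨fun t => if t = r then r else par t, fun t => T.dist t r, by simp, by simp, ?_, ?_, ?_⟩
  · intro t ht; simp only [if_neg ht]; exact (hpar t ht).1
  · intro t ht; simp only [if_neg ht]; exact (hpar t ht).2
  · intro a b hab
    have h2 := hT.dist_eq_dist_add_one_of_adj r hab
    rw [SimpleGraph.dist_comm (u := r), SimpleGraph.dist_comm (u := r)] at h2
    rcases h2 with h2 | h2
    · left
      have har : a ≠ r := by rintro rfl; simp at h2
      refine ⟨har, ?_⟩
      simp only [if_neg har]
      exact huniq a _ _ (hpar a har).1 hab.symm (hpar a har).2 h2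
    · right
      have hbr : b ≠ r := by rintro rfl; simp at h2
      refine ⟨hbr, ?_⟩
      simp only [if_neg hbr]
      exact huniq b _ _ (hpar b hbr).1 hab (hpar b hbr).2 h2

variable {r : W} {par : W → W} {h : W → ℕ} [Fintype W]

lemma Rooting.card_children_le (R : Rooting T r par h) (x : W) :
    (univ.filter fun t => t ≠ r ∧ par t = x).card ≤ degIn T x univ := by
  apply card_le_card
  intro t
  simp only [mem_filter, mem_univ, true_and]
  rintro ⟨ht, rfl⟩
  exact R.adj t ht

lemma Rooting.card_children_lt (R : Rooting T r par h) {x : W} (hx : x ≠ r) :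
    (univ.filter fun t => t ≠ r ∧ par t = x).card < degIn T x univ := by
  apply card_lt_card
  rw [ssubset_iff_of_subset]
  · refine ⟨par x, by simpa using (R.adj x hx).symm, ?_⟩
    simp only [mem_filter, mem_univ, true_and, not_and]
    intro h1 h2
    have := R.height x hx
    have := R.height _ h1
    rw [h2] at this
    omega
  · intro t
    simp only [mem_filter, mem_univ, true_and]
    rintro ⟨ht, rfl⟩
    exact R.adj t ht

lemma Rooting.child_unique (R : Rooting T r par h) {x t t' : W} (hx : degIn T x univ = 2)
    (hxr : x ≠ r) (ht : t ≠ r) (ht' : t' ≠ r) (h1 : par t = x) (h2 : par t' = x) : t = t' := by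
  have := R.card_children_lt hxr
  rw [hx] at this
  exact card_le_one.1 (Nat.lt_succ_iff.1 this) t (by simp [ht, h1]) t' (by simp [ht', h2])

/-- A non-root vertex of degree two has only one child, so a walk up through such vertices can be
retraced. The root is a leaf and therefore never one of them. -/
lemma Rooting.iterate_injective (R : Rooting T r par h) (hr : degIn T r univ = 1) (i : ℕ) {t t' : W}
    (hd : ∀ j, 1 ≤ j → j ≤ i → degIn T (par^[j] t) univ = 2) (he : par^[i] t = par^[i] t') :
    t = t' := by
  induction i with
  | zero => simpa using he
  | succ i ih =>
    apply ih (fun j h1 h2 => hd j h1 (by omega))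
    have h2 := hd (i + 1) (by omega) le_rfl
    have h2' := h2
    rw [he] at h2'
    rw [Function.iterate_succ_apply'] at h2 h2' he
    rw [Function.iterate_succ_apply'] at he
    have hne : ∀ x, degIn T (par x) univ = 2 → x ≠ r := by
      rintro x hx rfl
      rw [R.par_root] at hx; omega
    exact R.child_unique h2 (fun e => by rw [e] at h2; omega) (hne _ h2) (hne _ h2') rfl he.symm

lemma degIn_univ_eq_degree [DecidableRel T.Adj] (t : W) : degIn T t univ = T.degree t := by
  rw [← SimpleGraph.card_neighborFinset_eq_degree, SimpleGraph.neighborFinset_eq_filter]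
  unfold degIn
  congr 1
  ext; simp

lemma sum_degIn_of_isTree (hT : T.IsTree) :
    ∑ t, degIn T t univ + 2 = 2 * Fintype.card W := by
  have h1 := T.sum_degrees_eq_twice_card_edges
  have h2 := hT.card_edgeFinset
  rw [sum_congr rfl fun t _ => degIn_univ_eq_degree (T := T) t, h1]
  omega

lemma degIn_pos_of_isTree (hT : T.IsTree) (hcard : 2 ≤ Fintype.card W) (t : W) :
    1 ≤ degIn T t univ := by
  have : Nontrivial W := Fintype.one_lt_card_iff_nontrivial.1 hcard
  rw [degIn_univ_eq_degree]
  exact hT.connected.preconnected.degree_pos_of_nontrivial t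

/-- The leaves of `T`. -/
noncomputable def leafSet (T : SimpleGraph W) : Finset W := univ.filter fun t => degIn T t univ = 1

/-- The sum of deg − 2 over a tree is −2. Both bounds sum a pointwise inequality: the indicator of
deg ≠ 2 is at most (deg − 2) + 2·[deg = 1], and deg times that indicator is at most 3(deg − 2) +
4·[deg = 1]. -/
lemma card_not_deg_two_le (hT : T.IsTree) (hcard : 2 ≤ Fintype.card W) :
    (univ.filter fun t => degIn T t univ ≠ 2).card ≤ 2 * (leafSet T).card ∧
    ∑ t ∈ univ.filter (fun t => degIn T t univ ≠ 2), degIn T t univ ≤ 4 * (leafSet T).card := by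
  have hs := sum_degIn_of_isTree hT
  have hp := degIn_pos_of_isTree hT hcard
  have hs' : ∑ t, ((degIn T t univ : ℤ) - 2) = -2 := by
    rw [sum_sub_distrib]
    simp only [sum_const, card_univ, nsmul_eq_mul]
    have : ((∑ t, degIn T t univ : ℕ) : ℤ) + 2 = 2 * Fintype.card W := by exact_mod_cast hs
    push_cast at this
    linarith
  have hL : ∑ t, (if degIn T t univ = 1 then (1 : ℤ) else 0) = (leafSet T).card := by
    rw [leafSet, card_filter]; push_cast; rfl
  constructor
  · rw [← Nat.cast_le (α := ℤ), card_filter]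
    push_cast
    calc ∑ t, (if degIn T t univ ≠ 2 then (1 : ℤ) else 0)
        ≤ ∑ t, (((degIn T t univ : ℤ) - 2) + 2 * (if degIn T t univ = 1 then (1 : ℤ) else 0)) := by
          apply sum_le_sum
          intro t _
          have := hp t
          split_ifs <;> omega
      _ ≤ 2 * ((leafSet T).card : ℤ) := by rw [sum_add_distrib, ← mul_sum, hs', hL]; linarith
  · rw [← Nat.cast_le (α := ℤ), sum_filter]
    push_cast
    calc ∑ t, (if degIn T t univ ≠ 2 then (degIn T t univ : ℤ) else 0)
        ≤ ∑ t, (3 * ((degIn T t univ : ℤ) - 2) +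
            4 * (if degIn T t univ = 1 then (1 : ℤ) else 0)) := by
          apply sum_le_sum
          intro t _
          have := hp t
          split_ifs <;> omega
      _ ≤ 4 * ((leafSet T).card : ℤ) := by
        rw [sum_add_distrib, ← mul_sum, ← mul_sum, hs', hL]; linarith

/-- A tree with few leaves has many disjoint bare paths with `k + 1` vertices. -/
lemma Rooting.exists_bare_paths (R : Rooting T r par h) (hT : T.IsTree)
    (hcard : 2 ≤ Fintype.card W) (hr : degIn T r univ = 1) (k : ℕ)
    (hL : 2 * ((k + 1) * (7 * (leafSet T).card)) ≤ Fintype.card W) :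
    ∃ J : Finset W, Fintype.card W ≤ 2 * ((k + 1) * J.card) ∧
      (∀ t ∈ J, ∀ i ≤ k, degIn T (par^[i] t) univ = 2) ∧
      ∀ t ∈ J, ∀ t' ∈ J, ∀ i ≤ k, ∀ i' ≤ k, par^[i] t = par^[i'] t' → i = i' ∧ t = t' := by
  -- Children of vertices of degree other than two are included, so that a walk up that has met no
  -- member of `Bd` moves next to a vertex of degree two.
  set Bd : Finset W := univ.filter fun c => degIn T c univ ≠ 2 ∨ degIn T (par c) univ ≠ 2 with hBd
  have hBdc : Bd.card ≤ 7 * (leafSet T).card := by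
    obtain ⟨h1, h2⟩ := card_not_deg_two_le hT hcard
    have h3 : Bd ⊆ (univ.filter fun t => degIn T t univ ≠ 2) ∪ ({r} ∪
        (univ.filter fun t => degIn T t univ ≠ 2).biUnion
          fun b => univ.filter fun t => t ≠ r ∧ par t = b) := by
      intro c
      simp only [hBd, mem_filter, mem_univ, true_and, mem_union, mem_singleton, mem_biUnion]
      rintro (h | h)
      · exact Or.inl h
      · by_cases hc : c = r
        · exact Or.inr (Or.inl hc)
        · exact Or.inr (Or.inr ⟨par c, h, hc, rfl⟩)
    have h4 := card_le_card h3
    have h5 := card_union_le (univ.filter fun t => degIn T t univ ≠ 2) ({r} ∪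
        (univ.filter fun t => degIn T t univ ≠ 2).biUnion
          fun b => univ.filter fun t => t ≠ r ∧ par t = b)
    have h6 := card_union_le {r} ((univ.filter fun t => degIn T t univ ≠ 2).biUnion
          fun b => univ.filter fun t => t ≠ r ∧ par t = b)
    have h7 : ((univ.filter fun t => degIn T t univ ≠ 2).biUnion
          fun b => univ.filter fun t => t ≠ r ∧ par t = b).card ≤ 4 * (leafSet T).card :=
      card_biUnion_le.trans ((sum_le_sum fun b _ => R.card_children_le b).trans h2)
    have h8 : 1 ≤ (leafSet T).card := card_pos.2 ⟨r, by simp [leafSet, hr]⟩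
    rw [card_singleton] at h6
    omega
  set NG : Finset W := univ.filter fun t => ∃ i ≤ k, par^[i] t ∈ Bd with hNG
  have hNGc : NG.card ≤ (k + 1) * (7 * (leafSet T).card) := by
    have hfind : ∀ t ∈ NG, ∃ i, i ≤ k ∧ par^[i] t ∈ Bd ∧ ∀ j < i, par^[j] t ∉ Bd := by
      intro t ht
      have hex : ∃ i, i ≤ k ∧ par^[i] t ∈ Bd := by simpa [hNG] using ht
      refine ⟨Nat.find hex, (Nat.find_spec hex).1, (Nat.find_spec hex).2, fun j hj hB => ?_⟩
      have := (Nat.find_spec hex).1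
      exact Nat.find_min hex hj ⟨by omega, hB⟩
    choose! i hik hiB himin using hfind
    -- A starting point whose walk meets `Bd` is determined by the time and place of the first hit:
    -- all steps up to it arrive at vertices of degree two and can be retraced.
    have hle : NG.card ≤ (range (k + 1) ×ˢ Bd).card := by
      apply card_le_card_of_injOn (fun t => (i t, par^[i t] t))
      · intro t ht
        have h1 := hik t ht
        have h2 := hiB t ht
        simp only [coe_product, Set.mem_prod, mem_coe, mem_range]
        exact ⟨by omega, h2⟩
      · intro t ht t' ht' he
        simp only [Prod.mk.injEq] at he
        have he2 := he.2
        rw [← he.1] at he2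
        refine R.iterate_injective hr (i t) (fun j hj1 hj2 => ?_) he2
        have := himin t ht (j - 1) (by omega)
        simp only [hBd, mem_filter, mem_univ, true_and, not_or, not_not,
          ← Function.iterate_succ_apply' par] at this
        have h3 := this.2
        rwa [Nat.succ_eq_add_one, Nat.sub_add_cancel hj1] at h3
    rw [card_product, card_range] at hle
    exact hle.trans (Nat.mul_le_mul_left _ hBdc)
  have hGc : Fintype.card W ≤ 2 * NGᶜ.card := by
    rw [card_compl]; omega
  have hgood : ∀ t ∈ NGᶜ, ∀ i ≤ k, degIn T (par^[i] t) univ = 2 := by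
    intro t ht i hi
    by_contra hne
    apply mem_compl.1 ht
    simp only [hNG, mem_filter, mem_univ, true_and]
    exact ⟨i, hi, by simp [hBd, hne]⟩
  -- Pigeonhole on the height modulo k + 1. Walks starting in one residue class can meet only at the
  -- same step, and then they coincide.
  obtain ⟨ρ, hρ⟩ : ∃ ρ, Fintype.card W ≤
      2 * ((k + 1) * (NGᶜ.filter fun t => h t % (k + 1) = ρ).card) := by
    have h1 := card_eq_sum_card_fiberwise (f := fun t => h t % (k + 1)) (s := NGᶜ)
      (t := range (k + 1)) (fun t _ => by
        simp only [coe_range, Set.mem_Iio]; exact Nat.mod_lt _ (by omega))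
    by_contra hcon
    push Not at hcon
    have h2 : 2 * ((k + 1) * NGᶜ.card) < (k + 1) * Fintype.card W := by
      rw [h1, mul_sum, mul_sum]
      calc _ < ∑ _ρ ∈ range (k + 1), Fintype.card W :=
            sum_lt_sum_of_nonempty ⟨0, by simp⟩ fun ρ _ => hcon ρ
        _ = _ := by simp
    nlinarith
  refine ⟨_, hρ, fun t ht => hgood t (mem_filter.1 ht).1, ?_⟩
  have hh : ∀ t ∈ NGᶜ, ∀ i ≤ k, h (par^[i] t) + i = h t := by
    intro t ht i
    induction i with
    | zero => simp
    | succ i ih =>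
      intro hi
      have h1 := ih (by omega)
      have h2 : par^[i] t ≠ r := fun e => by
        have := hgood t ht i (by omega); rw [e] at this; omega
      have h3 := R.height _ h2
      rw [Function.iterate_succ_apply']
      omega
  intro t ht t' ht' i hi i' hi' he
  have h1 := hh t (mem_filter.1 ht).1 i hi
  have h2 := hh t' (mem_filter.1 ht').1 i' hi'
  have h3 := (mem_filter.1 ht).2
  have h4 := (mem_filter.1 ht').2
  have hii : i = i' := by
    rw [he] at h1
    rw [← h1] at h3
    rw [← h2] at h4
    have h5 : (h (par^[i'] t') + i) ≡ (h (par^[i'] t') + i') [MOD (k + 1)] := by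
      rw [Nat.ModEq, h3, h4]
    have h6 := Nat.ModEq.add_left_cancel' _ h5
    exact Nat.ModEq.eq_of_lt_of_lt h6 (by omega) (by omega)
  subst hii
  exact ⟨rfl, R.iterate_injective hr i (fun j _ hj => hgood t (mem_filter.1 ht).1 j (by omega)) he⟩

end Rooting
end TreeUniversality

/-! ### Paths through cliques, dense bipartite matchings, concatenation of lists -/

namespace TreeUniversality

open Finset
open scoped Classical

section Cliques

variable {V : Type*} {G : SimpleGraph V}

lemma exists_clique_path {K : Finset V} (hK : G.IsClique K) {x y : V} (hx : x ∈ K) (hy : y ∈ K)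
    (hxy : x ≠ y) : ∃ l : List V, l.Nodup ∧ (∀ v, v ∈ l ↔ v ∈ K) ∧ l.IsChain G.Adj ∧
      l.head? = some x ∧ l.getLast? = some y := by
  have hnd : (x :: (((K.erase x).erase y).toList ++ [y])).Nodup := by
    simp [List.nodup_append, Finset.nodup_toList, hxy]
    intro a h1 h2 h3 h4
    exact h1 h4
  have hmem : ∀ v, v ∈ x :: (((K.erase x).erase y).toList ++ [y]) ↔ v ∈ K := by
    intro v
    simp only [List.mem_cons, List.mem_append, mem_toList, mem_erase, List.not_mem_nil, or_false]
    constructor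
    · rintro (rfl | h | rfl)
      · exact hx
      · exact h.2.2
      · exact hy
    · intro hv; tauto
  refine ⟨_, hnd, hmem, ?_, rfl, ?_⟩
  · apply List.Pairwise.isChain
    refine List.Pairwise.imp_of_mem ?_ hnd
    intro a b ha hb hab
    exact hK ((hmem a).1 ha) ((hmem b).1 hb) hab
  · rw [← List.cons_append]; exact List.getLast?_concat

lemma isChain_append_of_ends {l l' : List V} {x y : V} (h : l.IsChain G.Adj)
    (h' : l'.IsChain G.Adj) (hx : l.getLast? = some x) (hy : l'.head? = some y)
    (hxy : G.Adj x y) : (l ++ l').IsChain G.Adj := by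
  rw [List.isChain_append]
  refine ⟨h, h', ?_⟩
  intro a ha b hb
  rw [hx] at ha; rw [hy] at hb
  simp only [Option.mem_def, Option.some.injEq] at ha hb
  subst ha hb; exact hxy

lemma HasMatchingBetween.symm {k : ℕ} {A B : Finset V} (h : HasMatchingBetween G k A B) :
    HasMatchingBetween G k B A := by
  obtain ⟨a, b, ha, hb, h⟩ := h
  exact ⟨b, a, hb, ha, fun i => ⟨(h i).2.1, (h i).1, (h i).2.2.symm⟩⟩

/-- Two vertices of disjoint cliques `K`, `K'` are joined by a path covering `K`, `Y` and `K'`. -/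
lemma exists_three_clique_path {K Y K' : Finset V} (hK : G.IsNClique 5 K) (hY : G.IsNClique 5 Y)
    (hK' : G.IsNClique 5 K') (h1 : Disjoint K Y) (h2 : Disjoint Y K') (h3 : Disjoint K K')
    (hm1 : HasMatchingBetween G 3 K Y) (hm2 : HasMatchingBetween G 3 Y K') {e e' : V}
    (he : e ∈ K) (he' : e' ∈ K') :
    ∃ l : List V, l.length = 15 ∧ l.Nodup ∧ (∀ v ∈ l, v ∈ K ∨ v ∈ Y ∨ v ∈ K') ∧
      l.IsChain G.Adj ∧ l.head? = some e ∧ l.getLast? = some e' := by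
  obtain ⟨a, b, ha, hb, hab⟩ := hm1
  obtain ⟨a', b', ha', hb', hab'⟩ := hm2
  -- The crossing edge must leave K at a vertex other than the entry e, since a spanning path of K
  -- needs distinct ends.
  obtain ⟨i, hi⟩ : ∃ i, a i ≠ e := by
    by_contra hcon
    push Not at hcon
    exact absurd (ha ((hcon 0).trans (hcon 1).symm)) (by decide)
  -- Of three disjoint edges at most one starts at the entry `b i` of Y and at most one ends at e'.
  -- This is why matchings of size 3 are required.
  obtain ⟨j, hj1, hj2⟩ : ∃ j, a' j ≠ b i ∧ b' j ≠ e' := by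
    by_contra hcon
    push Not at hcon
    have p : ∀ j k : Fin 3, a' j = b i → a' k = b i → j = k := fun j k h1 h2 =>
      ha' (h1.trans h2.symm)
    have q : ∀ j k : Fin 3, b' j = e' → b' k = e' → j = k := fun j k h1 h2 => hb' (h1.trans h2.symm)
    have c0 := hcon 0
    have c1 := hcon 1
    have c2 := hcon 2
    have n01 : (0 : Fin 3) ≠ 1 := by decide
    have n02 : (0 : Fin 3) ≠ 2 := by decide
    have n12 : (1 : Fin 3) ≠ 2 := by decide
    by_cases d0 : a' 0 = b i
    · have d1 : a' 1 ≠ b i := fun h => n01 (p _ _ d0 h)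
      have d2 : a' 2 ≠ b i := fun h => n02 (p _ _ d0 h)
      exact n12 (q _ _ (c1 d1) (c2 d2))
    · by_cases d1 : a' 1 = b i
      · have d2 : a' 2 ≠ b i := fun h => n12 (p _ _ d1 h)
        exact n02 (q _ _ (c0 d0) (c2 d2))
      · exact n01 (q _ _ (c0 d0) (c1 d1))
  obtain ⟨l1, n1, m1, c1, f1, g1⟩ := exists_clique_path hK.1 he (hab i).1 hi.symm
  obtain ⟨l2, n2, m2, c2, f2, g2⟩ := exists_clique_path hY.1 (hab i).2.1 (hab' j).1 hj1.symm
  obtain ⟨l3, n3, m3, c3, f3, g3⟩ := exists_clique_path hK'.1 (hab' j).2.1 he' hj2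
  have len : ∀ {l : List V} {K : Finset V}, l.Nodup → (∀ v, v ∈ l ↔ v ∈ K) → K.card = 5 →
      l.length = 5 := by
    intro l K hn hm hc
    rw [← List.toFinset_card_of_nodup hn, ← hc]
    congr 1; ext v; simp [hm]
  refine ⟨l1 ++ (l2 ++ l3), ?_, ?_, ?_, ?_, ?_, ?_⟩
  · simp [len n1 m1 hK.2, len n2 m2 hY.2, len n3 m3 hK'.2]
  · rw [List.nodup_append', List.nodup_append']
    refine ⟨n1, ⟨n2, n3, ?_⟩, ?_⟩
    · intro v hv hv'
      exact disjoint_left.1 h2 ((m2 v).1 hv) ((m3 v).1 hv')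
    · intro v hv hv'
      rcases List.mem_append.1 hv' with hv' | hv'
      · exact disjoint_left.1 h1 ((m1 v).1 hv) ((m2 v).1 hv')
      · exact disjoint_left.1 h3 ((m1 v).1 hv) ((m3 v).1 hv')
  · intro v hv
    simp only [List.mem_append, m1, m2, m3] at hv
    exact hv
  · exact isChain_append_of_ends c1 (isChain_append_of_ends c2 c3 g2 f3 (hab' j).2.2) g1
      (by simp [f2]) (hab i).2.2
  · simp [f1]
  · simp [g3]

/-- A relation between two sets of equal size in which every vertex is related to at least half of
the other side contains a perfect matching. -/
lemma exists_perm_of_dense {α : Type*} [Fintype α] (rel : α → α → Prop)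
    (h1 : ∀ a, 2 * (univ.filter fun b => ¬ rel a b).card ≤ Fintype.card α)
    (h2 : ∀ b, 2 * (univ.filter fun a => ¬ rel a b).card ≤ Fintype.card α) :
    ∃ π : Equiv.Perm α, ∀ a, rel a (π a) := by
  obtain ⟨f, hf, hf'⟩ := (Finset.all_card_le_biUnion_card_iff_exists_injective
    (fun a : α => univ.filter fun b => rel a b)).1 (by
      intro s
      rcases s.eq_empty_or_nonempty with rfl | ⟨a, ha⟩
      · simp
      -- One member already has enough partners for a set of at most half the size; a larger set
      -- meets the partners of every b, so its neighbourhood is everything.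
      by_cases hs : 2 * s.card ≤ Fintype.card α
      · have h3 : (univ.filter fun b => rel a b) ⊆
            s.biUnion fun a => univ.filter fun b => rel a b :=
          subset_biUnion_of_mem (fun a => univ.filter fun b => rel a b) ha
        have h4 := card_le_card h3
        have h5 := card_filter_add_card_filter_not (s := (univ : Finset α)) (fun b => rel a b)
        rw [card_univ] at h5
        have := h1 a
        omega
      · have : (s.biUnion fun a => univ.filter fun b => rel a b) = univ := by
          ext b
          simp only [mem_biUnion, mem_filter, mem_univ, true_and, iff_true]
          by_contra hcon
          push Not at hcon
          have h3 : s ⊆ univ.filter fun a => ¬ rel a b := fun a ha => by simp [hcon a ha]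
          have h4 := card_le_card h3
          have := h2 b
          omega
        rw [this]
        exact card_le_univ s)
  refine ⟨Equiv.ofBijective f (Finite.injective_iff_bijective.1 hf), fun a => ?_⟩
  have := hf' a
  simpa using this

/-- Concatenation of the lists `P 0, M 0, P 1, M 1, …, P k`. -/
def glue (P M : ℕ → List V) : ℕ → List V
  | 0 => P 0
  | k + 1 => glue P M k ++ (M k ++ P (k + 1))

lemma mem_glue {P M : ℕ → List V} {k : ℕ} {v : V} (hv : v ∈ glue P M k) :
    (∃ c ≤ k, v ∈ P c) ∨ ∃ c < k, v ∈ M c := by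
  induction k with
  | zero => exact Or.inl ⟨0, le_rfl, hv⟩
  | succ k ih =>
    simp only [glue, List.mem_append] at hv
    rcases hv with hv | hv | hv
    · rcases ih hv with ⟨c, hc, h⟩ | ⟨c, hc, h⟩
      · exact Or.inl ⟨c, by omega, h⟩
      · exact Or.inr ⟨c, by omega, h⟩
    · exact Or.inr ⟨k, by omega, hv⟩
    · exact Or.inl ⟨k + 1, le_rfl, hv⟩

lemma length_glue {P M : ℕ → List V} {k q : ℕ} (hP : ∀ c ≤ k, (P c).length = q) :
    (glue P M k).length = (k + 1) * q + ∑ c ∈ range k, (M c).length := by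
  induction k with
  | zero => simp [glue, hP 0 le_rfl]
  | succ k ih =>
    simp only [glue, List.length_append, ih fun c hc => hP c (by omega), hP (k + 1) le_rfl,
      sum_range_succ]
    ring

lemma isChain_glue {P M : ℕ → List V} {a b : ℕ → V} {k : ℕ}
    (hP : ∀ c ≤ k, (P c).IsChain G.Adj ∧ (P c).head? = some (a c) ∧ (P c).getLast? = some (b c))
    (hM : ∀ c < k, (b c :: M c ++ [a (c + 1)]).IsChain G.Adj) :
    (glue P M k).IsChain G.Adj ∧ (glue P M k).head? = some (a 0) ∧
      (glue P M k).getLast? = some (b k) := by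
  induction k with
  | zero => exact hP 0 le_rfl
  | succ k ih =>
    obtain ⟨h1, h2, h3⟩ := ih (fun c hc => hP c (by omega)) (fun c hc => hM c (by omega))
    obtain ⟨h4, h5, h6⟩ := hP (k + 1) le_rfl
    have h7 := hM k (by omega)
    refine ⟨?_, by simp [glue, h2], by simp [glue, h6]⟩
    obtain ⟨p, hp⟩ : ∃ p, P (k + 1) = a (k + 1) :: p := by
      cases hh : P (k + 1) with
      | nil => rw [hh] at h5; simp at h5
      | cons x p => rw [hh] at h5; simp at h5; exact ⟨p, by rw [h5]⟩
    simp only [glue]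
    rw [hp] at h4 ⊢
    rw [List.cons_append, List.isChain_cons] at h7
    rw [List.isChain_append]
    refine ⟨h1, ?_, ?_⟩
    · rw [List.isChain_append] at h7 ⊢
      refine ⟨h7.2.1, h4, fun x hx y hy => h7.2.2.2 x hx y (by simpa using hy)⟩
    · intro x hx y hy
      rw [h3] at hx
      simp only [Option.mem_def, Option.some.injEq] at hx
      subst hx
      apply h7.1
      cases hM' : M k with
      | nil => rw [hM'] at hy; simpa using hy
      | cons z q => rw [hM'] at hy; simpa using hy

lemma nodup_glue {P M : ℕ → List V} {k : ℕ} (hP : ∀ c ≤ k, (P c).Nodup) (hM : ∀ c < k, (M c).Nodup)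
    (hPP : ∀ c ≤ k, ∀ c' ≤ k, ∀ v, v ∈ P c → v ∈ P c' → c = c')
    (hMM : ∀ c < k, ∀ c' < k, ∀ v, v ∈ M c → v ∈ M c' → c = c')
    (hPM : ∀ c ≤ k, ∀ c' < k, ∀ v, v ∈ P c → v ∉ M c') : (glue P M k).Nodup := by
  induction k with
  | zero => exact hP 0 le_rfl
  | succ k ih =>
    have h1 := ih (fun c hc => hP c (by omega)) (fun c hc => hM c (by omega))
      (fun c hc c' hc' => hPP c (by omega) c' (by omega))
      (fun c hc c' hc' => hMM c (by omega) c' (by omega))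
      (fun c hc c' hc' => hPM c (by omega) c' (by omega))
    simp only [glue]
    rw [List.nodup_append', List.nodup_append']
    refine ⟨h1, ⟨hM k (by omega), hP _ le_rfl, ?_⟩, ?_⟩
    · intro v hv hv'
      exact hPM (k + 1) le_rfl k (by omega) v hv' hv
    · intro v hv hv'
      rcases mem_glue hv with ⟨c, hc, h⟩ | ⟨c, hc, h⟩ <;> rcases List.mem_append.1 hv' with h' | h'
      · exact hPM c (by omega) k (by omega) v h h'
      · have := hPP c (by omega) (k + 1) le_rfl v h h'; omega
      · have := hMM c (by omega) k (by omega) v h h'; omega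
      · exact hPM (k + 1) le_rfl c (by omega) v h' h

end Cliques
end TreeUniversality

/-! ### Assigning the good cliques to slots -/

namespace TreeUniversality

open Finset
open scoped Classical

section CliqueFactor

variable {V : Type*} {G : SimpleGraph V} {n : ℕ} {γ : ℝ} {V₂ : Finset V}
  {𝒦 good bad : Finset (Finset V)}

lemma IsSuitableCliqueFactor.card_good (hK : IsSuitableCliqueFactor G n γ V₂ 𝒦 good bad) :
    good.card = 99 * ⌊γ * n⌋₊ := by
  have h1 : 𝒦 = good ∪ bad := by ext K; rw [hK.good_or_bad, mem_union]
  have h2 := hK.card_all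
  rw [h1, card_union_of_disjoint hK.good_disjoint_bad, hK.card_bad] at h2
  omega

lemma IsSuitableCliqueFactor.good_subset (hK : IsSuitableCliqueFactor G n γ V₂ 𝒦 good bad) :
    good ⊆ 𝒦 := fun K h => (hK.good_or_bad K).2 (Or.inl h)

lemma IsSuitableCliqueFactor.bad_subset (hK : IsSuitableCliqueFactor G n γ V₂ 𝒦 good bad) :
    bad ⊆ 𝒦 := fun K h => (hK.good_or_bad K).2 (Or.inr h)

lemma IsSuitableCliqueFactor.card_unmatched (hK : IsSuitableCliqueFactor G n γ V₂ 𝒦 good bad)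
    {K : Finset V} (h : K ∈ good) :
    (good.filter fun K' => K' ≠ K ∧ ¬ HasMatchingBetween G 3 K K').card ≤ ⌊γ * n⌋₊ := by
  apply Nat.le_floor
  convert hK.few_unmatched K h

/-- Transfers the bound on unmatched cliques to an injectively indexed family, the form needed for
`exists_perm_of_dense`. -/
lemma IsSuitableCliqueFactor.card_unmatched_le {α : Type*} [Fintype α]
    (hK : IsSuitableCliqueFactor G n γ V₂ 𝒦 good bad) {K : Finset V} (hKg : K ∈ good)
    {f : α → Finset V} (hf : Function.Injective f) (hfg : ∀ x, f x ∈ good) (hfK : ∀ x, f x ≠ K) :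
    (univ.filter fun x => ¬ HasMatchingBetween G 3 K (f x)).card ≤ ⌊γ * n⌋₊ := by
  rw [← card_image_of_injective _ hf]
  refine le_trans (card_le_card ?_) (hK.card_unmatched hKg)
  intro K' hK'
  obtain ⟨x, hx, rfl⟩ := mem_image.1 hK'
  exact mem_filter.2 ⟨hfg x, hfK x, (mem_filter.1 hx).2⟩

/-- A vertex outside the good cliques has a neighbour in many good cliques. -/
lemma IsSuitableCliqueFactor.card_adjacent (hK : IsSuitableCliqueFactor G n γ V₂ 𝒦 good bad)
    (hV₂ : V₂.card = 500 * ⌊γ * n⌋₊) {v : V} (hv : ∀ K ∈ good, v ∉ K) :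
    7 * ⌊γ * n⌋₊ ≤ (good.filter fun K => ∃ u ∈ K, G.Adj v u).card := by
  have hcover : V₂ = 𝒦.biUnion id := by
    symm
    apply eq_of_subset_of_card_le
    · intro x hx
      obtain ⟨K, hK', hx⟩ := mem_biUnion.1 hx
      exact (hK.isClique K hK').1 hx
    · rw [card_biUnion (t := id) (fun K h K' h' hne => hK.pairwiseDisjoint K h K' h' hne),
        sum_congr rfl fun K h => show (id K : Finset V).card = 5 from (hK.isClique K h).2.2, hV₂]
      simp [hK.card_all]; omega
  have h1 := hK.degIn_V₂ v hv
  have hsub : V₂.filter (fun u => G.Adj v u) ⊆ bad.biUnion id ∪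
      (good.filter fun K => ∃ u ∈ K, G.Adj v u).biUnion id := by
    intro u hu
    rw [mem_filter, hcover, mem_biUnion] at hu
    obtain ⟨⟨K, hK', huK⟩, hadj⟩ := hu
    simp only [mem_union, mem_biUnion, mem_filter]
    rcases (hK.good_or_bad K).1 hK' with h | h
    · exact Or.inr ⟨K, ⟨h, u, huK, hadj⟩, huK⟩
    · exact Or.inl ⟨K, h, huK⟩
  -- The g bad cliques contain at most 5g of the 40g neighbours; the remaining 35g lie in good
  -- cliques, at most five in each.
  have h2 := (card_le_card hsub).trans (card_union_le _ _)
  have h3 : (bad.biUnion id).card ≤ bad.card * 5 := card_biUnion_le_card_mul _ _ _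
    fun K h => (hK.isClique K (hK.bad_subset h)).2.2.le
  have h4 : ((good.filter fun K => ∃ u ∈ K, G.Adj v u).biUnion id).card ≤
      (good.filter fun K => ∃ u ∈ K, G.Adj v u).card * 5 := card_biUnion_le_card_mul _ _ _
    fun K h => (hK.isClique K (hK.good_subset (mem_filter.1 h).1)).2.2.le
  rw [hK.card_bad] at h3
  unfold degIn at h1
  omega

/-- Slots for the cliques: the two end cliques of every path, the left and right cliques of every
link, and the middle cliques of the chains. -/
abbrev CliqueSlot (ι : Type*) := (ι × Bool) ⊕ ((ι × (Bool ⊕ Fin 30)) × Bool) ⊕ (ι × Fin 33)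

/-- Each of the g paths needs 2 + 64 + 33 = 99 good cliques, exactly as many as there are. Hall's
theorem first picks cliques next to the vertices w. Among the others, 30g left cliques are then
matched with 30g right cliques; only g partners are excluded for each. The middle cliques are left
in arbitrary order here. -/
lemma exists_linked_slots {ι : Type*} [Fintype ι]
    (hK : IsSuitableCliqueFactor G n γ V₂ 𝒦 good bad) (hV₂ : V₂.card = 500 * ⌊γ * n⌋₊)
    (hι : Fintype.card ι = ⌊γ * n⌋₊) (E : ι × Bool → Finset V) (hE : ∀ x, E x ∈ good)
    (hEinj : Function.Injective E) (w : (ι × Bool) × Bool → V) (hw : ∀ x, ∀ K ∈ good, w x ∉ K) :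
    ∃ Φ : CliqueSlot ι → Finset V, Function.Injective Φ ∧ (∀ x, Φ x ∈ good) ∧
      (∀ x, Φ (Sum.inl x) = E x) ∧
      (∀ i b s, ∃ u ∈ Φ (Sum.inr (Sum.inl ((i, Sum.inl b), s))), G.Adj (w ((i, b), s)) u) ∧
      ∀ i c, HasMatchingBetween G 3 (Φ (Sum.inr (Sum.inl ((i, Sum.inr c), false))))
        (Φ (Sum.inr (Sum.inl ((i, Sum.inr c), true)))) := by
  set g := ⌊γ * n⌋₊ with hg
  -- the cliques next to the linking vertices
  obtain ⟨L, hLinj, hL⟩ := (Finset.all_card_le_biUnion_card_iff_exists_injective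
    (fun x : (ι × Bool) × Bool =>
      (good.filter fun K => ∃ u ∈ K, G.Adj (w x) u) \ univ.image E)).1 (by
    intro s
    rcases s.eq_empty_or_nonempty with rfl | ⟨x, hx⟩
    · simp
    -- Of at least 7g candidates, at most 2g are end cliques. The remaining 5g suffice for all 4g
    -- requests together, so a single request verifies Hall's condition.
    have h1 := hK.card_adjacent hV₂ (hw x)
    have h2 := le_card_sdiff (univ.image E) (good.filter fun K => ∃ u ∈ K, G.Adj (w x) u)
    have h3 : (univ.image E).card ≤ 2 * g := by
      refine card_image_le.trans ?_
      simp [hι]; omega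
    have h4 : s.card ≤ 4 * g := by
      refine (card_le_univ s).trans ?_
      simp [hι]; omega
    have h5 := card_le_card (subset_biUnion_of_mem (fun x : (ι × Bool) × Bool =>
      (good.filter fun K => ∃ u ∈ K, G.Adj (w x) u) \ univ.image E) hx)
    omega)
  simp only [mem_sdiff, mem_filter, mem_image, mem_univ, true_and, not_exists] at hL
  -- the remaining cliques
  set Rm := good \ (univ.image E ∪ univ.image L) with hRm
  -- After 2g end cliques and 4g linking cliques, 93g = (30 + 30 + 33)g good cliques remain.
  have hRmc : Fintype.card (ι × (Fin 30 ⊕ Fin 30 ⊕ Fin 33)) = Fintype.card Rm := by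
    rw [Fintype.card_coe, hRm, card_sdiff_of_subset, card_union_of_disjoint,
      card_image_of_injective _ hEinj, card_image_of_injective _ hLinj, hK.card_good]
    · simp [hι]; omega
    · rw [disjoint_left]
      intro K h1 h2
      obtain ⟨x, _, rfl⟩ := mem_image.1 h1
      obtain ⟨y, _, hy⟩ := mem_image.1 h2
      exact (hL y).2 x hy.symm
    · apply union_subset
      · intro K h
        obtain ⟨x, _, rfl⟩ := mem_image.1 h
        exact hE x
      · intro K h
        obtain ⟨x, _, rfl⟩ := mem_image.1 h
        exact (hL x).1.1
  let Z := Fintype.equivOfCardEq hRmc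
  have hZ : ∀ x, ((Z x : Finset V) ∈ good) ∧ (∀ y, E y ≠ Z x) ∧ (∀ y, L y ≠ Z x) := by
    intro x
    have := (Z x).2
    simp only [hRm, mem_sdiff, mem_union, mem_image, mem_univ, true_and, not_or, not_exists] at this
    exact ⟨this.1, this.2.1, this.2.2⟩
  have hZinj : ∀ x y, (Z x : Finset V) = Z y → x = y := fun x y h => Z.injective (Subtype.ext h)
  -- direct links
  have hcount : ∀ (K : Finset V) (hKg : K ∈ good) (f : ι × Fin 30 → Finset V),
      Function.Injective f → (∀ x, f x ∈ good) → (∀ x, f x ≠ K) →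
      2 * (univ.filter fun x => ¬ HasMatchingBetween G 3 K (f x)).card ≤
        Fintype.card (ι × Fin 30) := by
    intro K hKg f hf hfg hfK
    have h1 := hK.card_unmatched_le hKg hf hfg hfK
    simp [hι]; omega
  obtain ⟨π, hπ⟩ := exists_perm_of_dense (α := ι × Fin 30) (fun a b =>
      HasMatchingBetween G 3 (Z (a.1, Sum.inl a.2)) (Z (b.1, Sum.inr (Sum.inl b.2))))
    (fun a => hcount _ (hZ _).1 (fun b => Z (b.1, Sum.inr (Sum.inl b.2)))
      (fun b b' h => by
        have := hZinj _ _ h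
        simp only [Prod.mk.injEq, Sum.inr.injEq, Sum.inl.injEq] at this
        exact Prod.ext this.1 this.2)
      (fun b => (hZ _).1) (fun b h => by have := hZinj _ _ h; simp at this))
    (fun b => by
      have := hcount (Z (b.1, Sum.inr (Sum.inl b.2))) (hZ _).1 (fun a => Z (a.1, Sum.inl a.2))
        (fun b b' h => by
          have := hZinj _ _ h
          simp only [Prod.mk.injEq, Sum.inl.injEq] at this
          exact Prod.ext this.1 this.2)
        (fun b => (hZ _).1) (fun b h => by have := hZinj _ _ h; simp at this)
      refine le_trans (Nat.mul_le_mul_left _ (card_le_card ?_)) this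
      intro a
      simp only [mem_filter, mem_univ, true_and]
      exact fun h h' => h h'.symm)
  refine ⟨fun x => match x with
    | Sum.inl x => E x
    | Sum.inr (Sum.inl ((i, Sum.inl b), s)) => L ((i, b), s)
    | Sum.inr (Sum.inl ((i, Sum.inr c), false)) => Z (i, Sum.inl c)
    | Sum.inr (Sum.inl ((i, Sum.inr c), true)) => Z ((π (i, c)).1, Sum.inr (Sum.inl (π (i, c)).2))
    | Sum.inr (Sum.inr (i, c)) => Z (i, Sum.inr (Sum.inr c)), ?_, ?_, fun _ => rfl, ?_, ?_⟩
  · have hπ' : ∀ x y, (π x).1 = (π y).1 → (π x).2 = (π y).2 → x = y := fun x y h1 h2 =>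
      π.injective (Prod.ext h1 h2)
    rintro (x | ⟨⟨i, b | c⟩, (_ | _)⟩ | ⟨i, c⟩) (y | ⟨⟨i', b' | c'⟩, (_ | _)⟩ | ⟨i', c'⟩) hxy <;>
      simp only at hxy <;>
      first
        | exact congrArg _ (hEinj hxy)
        | exact absurd hxy.symm ((hL _).2 _)
        | exact absurd hxy ((hL _).2 _)
        | exact absurd hxy ((hZ _).2.1 _)
        | exact absurd hxy.symm ((hZ _).2.1 _)
        | exact absurd hxy ((hZ _).2.2 _)
        | exact absurd hxy.symm ((hZ _).2.2 _)
        | (have := hLinj hxy; simp at this ⊢; exact this)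
        | (have := hZinj _ _ hxy; simp at this ⊢; exact this)
        | (have := hZinj _ _ hxy; simp only [Prod.mk.injEq, Sum.inr.injEq, Sum.inl.injEq] at this
           have h := hπ' _ _ this.1 this.2; simp at h ⊢; exact h)
        | (have := hZinj _ _ hxy; simp at this)
        | (have := hLinj hxy; simp at this)
  · rintro (x | ⟨⟨i, b | c⟩, (_ | _)⟩ | ⟨i, c⟩)
    · exact hE x
    · exact (hL _).1.1
    · exact (hL _).1.1
    · exact (hZ _).1
    · exact (hZ _).1
    · exact (hZ _).1
  · intro i b s
    exact (hL ((i, b), s)).1.2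
  · intro i c
    exact hπ (i, c)

end CliqueFactor
end TreeUniversality

/-! ### Absorbing paths through the clique factor -/

namespace TreeUniversality

open Finset
open scoped Classical

/-- The kinds of links of a path through the cliques, in the order in which they are used. -/
def linkKind : ℕ → Bool ⊕ Fin 30
  | 0 => Sum.inl false
  | 1 => Sum.inl true
  | c + 2 => Sum.inr (Fin.ofNat 30 c)

lemma linkKind_injOn {c c' : ℕ} (hc : c < 32) (hc' : c' < 32) (h : linkKind c = linkKind c') :
    c = c' := by
  match c, c' with
  | 0, 0 => rfl
  | 0, 1 => simp [linkKind] at h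
  | 0, c' + 2 => simp [linkKind] at h
  | 1, 0 => simp [linkKind] at h
  | 1, 1 => rfl
  | 1, c' + 2 => simp [linkKind] at h
  | c + 2, 0 => simp [linkKind] at h
  | c + 2, 1 => simp [linkKind] at h
  | c + 2, c' + 2 =>
    simp only [linkKind, Sum.inr.injEq] at h
    have := congrArg Fin.val h
    simp only [Fin.ofNat] at this
    omega

/-- The slot of the first clique of the `c`-th chain of a path. -/
def entrySlot {ι : Type*} (i : ι) : ℕ → CliqueSlot ι
  | 0 => Sum.inl (i, false)
  | c + 1 => Sum.inr (Sum.inl ((i, linkKind c), true))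

/-- The slot of the last clique of the `c`-th chain of a path. -/
def exitSlot {ι : Type*} (i : ι) (c : ℕ) : CliqueSlot ι :=
  if c = 32 then Sum.inl (i, true) else Sum.inr (Sum.inl ((i, linkKind c), false))

lemma entrySlot_inj {ι : Type*} {i i' : ι} {c c' : ℕ} (hc : c ≤ 32) (hc' : c' ≤ 32)
    (h : entrySlot i c = entrySlot i' c') : i = i' ∧ c = c' := by
  match c, c' with
  | 0, 0 => simpa [entrySlot] using h
  | 0, c' + 1 => simp [entrySlot] at h
  | c + 1, 0 => simp [entrySlot] at h
  | c + 1, c' + 1 =>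
    simp only [entrySlot, Sum.inr.injEq, Sum.inl.injEq, Prod.mk.injEq, and_true] at h
    exact ⟨h.1, by rw [linkKind_injOn (by omega) (by omega) h.2]⟩

lemma exitSlot_inj {ι : Type*} {i i' : ι} {c c' : ℕ} (hc : c ≤ 32) (hc' : c' ≤ 32)
    (h : exitSlot i c = exitSlot i' c') : i = i' ∧ c = c' := by
  unfold exitSlot at h
  split_ifs at h with h1 h2 h2
  · simp at h; exact ⟨h, by omega⟩
  · simp only [Sum.inr.injEq, Sum.inl.injEq, Prod.mk.injEq, and_true] at h
    exact ⟨h.1, linkKind_injOn (by omega) (by omega) h.2⟩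

lemma entrySlot_ne_exitSlot {ι : Type*} {i i' : ι} {c c' : ℕ} : entrySlot i c ≠ exitSlot i' c' := by
  unfold exitSlot
  split_ifs <;> cases c <;> simp [entrySlot]

lemma entrySlot_ne_inr {ι : Type*} {i : ι} {c : ℕ} {x : ι × Fin 33} :
    entrySlot i c ≠ Sum.inr (Sum.inr x) := by
  cases c <;> simp [entrySlot]

lemma exitSlot_ne_inr {ι : Type*} {i : ι} {c : ℕ} {x : ι × Fin 33} :
    exitSlot i c ≠ Sum.inr (Sum.inr x) := by
  unfold exitSlot
  split_ifs <;> simp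

/-- The vertices in the middle of a link. -/
def linkSet {ι V : Type*} (vL : ι → V) (bd : ι → Finset V) (i : ι) : Bool ⊕ Fin 30 → Finset V
  | Sum.inl false => {vL i}
  | Sum.inl true => bd i
  | Sum.inr _ => ∅

section CliqueFactor

variable {V : Type*} {G : SimpleGraph V} {n : ℕ} {γ : ℝ} {V₂ : Finset V}
  {𝒦 good bad : Finset (Finset V)}

/-- Disjoint paths with `501` vertices and given end vertices in good cliques that use up the
clique factor and the set `Lo`. -/
lemma exists_clique_paths {ι : Type*} [Fintype ι]
    (hK : IsSuitableCliqueFactor G n γ V₂ 𝒦 good bad) (hV₂ : V₂.card = 500 * ⌊γ * n⌋₊)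
    (hι : Fintype.card ι = ⌊γ * n⌋₊) (E : ι × Bool → Finset V) (hE : ∀ x, E x ∈ good)
    (hEinj : Function.Injective E) (s : ι × Bool → V) (hs : ∀ x, s x ∈ E x)
    (Lo : Finset V) (hLo : Lo.card = ⌊γ * n⌋₊) (hLoV : Disjoint Lo V₂) :
    ∃ l : ι → List V, (∀ i, (l i).length = 501 ∧ (l i).Nodup ∧ (∀ v ∈ l i, v ∈ V₂ ∨ v ∈ Lo) ∧
      (l i).IsChain G.Adj ∧ (l i).head? = some (s (i, false)) ∧
      (l i).getLast? = some (s (i, true))) ∧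
      ∀ i j v, v ∈ l i → v ∈ l j → i = j := by
  have hclq : ∀ K ∈ good, G.IsNClique 5 K := fun K h => (hK.isClique K (hK.good_subset h)).2
  have hclqV : ∀ K ∈ good, K ⊆ V₂ := fun K h => (hK.isClique K (hK.good_subset h)).1
  -- Each path absorbs exactly one leftover vertex and exactly one bad clique.
  let vL : ι ≃ Lo := Fintype.equivOfCardEq (by rw [hι, Fintype.card_coe, hLo])
  let bd : ι ≃ bad := Fintype.equivOfCardEq (by rw [hι, Fintype.card_coe, hK.card_bad])
  have hbd : ∀ i, ∃ x y, ∃ l : List V, l.Nodup ∧ (∀ v, v ∈ l ↔ v ∈ (bd i : Finset V)) ∧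
      l.IsChain G.Adj ∧ l.head? = some x ∧ l.getLast? = some y ∧ x ∈ (bd i : Finset V) ∧
      y ∈ (bd i : Finset V) := by
    intro i
    have h1 := (hK.isClique _ (hK.bad_subset (bd i).2)).2
    obtain ⟨x, hx, y, hy, hxy⟩ := one_lt_card.1 (show 1 < (bd i : Finset V).card by
      rw [h1.2]; norm_num)
    obtain ⟨l, h2, h3, h4, h5, h6⟩ := exists_clique_path h1.1 hx hy hxy
    exact ⟨x, y, l, h2, h3, h4, h5, h6, hx, hy⟩
  choose bx by' bl hbl1 hbl2 hbl3 hbl4 hbl5 hbx hby using hbd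
  have hLgood : ∀ i, ∀ K ∈ good, (vL i : V) ∉ K := fun i K h h' =>
    disjoint_left.1 hLoV (vL i).2 (hclqV K h h')
  have hbgood : ∀ i, ∀ v ∈ (bd i : Finset V), ∀ K ∈ good, v ∉ K := by
    intro i v hv K h h'
    refine disjoint_left.1 (hK.pairwiseDisjoint _ (hK.bad_subset (bd i).2) K (hK.good_subset h)
      fun e => ?_) hv h'
    exact disjoint_left.1 hK.good_disjoint_bad h (e ▸ (bd i).2)
  obtain ⟨Φ, hΦinj, hΦg, hΦE, hΦl, hΦd⟩ := exists_linked_slots hK hV₂ hι E hE hEinj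
    (fun x => match x with
      | ((i, false), _) => (vL i : V)
      | ((i, true), false) => bx i
      | ((i, true), true) => by' i) (by
    rintro ⟨⟨i, _ | _⟩, _ | _⟩ K h
    · exact hLgood i K h
    · exact hLgood i K h
    · exact hbgood i _ (hbx i) K h
    · exact hbgood i _ (hby i) K h)
  have hdisj : ∀ x y v, v ∈ Φ x → v ∈ Φ y → x = y := by
    intro x y v hx hy
    by_contra hne
    exact disjoint_left.1 (hK.pairwiseDisjoint _ (hK.good_subset (hΦg x)) _ (hK.good_subset (hΦg y))
      fun e => hne (hΦinj e)) hx hy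
  -- the links
  have hlink : ∀ (i : ι) (κ : Bool ⊕ Fin 30), ∃ lv rv, ∃ mid : List V,
      lv ∈ Φ (Sum.inr (Sum.inl ((i, κ), false))) ∧ rv ∈ Φ (Sum.inr (Sum.inl ((i, κ), true))) ∧
      (lv :: mid ++ [rv]).IsChain G.Adj ∧ mid.Nodup ∧
      (∀ v, v ∈ mid ↔ v ∈ linkSet (fun i => (vL i : V)) (fun i => (bd i : Finset V)) i κ) := by
    rintro i ((_ | _) | c)
    · obtain ⟨u, hu, hu'⟩ := hΦl i false false
      obtain ⟨u', hu2, hu2'⟩ := hΦl i false true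
      exact ⟨u, u', [(vL i : V)], hu, hu2, by simpa using ⟨hu'.symm, hu2'⟩, by simp,
        by simp [linkSet]⟩
    · obtain ⟨u, hu, hu'⟩ := hΦl i true false
      obtain ⟨u', hu2, hu2'⟩ := hΦl i true true
      refine ⟨u, u', bl i, hu, hu2, ?_, hbl1 i, by simp [linkSet, hbl2 i]⟩
      have h1 : (bl i ++ [u']).IsChain G.Adj :=
        isChain_append_of_ends (hbl3 i) (by simp) (hbl5 i) rfl hu2'
      exact isChain_append_of_ends (l := [u]) (by simp) h1 rfl (by simp [hbl4 i]) hu'.symm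
    · obtain ⟨a, b, _, _, h⟩ := hΦd i c
      exact ⟨a 0, b 0, [], (h 0).1, (h 0).2.1, by simpa using (h 0).2.2, by simp, by simp [linkSet]⟩
  choose lv rv mid hlv hrv hmchain hmnd hmid using hlink
  -- the middle cliques of the chains
  have hent : ∀ i c, Φ (entrySlot i c) ∈ good := fun i c => hΦg _
  have hcard : Fintype.card (ι × Fin 33) = 33 * ⌊γ * n⌋₊ := by simp [hι, mul_comm]
  -- A middle clique fits a chain if it is matched to both the entry and the exit clique. At most 2g
  -- of the 33g candidates are excluded on either side, so `exists_perm_of_dense` assigns the middle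
  -- cliques.
  obtain ⟨rel, hrel⟩ : ∃ rel : ι × Fin 33 → ι × Fin 33 → Prop, ∀ a b, rel a b ↔
      HasMatchingBetween G 3 (Φ (entrySlot a.1 a.2)) (Φ (Sum.inr (Sum.inr b))) ∧
      HasMatchingBetween G 3 (Φ (exitSlot a.1 a.2)) (Φ (Sum.inr (Sum.inr b))) :=
    ⟨_, fun _ _ => Iff.rfl⟩
  obtain ⟨σ, hσ⟩ := exists_perm_of_dense rel
    (fun a => by
      have hf : Function.Injective fun b : ι × Fin 33 => Φ (Sum.inr (Sum.inr b)) := fun b b' h => by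
        simpa using hΦinj h
      have h1 := hK.card_unmatched_le (hΦg (entrySlot a.1 a.2)) hf (fun x => hΦg _)
        (fun x h => entrySlot_ne_inr (hΦinj h).symm)
      have h2 := hK.card_unmatched_le (hΦg (exitSlot a.1 a.2)) hf (fun x => hΦg _)
        (fun x h => exitSlot_ne_inr (hΦinj h).symm)
      have h3 : (univ.filter fun b => ¬ rel a b) ⊆
          (univ.filter fun b => ¬ HasMatchingBetween G 3 (Φ (entrySlot a.1 a.2))
            (Φ (Sum.inr (Sum.inr b)))) ∪
          (univ.filter fun b => ¬ HasMatchingBetween G 3 (Φ (exitSlot a.1 a.2))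
            (Φ (Sum.inr (Sum.inr b)))) := by
        intro b
        simp only [mem_filter, mem_univ, true_and, mem_union, hrel, not_and_or, imp_self]
      have h4 := (card_le_card h3).trans ((card_union_le _ _).trans (Nat.add_le_add h1 h2))
      rw [hcard]
      omega)
    (fun b => by
      have hf1 : Function.Injective fun a : ι × Fin 33 => Φ (entrySlot a.1 a.2) := fun a a' h => by
        have := entrySlot_inj (by omega) (by omega) (hΦinj h)
        exact Prod.ext this.1 (Fin.ext this.2)
      have hf2 : Function.Injective fun a : ι × Fin 33 => Φ (exitSlot a.1 a.2) := fun a a' h => by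
        have := exitSlot_inj (by omega) (by omega) (hΦinj h)
        exact Prod.ext this.1 (Fin.ext this.2)
      have h1 := hK.card_unmatched_le (hΦg (Sum.inr (Sum.inr b))) hf1 (fun x => hΦg _)
        (fun x h => entrySlot_ne_inr (hΦinj h))
      have h2 := hK.card_unmatched_le (hΦg (Sum.inr (Sum.inr b))) hf2 (fun x => hΦg _)
        (fun x h => exitSlot_ne_inr (hΦinj h))
      have h3 : (univ.filter fun a => ¬ rel a b) ⊆
          (univ.filter fun a : ι × Fin 33 =>
            ¬ HasMatchingBetween G 3 (Φ (Sum.inr (Sum.inr b))) (Φ (entrySlot a.1 a.2))) ∪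
          (univ.filter fun a : ι × Fin 33 =>
            ¬ HasMatchingBetween G 3 (Φ (Sum.inr (Sum.inr b))) (Φ (exitSlot a.1 a.2))) := by
        intro a
        simp only [mem_filter, mem_univ, true_and, mem_union, hrel, not_and_or]
        rintro (h | h)
        · exact Or.inl fun h' => h h'.symm
        · exact Or.inr fun h' => h h'.symm
      have h4 := (card_le_card h3).trans ((card_union_le _ _).trans (Nat.add_le_add h1 h2))
      rw [hcard]
      omega)
  -- the chains
  let Y : ι → ℕ → CliqueSlot ι := fun i c => Sum.inr (Sum.inr (σ (i, Fin.ofNat 33 c)))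
  let ev : ι → ℕ → V := fun i c => match c with
    | 0 => s (i, false)
    | c + 1 => rv i (linkKind c)
  let xv : ι → ℕ → V := fun i c => if c = 32 then s (i, true) else lv i (linkKind c)
  have hYinj : ∀ i i' c c', c ≤ 32 → c' ≤ 32 → Y i c = Y i' c' → i = i' ∧ c = c' := by
    intro i i' c c' hc hc' h
    have h1 : σ (i, Fin.ofNat 33 c) = σ (i', Fin.ofNat 33 c') := by simpa [Y] using h
    have h2 := σ.injective h1
    simp only [Prod.mk.injEq] at h2
    have h3 := congrArg Fin.val h2.2
    simp only [Fin.ofNat] at h3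
    exact ⟨h2.1, by omega⟩
  have hev : ∀ i c, ev i c ∈ Φ (entrySlot i c) := by
    intro i c
    cases c with
    | zero => simp only [ev, entrySlot]; rw [hΦE]; exact hs _
    | succ c => exact hrv i _
  have hxv : ∀ i c, xv i c ∈ Φ (exitSlot i c) := by
    intro i c
    simp only [xv, exitSlot]
    split_ifs
    · rw [hΦE]; exact hs _
    · exact hlv i _
  have hchain : ∀ i c, c ≤ 32 → ∃ l : List V, l.length = 15 ∧ l.Nodup ∧
      (∀ v ∈ l, v ∈ Φ (entrySlot i c) ∨ v ∈ Φ (Y i c) ∨ v ∈ Φ (exitSlot i c)) ∧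
      l.IsChain G.Adj ∧ l.head? = some (ev i c) ∧ l.getLast? = some (xv i c) := by
    intro i c hc
    have hval : ((Fin.ofNat 33 c : Fin 33) : ℕ) = c := by simp only [Fin.ofNat]; omega
    have h1 := (hrel _ _).1 (hσ (i, Fin.ofNat 33 c))
    simp only [hval] at h1
    have hd : ∀ x y, x ≠ y → Disjoint (Φ x) (Φ y) := fun x y hne =>
      disjoint_left.2 fun v hv hv' => hne (hdisj x y v hv hv')
    exact exists_three_clique_path (hclq _ (hΦg _)) (hclq _ (hΦg (Y i c))) (hclq _ (hΦg _))
      (hd _ _ entrySlot_ne_inr) (hd _ _ exitSlot_ne_inr.symm) (hd _ _ entrySlot_ne_exitSlot)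
      h1.1 h1.2.symm (hev i c) (hxv i c)
  choose! P hP1 hP2 hP3 hP4 hP5 hP6 using hchain
  have hPslot : ∀ i c i' c', c ≤ 32 → c' ≤ 32 → ∀ v, v ∈ P i c → v ∈ P i' c' → i = i' ∧ c = c' := by
    intro i c i' c' hc hc' v hv hv'
    rcases hP3 i c hc v hv with h | h | h <;> rcases hP3 i' c' hc' v hv' with h' | h' | h' <;>
      have he := hdisj _ _ v h h'
    · exact entrySlot_inj hc hc' he
    · exact absurd he entrySlot_ne_inr
    · exact absurd he entrySlot_ne_exitSlot
    · exact absurd he.symm entrySlot_ne_inr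
    · exact hYinj i i' c c' hc hc' he
    · exact absurd he.symm exitSlot_ne_inr
    · exact absurd he.symm entrySlot_ne_exitSlot
    · exact absurd he exitSlot_ne_inr
    · exact exitSlot_inj hc hc' he
  have hPgood : ∀ i c, c ≤ 32 → ∀ v ∈ P i c, ∃ K ∈ good, v ∈ K := by
    intro i c hc v hv
    rcases hP3 i c hc v hv with h | h | h
    · exact ⟨_, hΦg _, h⟩
    · exact ⟨_, hΦg _, h⟩
    · exact ⟨_, hΦg _, h⟩
  have hMgood : ∀ i κ, ∀ v ∈ mid i κ, ∀ K ∈ good, v ∉ K := by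
    intro i κ v hv
    rw [hmid] at hv
    match κ with
    | Sum.inl false => rw [show v = vL i by simpa [linkSet] using hv]; exact hLgood i
    | Sum.inl true => exact hbgood i v hv
    | Sum.inr _ => simp [linkSet] at hv
  have hMinj : ∀ i κ i' κ', ∀ v, v ∈ mid i κ → v ∈ mid i' κ' → i = i' ∧ κ = κ' := by
    intro i κ i' κ' v hv hv'
    rw [hmid] at hv hv'
    have hLb : ∀ i i', (vL i : V) ∉ (bd i' : Finset V) := fun i i' h =>
      disjoint_left.1 hLoV (vL i).2 ((hK.isClique _ (hK.bad_subset (bd i').2)).1 h)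
    match κ, κ' with
    | Sum.inl false, Sum.inl false =>
      simp only [linkSet, mem_singleton] at hv hv'
      exact ⟨vL.injective (Subtype.ext (hv.symm.trans hv')), rfl⟩
    | Sum.inl false, Sum.inl true =>
      simp only [linkSet, mem_singleton] at hv hv'
      exact absurd (hv ▸ hv') (hLb _ _)
    | Sum.inl true, Sum.inl false =>
      simp only [linkSet, mem_singleton] at hv hv'
      exact absurd (hv' ▸ hv) (hLb _ _)
    | Sum.inl true, Sum.inl true =>
      simp only [linkSet] at hv hv'
      refine ⟨?_, rfl⟩
      by_contra hne
      exact disjoint_left.1 (hK.pairwiseDisjoint _ (hK.bad_subset (bd i).2) _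
        (hK.bad_subset (bd i').2) fun e => hne (bd.injective (Subtype.ext e))) hv hv'
    | Sum.inr _, _ => simp [linkSet] at hv
    | _, Sum.inr _ => simp [linkSet] at hv'
  have hglue : ∀ i, (glue (P i) (fun c => mid i (linkKind c)) 32).IsChain G.Adj ∧
      (glue (P i) (fun c => mid i (linkKind c)) 32).head? = some (ev i 0) ∧
      (glue (P i) (fun c => mid i (linkKind c)) 32).getLast? = some (xv i 32) := fun i => by
    apply isChain_glue
    · exact fun c hc => ⟨hP4 i c hc, hP5 i c hc, hP6 i c hc⟩
    · intro c hc
      have : xv i c = lv i (linkKind c) := by simp only [xv]; rw [if_neg (by omega)]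
      rw [this]
      exact hmchain i (linkKind c)
  refine ⟨fun i => glue (P i) (fun c => mid i (linkKind c)) 32,
    fun i => ⟨?_, ?_, ?_, (hglue i).1, (hglue i).2.1, ?_⟩, ?_⟩
  -- There are 33 chains of 15 vertices, one leftover vertex and a bad clique: 495 + 1 + 5 = 501.
  -- The 30 direct links add nothing.
  · rw [length_glue fun c hc => hP1 i c hc]
    have hlen : ∀ κ, (mid i κ).length =
        (linkSet (fun i => (vL i : V)) (fun i => (bd i : Finset V)) i κ).card := by
      intro κ
      rw [← List.toFinset_card_of_nodup (hmnd i κ)]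
      congr 1; ext v; simp [hmid]
    simp only [hlen]
    rw [sum_range_succ', sum_range_succ']
    have h0 : ∑ k ∈ range 30, (linkSet (fun i => (vL i : V)) (fun i => (bd i : Finset V)) i
        (linkKind (k + 1 + 1))).card = 0 := sum_eq_zero fun k _ => by simp [linkKind, linkSet]
    rw [h0]
    simp only [linkKind, linkSet, card_singleton, zero_add,
      (hK.isClique _ (hK.bad_subset (bd i).2)).2.2]
    norm_num
  · apply nodup_glue
    · exact fun c hc => hP2 i c hc
    · exact fun c _ => hmnd i _
    · exact fun c hc c' hc' v hv hv' => (hPslot i c i c' hc hc' v hv hv').2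
    · exact fun c hc c' hc' v hv hv' => linkKind_injOn hc hc' (hMinj i _ i _ v hv hv').2
    · intro c hc c' _ v hv hv'
      obtain ⟨K, hKg, hvK⟩ := hPgood i c hc v hv
      exact hMgood i _ v hv' K hKg hvK
  · intro v hv
    rcases mem_glue hv with ⟨c, hc, h⟩ | ⟨c, hc, h⟩
    · obtain ⟨K, hKg, hvK⟩ := hPgood i c hc v h
      exact Or.inl (hclqV K hKg hvK)
    · rw [hmid] at h
      match hκ : linkKind c with
      | Sum.inl false =>
        rw [hκ] at h
        rw [show v = vL i by simpa [linkSet] using h]; exact Or.inr (vL i).2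
      | Sum.inl true =>
        rw [hκ] at h
        exact Or.inl ((hK.isClique _ (hK.bad_subset (bd i).2)).1 h)
      | Sum.inr _ => rw [hκ] at h; simp [linkSet] at h
  · rw [(hglue i).2.2]; simp [xv]
  · intro i j v hv hv'
    rcases mem_glue hv with ⟨c, hc, h⟩ | ⟨c, hc, h⟩ <;>
      rcases mem_glue hv' with ⟨c', hc', h'⟩ | ⟨c', hc', h'⟩
    · exact (hPslot i c j c' hc hc' v h h').1
    · obtain ⟨K, hKg, hvK⟩ := hPgood i c hc v h
      exact absurd hvK (hMgood j _ v h' K hKg)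
    · obtain ⟨K, hKg, hvK⟩ := hPgood j c' hc' v h'
      exact absurd hvK (hMgood i _ v h K hKg)
    · exact (hMinj i _ j _ v h h').1

end CliqueFactor
end TreeUniversality

/-! ### Reinserting bare paths into an embedding -/

namespace TreeUniversality

open Finset
open scoped Classical

lemma Rooting.isContained {V W : Type*} {G : SimpleGraph V} {T : SimpleGraph W} {r : W}
    {par : W → W} {h : W → ℕ} (R : Rooting T r par h) {ψ : W → V} (hψ : Function.Injective ψ)
    (hadj : ∀ t, t ≠ r → G.Adj (ψ (par t)) (ψ t)) : T.IsContained G := by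
  refine ⟨⟨⟨ψ, ?_⟩, hψ⟩⟩
  intro a b hab
  rcases R.edge a b hab with ⟨h1, h2⟩ | ⟨h1, h2⟩
  · have := hadj a h1; rw [h2] at this; exact this.symm
  · have := hadj b h1; rwa [h2] at this

/-- An embedding of the part of a tree outside the interiors of disjoint bare paths extends to the
whole tree if the interiors can be embedded as disjoint paths. -/
lemma Rooting.isContained_of_lists {V W : Type*} {G : SimpleGraph V} {T : SimpleGraph W} {r : W}
    {par : W → W} {h : W → ℕ} (R : Rooting T r par h) {k : ℕ} {J C : Finset W}
    (hJ : ∀ t ∈ J, ∀ t' ∈ J, ∀ i ≤ k + 1, ∀ i' ≤ k + 1, par^[i] t = par^[i'] t' → i = i' ∧ t = t')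
    (hC : ∀ w, w ∉ C ↔ ∃ t ∈ J, ∃ i, 1 ≤ i ∧ i ≤ k ∧ par^[i] t = w)
    (hpar : ∀ t ∈ C, t ∉ J → t ≠ r → par t ∈ C) {φ : W → V} (hφ : Set.InjOn φ C)
    (hadj : ∀ t ∈ C, t ∉ J → t ≠ r → G.Adj (φ (par t)) (φ t))
    {L : W → List V} (hlen : ∀ t ∈ J, (L t).length = k) (hnd : ∀ t ∈ J, (L t).Nodup)
    (hchain : ∀ t ∈ J, (φ t :: L t ++ [φ (par^[k + 1] t)]).IsChain G.Adj)
    (hLφ : ∀ t ∈ J, ∀ w ∈ C, φ w ∉ L t)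
    (hLL : ∀ t ∈ J, ∀ t' ∈ J, ∀ v, v ∈ L t → v ∈ L t' → t = t') : T.IsContained G := by
  have hex : ∀ w, ∃ t i, w ∉ C → t ∈ J ∧ 1 ≤ i ∧ i ≤ k ∧ par^[i] t = w := by
    intro w
    by_cases hw : w ∈ C
    · exact ⟨w, 0, fun h => absurd hw h⟩
    · obtain ⟨t, ht, i, h⟩ := (hC w).1 hw
      exact ⟨t, i, fun _ => ⟨ht, h⟩⟩
  choose τ idx hτ using hex
  -- The interior vertex `par^[i] t` goes to entry i − 1 of `L t`. The default of `getD` never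
  -- matters, as the index is in range.
  set ψ : W → V := fun w => if w ∈ C then φ w else (L (τ w)).getD (idx w - 1) (φ w) with hψ
  have hψC : ∀ w ∈ C, ψ w = φ w := fun w hw => by simp [hψ, hw]
  have hψL : ∀ w, w ∉ C → ∃ hlt : idx w - 1 < (L (τ w)).length, ψ w = (L (τ w))[idx w - 1] := by
    intro w hw
    obtain ⟨h1, h2, h3, h4⟩ := hτ w hw
    have hlt : idx w - 1 < (L (τ w)).length := by rw [hlen _ h1]; omega
    exact ⟨hlt, by simp only [hψ]; rw [if_neg hw, List.getD_eq_getElem _ _ hlt]⟩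
  have hmemC : ∀ t ∈ J, ∀ i ≤ k + 1, (i = 0 ∨ i = k + 1) → par^[i] t ∈ C := by
    intro t ht i hi hi'
    by_contra hcon
    obtain ⟨t', ht', i', h1, h2, h3⟩ := (hC _).1 hcon
    have := (hJ t' ht' t ht i' (by omega) i hi h3).1
    omega
  -- Indexing the bare path with both ends included turns all its adjacencies into the chain
  -- condition.
  have hψq : ∀ t ∈ J, ∀ i (hi : i < (φ t :: L t ++ [φ (par^[k + 1] t)]).length),
      ψ (par^[i] t) = (φ t :: L t ++ [φ (par^[k + 1] t)])[i] := by
    intro t ht i hi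
    have hi' : i ≤ k + 1 := by simp [hlen t ht] at hi; omega
    by_cases h0 : i = 0
    · subst h0
      simpa using hψC t (hmemC t ht 0 (by omega) (Or.inl rfl))
    by_cases h1 : i = k + 1
    · subst h1
      rw [hψC _ (hmemC t ht (k + 1) le_rfl (Or.inr rfl))]
      simp [hlen t ht]
    · have hnC : par^[i] t ∉ C := (hC _).2 ⟨t, ht, i, by omega, by omega, rfl⟩
      obtain ⟨hlt, he⟩ := hψL _ hnC
      obtain ⟨g1, g2, g3, g4⟩ := hτ _ hnC
      have g5 := hJ _ g1 t ht _ (by omega) i hi' g4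
      rw [he]
      obtain ⟨i, rfl⟩ : ∃ j, i = j + 1 := ⟨i - 1, by omega⟩
      have hil : i < (L t).length := by rw [hlen t ht]; omega
      simp only [List.cons_append, List.getElem_cons_succ, List.getElem_append_left hil, g5.1, g5.2,
        Nat.add_sub_cancel]
  have hψadj : ∀ t ∈ J, ∀ i ≤ k, G.Adj (ψ (par^[i] t)) (ψ (par^[i + 1] t)) := by
    intro t ht i hi
    have h1 : i + 1 < (φ t :: L t ++ [φ (par^[k + 1] t)]).length := by simp [hlen t ht]; omega
    rw [hψq t ht i (by omega), hψq t ht (i + 1) h1]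
    exact List.isChain_iff_getElem.1 (hchain t ht) i h1
  refine R.isContained (ψ := ψ) ?_ ?_
  · intro w w' hww'
    by_cases hw : w ∈ C <;> by_cases hw' : w' ∈ C
    · rw [hψC w hw, hψC w' hw'] at hww'
      exact hφ hw hw' hww'
    · obtain ⟨hlt, he⟩ := hψL _ hw'
      rw [hψC w hw, he] at hww'
      exact absurd (hww' ▸ List.getElem_mem hlt) (hLφ _ (hτ w' hw').1 w hw)
    · obtain ⟨hlt, he⟩ := hψL _ hw
      rw [hψC w' hw', he] at hww'
      exact absurd (hww' ▸ List.getElem_mem hlt) (hLφ _ (hτ w hw).1 w' hw')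
    · obtain ⟨hlt, he⟩ := hψL _ hw
      obtain ⟨hlt', he'⟩ := hψL _ hw'
      obtain ⟨g1, g2, g3, g4⟩ := hτ _ hw
      obtain ⟨g1', g2', g3', g4'⟩ := hτ _ hw'
      have hv : (L (τ w))[idx w - 1] ∈ L (τ w') := by
        rw [← he, hww', he']; exact List.getElem_mem hlt'
      have hττ := hLL _ g1 _ g1' _ (List.getElem_mem hlt) hv
      have hidx : idx w - 1 = idx w' - 1 := by
        rw [he, he'] at hww'
        simp only [← hττ] at hww'
        exact (hnd _ g1).getElem_inj_iff.1 hww'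
      have hi : idx w = idx w' := by omega
      rw [← g4, ← g4', hττ, hi]
  · intro t htr
    by_cases htC : t ∈ C
    · by_cases htJ : t ∈ J
      · exact (hψadj t htJ 0 (by omega)).symm
      · rw [hψC _ (hpar t htC htJ htr), hψC t htC]
        exact hadj t htC htJ htr
    · obtain ⟨g1, g2, g3, g4⟩ := hτ _ htC
      have := hψadj _ g1 _ g3
      rw [Function.iterate_succ_apply', g4] at this
      exact this.symm

end TreeUniversality

/-! ### Trees with few leaves: embedding the contracted core -/

namespace TreeUniversality

open Finset
open scoped Classical

section FewLeaves

variable {W : Type*} [Fintype W] {T : SimpleGraph W} {r : W} {par : W → W} {h : W → ℕ}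

/-- A family of bare paths: all vertices `par^[i] t` with `t ∈ J` and `i ≤ k + 1` are distinct and
have degree two. -/
structure IsBareFamily (T : SimpleGraph W) (par : W → W) (k : ℕ) (J : Finset W) : Prop where
  deg : ∀ t ∈ J, ∀ i ≤ k + 1, degIn T (par^[i] t) univ = 2
  inj : ∀ t ∈ J, ∀ t' ∈ J, ∀ i ≤ k + 1, ∀ i' ≤ k + 1, par^[i] t = par^[i'] t' → i = i' ∧ t = t'

/-- The vertices that are not interior vertices of the bare paths. -/
noncomputable def bareCore (par : W → W) (k : ℕ) (J : Finset W) : Finset W :=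
  univ.filter fun w => ¬ ∃ t ∈ J, ∃ i, 1 ≤ i ∧ i ≤ k ∧ par^[i] t = w

/-- The parent function after contracting the bare paths to edges. -/
noncomputable def barePar (par : W → W) (k : ℕ) (J : Finset W) (t : W) : W :=
  if t ∈ J then par^[k + 1] t else par t

lemma notMem_bareCore {k : ℕ} {J : Finset W} {w : W} :
    w ∉ bareCore par k J ↔ ∃ t ∈ J, ∃ i, 1 ≤ i ∧ i ≤ k ∧ par^[i] t = w := by
  simp [bareCore]

variable {k : ℕ} {J : Finset W}

lemma IsBareFamily.card_core (B : IsBareFamily T par k J) :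
    (bareCore par k J).card + k * J.card = Fintype.card W := by
  have h1 : (bareCore par k J)ᶜ = (J ×ˢ Icc 1 k).image fun x => par^[x.2] x.1 := by
    ext w
    rw [mem_compl, notMem_bareCore]
    simp only [mem_image, mem_product, mem_Icc, Prod.exists]
    constructor
    · rintro ⟨t, ht, i, h1, h2, h3⟩; exact ⟨t, i, ⟨ht, h1, h2⟩, h3⟩
    · rintro ⟨t, i, ⟨ht, h1, h2⟩, h3⟩; exact ⟨t, ht, i, h1, h2, h3⟩
  have h2 : ((J ×ˢ Icc 1 k).image fun x => par^[x.2] x.1).card = J.card * k := by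
    rw [card_image_of_injOn, card_product, Nat.card_Icc, Nat.add_sub_cancel]
    rintro ⟨t, i⟩ hx ⟨t', i'⟩ hx' he
    simp only [coe_product, coe_Icc, Set.mem_prod, mem_coe, Set.mem_Icc] at hx hx' he
    have := B.inj t hx.1 t' hx'.1 i (by omega) i' (by omega) he
    rw [this.1, this.2]
  rw [← card_add_card_compl (bareCore par k J), h1, h2, mul_comm]

lemma IsBareFamily.ne_root (B : IsBareFamily T par k J) (hr : degIn T r univ = 1) {t : W}
    (ht : t ∈ J) {i : ℕ} (hi : i ≤ k + 1) : par^[i] t ≠ r := fun e => by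
  have := B.deg t ht i hi
  rw [e] at this
  omega

lemma IsBareFamily.mem_core_of_mem (B : IsBareFamily T par k J) {t : W} (ht : t ∈ J) {i : ℕ}
    (hi : i = 0 ∨ i = k + 1) : par^[i] t ∈ bareCore par k J := by
  by_contra hcon
  obtain ⟨t', ht', i', h1, h2, h3⟩ := notMem_bareCore.1 hcon
  have := (B.inj t' ht' t ht i' (by omega) i (by omega) h3).1
  omega

lemma IsBareFamily.root_mem_core (B : IsBareFamily T par k J) (hr : degIn T r univ = 1) :
    r ∈ bareCore par k J := by
  by_contra hcon
  obtain ⟨t', ht', i', h1, h2, h3⟩ := notMem_bareCore.1 hcon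
  exact B.ne_root hr ht' (by omega) h3

/-- If the parent were interior to a bare path, its only child would be the next vertex down that
path. Then t would be interior as well, or the lower end, which belongs to J. -/
lemma IsBareFamily.par_mem_core (B : IsBareFamily T par k J) (R : Rooting T r par h)
    (hr : degIn T r univ = 1) {t : W} (ht : t ∈ bareCore par k J) (htJ : t ∉ J) (htr : t ≠ r) :
    par t ∈ bareCore par k J := by
  by_contra hcon
  obtain ⟨t', ht', i, h1, h2, h3⟩ := notMem_bareCore.1 hcon
  obtain ⟨i, rfl⟩ : ∃ j, i = j + 1 := ⟨i - 1, by omega⟩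
  have h4 : t = par^[i] t' := by
    have h5 := B.deg t' ht' (i + 1) (by omega)
    have h6 := B.ne_root hr ht' (i := i + 1) (by omega)
    exact R.child_unique h5 h6 htr (B.ne_root hr ht' (by omega)) h3.symm
      (Function.iterate_succ_apply' par i t').symm
  by_cases hi : i = 0
  · subst hi; exact htJ (by rw [h4]; exact ht')
  · exact notMem_bareCore.2 ⟨t', ht', i, by omega, by omega, h4.symm⟩ ht

lemma IsBareFamily.barePar_mem (B : IsBareFamily T par k J) (R : Rooting T r par h)
    (hr : degIn T r univ = 1) {t : W} (ht : t ∈ bareCore par k J) (htr : t ≠ r) :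
    barePar par k J t ∈ bareCore par k J ∧ h (barePar par k J t) < h t := by
  unfold barePar
  split_ifs with htJ
  · refine ⟨B.mem_core_of_mem htJ (Or.inr rfl), ?_⟩
    have : ∀ i ≤ k + 1, h (par^[i] t) + i = h t := by
      intro i
      induction i with
      | zero => simp
      | succ i ih =>
        intro hi
        have h1 := ih (by omega)
        have h3 := R.height _ (B.ne_root hr htJ (i := i) (by omega))
        rw [Function.iterate_succ_apply']
        omega
    have := this (k + 1) le_rfl
    omega
  · refine ⟨B.par_mem_core R hr ht htJ htr, ?_⟩
    have := R.height t htr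
    omega

/-- Contraction does not raise the number of children: a contracted child in J is replaced by the
top interior vertex of its path, a genuine child that lies outside the core. -/
lemma IsBareFamily.card_barePar_le (B : IsBareFamily T par k J) (R : Rooting T r par h)
    (hr : degIn T r univ = 1) (hk : 1 ≤ k) (t : W) :
    ((bareCore par k J).filter fun x => x ∉ ({r} : Finset W) ∧ barePar par k J x = t).card ≤
      degIn T t univ := by
  refine le_trans ?_ (R.card_children_le t)
  apply card_le_card_of_injOn (fun x => if x ∈ J then par^[k] x else x)
  · intro x hx
    simp only [coe_filter, Set.mem_ofPred_eq, mem_singleton] at hx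
    simp only [coe_filter, mem_univ, true_and, Set.mem_ofPred_eq]
    obtain ⟨h1, h2, h3⟩ := hx
    unfold barePar at h3
    split_ifs at h3 ⊢ with hxJ
    · refine ⟨B.ne_root hr hxJ (by omega), ?_⟩
      rw [← h3, Function.iterate_succ_apply']
    · exact ⟨h2, h3⟩
  · intro x hx y hy hxy
    simp only [coe_filter, Set.mem_ofPred_eq] at hx hy
    simp only at hxy
    split_ifs at hxy with h1 h2 h2
    · exact (B.inj x h1 y h2 k (by omega) k (by omega) hxy).2
    · exact absurd hy.1 (notMem_bareCore.2 ⟨x, h1, k, hk, le_rfl, hxy⟩)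
    · exact absurd hx.1 (notMem_bareCore.2 ⟨y, h2, k, hk, le_rfl, hxy.symm⟩)
    · exact hxy

lemma nbrs_singleton_inter {V : Type*} [Fintype V] {G : SimpleGraph V} (v : V) (A : Finset V) :
    degIn G v A = (nbrs G {v} ∩ A).card := by
  unfold degIn
  congr 1
  ext u
  simp [and_comm]

/-- A tree with a bare family embeds so that all vertices outside the bare paths are placed in
`V₁` and many neighbours of every vertex remain unused. -/
lemma IsBareFamily.exists_core_embedding {V : Type*} [Fintype V] {G : SimpleGraph V}
    (B : IsBareFamily T par k J) (R : Rooting T r par h)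
    (hr : degIn T r univ = 1) (hk : 1 ≤ k) {m D D' d : ℕ} {V₁ V₂ : Finset V}
    (hJoin : Joined G m V₁) (hm : 1 ≤ m) (hdisj : Disjoint V₁ V₂) (hcov : ∀ v, v ∈ V₁ ∨ v ∈ V₂)
    (hD : ∀ t, degIn T t univ ≤ D) (hd : ∀ v, d ≤ degIn G v V₁) (hdD : (D + D') * (2 * m) + 1 ≤ d)
    (hne : V₁.Nonempty)
    (hroom : (D + D') * (2 * m) + 2 * m + (bareCore par k J).card + 1 < V₁.card) :
    ∃ φ : W → V, Set.InjOn φ (bareCore par k J) ∧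
      (∀ t ∈ bareCore par k J, t ≠ r → G.Adj (φ (barePar par k J t)) (φ t)) ∧
      (∀ t ∈ bareCore par k J, φ t ∈ V₁) ∧
      ∀ v, D' ≤ (nbrs G {v} \ (V₂ ∪ (bareCore par k J).image φ)).card := by
  obtain ⟨v₀, hv₀⟩ := hne
  set C := bareCore par k J with hC
  have hrC := B.root_mem_core hr
  -- The demand starts at D + D'. Embedding children spends at most D at each vertex, so D' free
  -- neighbours survive everywhere. They are needed for the connecting paths.
  have hO₀ : Extendable G (2 * m) (insert v₀ V₂) fun _ => D + D' := by
    apply extendable_const_of_degree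
    intro v
    have h1 := hd v
    rw [nbrs_singleton_inter] at h1
    have h2 : (nbrs G {v} ∩ V₁).erase v₀ ⊆ nbrs G {v} \ insert v₀ V₂ := by
      intro x
      simp only [mem_erase, mem_inter, mem_sdiff, mem_insert, not_or]
      exact fun h => ⟨h.2.1, h.1, disjoint_left.1 hdisj h.2.2⟩
    have h3 := card_le_card h2
    have h4 := pred_card_le_card_erase (s := nbrs G {v} ∩ V₁) (a := v₀)
    omega
  have hV₁O : V₁.card ≤ (V₁ \ insert v₀ V₂).card + 1 := by
    have h2 : V₁.erase v₀ ⊆ V₁ \ insert v₀ V₂ := by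
      intro x
      simp only [mem_erase, mem_sdiff, mem_insert, not_or]
      exact fun h => ⟨h.2, h.1, disjoint_left.1 hdisj h.2⟩
    have h3 := card_le_card h2
    have h4 := pred_card_le_card_erase (s := V₁) (a := v₀)
    omega
  obtain ⟨φ, h1, h2, h3, h4, -, h6, h7⟩ := exists_embedding hJoin hm hO₀ (barePar par k J) h r C {r}
    hrC (mem_singleton_self _) (fun t ht htr => B.barePar_mem R hr ht htr)
    (fun t _ => (B.card_barePar_le R hr hk t).trans ((hD t).trans (Nat.le_add_right _ _)))
    (by omega) (fun _ _ => True) v₀ (mem_insert_self _ _) trivial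
    (fun _ _ _ _ _ _ _ _ _ _ _ => trivial)
    (fun s φ t hrs _ _ htS hts _ _ _ => absurd (by rwa [mem_singleton.1 htS]) hts)
  have hφV : ∀ t ∈ C, φ t ∈ V₁ := by
    intro t ht
    by_cases htr : t = r
    · rw [htr, h6]; exact hv₀
    · have := h3 t ht (by simpa using htr)
      rw [mem_insert, not_or] at this
      exact (hcov _).resolve_right this.2
  refine ⟨φ, h1, h2, hφV, fun v => ?_⟩
  have h8 := h7 {v} (by simp; omega)
  have h9 : (C.filter fun x => x ∉ ({r} : Finset W) ∧ φ (barePar par k J x) = v).card ≤ D := by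
    by_cases hex : ∃ t ∈ C, φ t = v
    · obtain ⟨t, ht, rfl⟩ := hex
      refine le_trans (card_le_card ?_) ((B.card_barePar_le R hr hk t).trans (hD t))
      intro x
      simp only [mem_filter]
      rintro ⟨hx, hxr, he⟩
      exact ⟨hx, hxr, h1 (B.barePar_mem R hr hx (by simpa using hxr)).1 ht he⟩
    · rw [card_eq_zero.2]
      · exact Nat.zero_le _
      · rw [filter_eq_empty_iff]
        rintro x hx ⟨hxr, he⟩
        exact hex ⟨_, (B.barePar_mem R hr hx (by simpa using hxr)).1, he⟩
  have h10 : insert v₀ V₂ ∪ C.image φ = V₂ ∪ C.image φ := by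
    ext x
    simp only [mem_union, mem_insert]
    constructor
    · rintro ((rfl | h) | h)
      · exact Or.inr (mem_image.2 ⟨r, hrC, h6⟩)
      · exact Or.inl h
      · exact Or.inr h
    · tauto
  rw [sum_singleton, h10] at h8
  omega

end FewLeaves
end TreeUniversality

/-! ### Trees with few leaves: realising the bare paths -/

namespace TreeUniversality

open Finset
open scoped Classical

section FewLeaves

variable {W : Type*}

lemma isChain_cons_append_singleton {V : Type*} {G : SimpleGraph V} {l : List V} {a b x y : V}
    (h : l.IsChain G.Adj) (hx : l.head? = some x) (hy : l.getLast? = some y) (hax : G.Adj a x)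
    (hyb : G.Adj y b) : (a :: l ++ [b]).IsChain G.Adj := by
  have h1 : (l ++ [b]).IsChain G.Adj := isChain_append_of_ends h (by simp) hy rfl hyb
  exact isChain_append_of_ends (l := [a]) (by simp) h1 rfl (by simp [hx]) hax

/-- The connecting paths for bare paths with `505` interior vertices: most of them inside `V₁`,
the others through the clique factor, using up all vertices of `V₁`. -/
lemma exists_bare_path_lists {V : Type*} [Fintype V] {G : SimpleGraph V} {n m : ℕ} {γ : ℝ}
    {V₁ V₂ : Finset V} {𝒦 good bad : Finset (Finset V)}
    (hK : IsSuitableCliqueFactor G n γ V₂ 𝒦 good bad) (hV₂ : V₂.card = 500 * ⌊γ * n⌋₊)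
    (hdisj : Disjoint V₁ V₂) (hcov : ∀ v, v ∈ V₁ ∨ v ∈ V₂) (hJoin : Joined G m V₁) (hm : 1 ≤ m)
    (hg : 2 * m * m + 4 * m < ⌊γ * n⌋₊) {J : Finset W} (hJ : ⌊γ * n⌋₊ ≤ J.card) {I : Finset V}
    (hI : I ⊆ V₁) (hIc : V₁.card + 500 * ⌊γ * n⌋₊ = I.card + 505 * J.card)
    (hdeg : ∀ v, 2 * m * m ≤ (nbrs G {v} \ (V₂ ∪ I)).card)
    (ep : W → Bool → V) (hepI : ∀ t ∈ J, ∀ b, ep t b ∈ I)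
    (hep : ∀ t ∈ J, ∀ t' ∈ J, ∀ b b', ep t b = ep t' b' → t = t' ∧ b = b') :
    ∃ L : W → List V, (∀ t ∈ J, (L t).length = 505 ∧ (L t).Nodup ∧
      (ep t false :: L t ++ [ep t true]).IsChain G.Adj ∧ ∀ v ∈ L t, v ∉ I) ∧
      ∀ t ∈ J, ∀ t' ∈ J, ∀ v, v ∈ L t → v ∈ L t' → t = t' := by
  set g := ⌊γ * n⌋₊ with hgdef
  -- The g bare paths in `J₂` will run through the clique factor.
  obtain ⟨J₂, hJ₂, hJ₂c⟩ := exists_subset_card_eq hJ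
  -- the end cliques
  obtain ⟨E⟩ : Nonempty (J₂ × Bool ↪ good) := Function.Embedding.nonempty_of_card_le (by
    rw [Fintype.card_coe, hK.card_good, Fintype.card_prod, Fintype.card_coe, hJ₂c,
      Fintype.card_bool]
    omega)
  have hEne : ∀ x, ∃ v, v ∈ (E x : Finset V) := by
    intro x
    have h1 := (hK.isClique _ (hK.good_subset (E x).2)).2.2
    exact card_pos.1 (by omega)
  choose s hs using hEne
  have hsV : ∀ x, s x ∈ V₂ := fun x => (hK.isClique _ (hK.good_subset (E x).2)).1 (hs x)
  have hsinj : ∀ x y, s x = s y → x = y := by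
    intro x y hxy
    by_contra hne
    exact disjoint_left.1 (hK.pairwiseDisjoint _ (hK.good_subset (E x).2) _
      (hK.good_subset (E y).2) fun e => hne (E.injective (Subtype.ext e))) (hs x) (hxy ▸ hs y)
  set O := V₂ ∪ I with hO
  have hOV : ∀ v, v ∉ O → v ∈ V₁ := fun v hv =>
    (hcov v).resolve_right fun h => hv (mem_union_left _ h)
  have hVO : (V₁ \ O).card + I.card = V₁.card := by
    have h1 : V₁ \ O = V₁ \ I := by
      ext x
      simp only [hO, mem_sdiff, mem_union, not_or]
      exact ⟨fun h => ⟨h.1, h.2.2⟩, fun h => ⟨h.1, disjoint_left.1 hdisj h.1, h.2⟩⟩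
    rw [h1, card_sdiff_add_card_eq_card hI]
  have hExt : Extendable G (2 * m) O (demandOn m univ) := by
    have : demandOn m (univ : Finset V) = fun _ => m := by ext; simp [demandOn]
    rw [this]
    apply extendable_const_of_degree
    intro v
    have := hdeg v
    have h2 : m * (2 * m) = 2 * m * m := by ring
    omega
  -- the requests
  let J₁ := J \ J₂
  have hJ₁c : J₁.card + g = J.card := by rw [← hJ₂c]; exact card_sdiff_add_card_eq_card hJ₂
  -- A bare path in `J₁` requests one path with 503 + 2 interior vertices. One in `J₂` requests two
  -- connectors with two interior vertices each, from its ends to its two end cliques.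
  let a : J₁ ⊕ (J₂ × Bool) → V := Sum.elim (fun t => ep t false) (fun x => ep x.1 x.2)
  let b : J₁ ⊕ (J₂ × Bool) → V := Sum.elim (fun t => ep t true) s
  let j : J₁ ⊕ (J₂ × Bool) → ℕ := Sum.elim (fun _ => 503) (fun _ => 0)
  have h1J : ∀ t : J₁, (t : W) ∈ J := fun t => (mem_sdiff.1 t.2).1
  have h1J2 : ∀ t : J₁, (t : W) ∉ J₂ := fun t => (mem_sdiff.1 t.2).2
  have h2J : ∀ t : J₂, (t : W) ∈ J := fun t => hJ₂ t.2
  have hIs : ∀ t ∈ J, ∀ b, ∀ x, ep t b ≠ s x := fun t ht b x e =>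
    disjoint_left.1 hdisj (hI (hepI t ht b)) (e ▸ hsV x)
  have hsum : ∑ i, (j i + 2) = 505 * J₁.card + 4 * g := by
    rw [Fintype.sum_sum_type]
    simp [j, hJ₂c]; omega
  obtain ⟨l, hl1, hl2⟩ := hJoin.exists_paths hm a b j univ hExt hOV (fun v _ => mem_univ v)
    (by
      rintro (t | x) _
      · exact ⟨mem_univ _, mem_union_right _ (hepI _ (h1J t) _)⟩
      · exact ⟨mem_univ _, mem_union_right _ (hepI _ (h2J x.1) _)⟩)
    (by
      rintro (t | x) _
      · exact ⟨mem_univ _, mem_union_right _ (hepI _ (h1J t) _)⟩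
      · exact ⟨mem_univ _, mem_union_left _ (hsV x)⟩)
    (by
      rintro (t | x) _ e
      · simpa using (hep _ (h1J t) _ (h1J t) _ _ e).2
      · exact hIs _ (h2J x.1) _ _ e)
    (by
      rintro (t | x) _ (t' | x') _ hne
      · have hne' : (t : W) ≠ t' := fun e => hne (by rw [Subtype.ext e])
        exact ⟨fun e => hne' (hep _ (h1J t) _ (h1J t') _ _ e).1,
          fun e => hne' (hep _ (h1J t) _ (h1J t') _ _ e).1,
          fun e => hne' (hep _ (h1J t) _ (h1J t') _ _ e).1⟩
      · have hne' : (t : W) ≠ x'.1 := fun e => h1J2 t (by rw [e]; exact x'.1.2)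
        exact ⟨fun e => hne' (hep _ (h1J t) _ (h2J x'.1) _ _ e).1, hIs _ (h1J t) _ _,
          hIs _ (h1J t) _ _⟩
      · have hne' : (x.1 : W) ≠ t' := fun e => h1J2 t' (by rw [← e]; exact x.1.2)
        exact ⟨fun e => hne' (hep _ (h2J x.1) _ (h1J t') _ _ e).1,
          fun e => hne' (hep _ (h2J x.1) _ (h1J t') _ _ e).1, fun e => hIs _ (h1J t') _ _ e.symm⟩
      · refine ⟨fun e => hne ?_, hIs _ (h2J x.1) _ _, fun e => hne (by rw [hsinj _ _ e])⟩
        have := hep _ (h2J x.1) _ (h2J x'.1) _ _ e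
        rw [Prod.ext (Subtype.ext this.1) this.2])
    (by rw [hsum]; omega)
  have hl1 := fun i => hl1 i (mem_univ i)
  have hl2 : ∀ i k v, v ∈ l i → v ∈ l k → i = k := by
    intro i k v hv hv'
    by_contra hne
    exact hl2 i (mem_univ _) k (mem_univ _) hne v hv hv'
  -- the vertices of `V₁` that are still unused
  set Us : Finset V := univ.biUnion fun i => (l i).toFinset with hUs
  have hUsc : Us.card = 505 * J₁.card + 4 * g := by
    rw [hUs, card_biUnion, ← hsum]
    · exact sum_congr rfl fun i _ => by
        rw [List.toFinset_card_of_nodup (hl1 i).2.1, (hl1 i).1]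
    · intro i _ k _ hne
      rw [Function.onFun, disjoint_left]
      intro v hv hv'
      exact hne (hl2 i k v (List.mem_toFinset.1 hv) (List.mem_toFinset.1 hv'))
  have hUsV : Us ⊆ V₁ \ O := by
    intro v hv
    obtain ⟨i, _, hv⟩ := mem_biUnion.1 hv
    have := (hl1 i).2.2.1 v (List.mem_toFinset.1 hv)
    exact mem_sdiff.2 ⟨hOV v this, this⟩
  -- By `hIc` the free part of V₁ has 505|J| − 500g = 505|J₁| + 5g vertices, and the requests used
  -- 505|J₁| + 4g of them.
  have hLoc : ((V₁ \ O) \ Us).card = g := by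
    have := card_sdiff_add_card_eq_card hUsV
    omega
  obtain ⟨Q, hQ1, hQ2⟩ := exists_clique_paths (ι := J₂) hK hV₂ (by rw [Fintype.card_coe, hJ₂c])
    (fun x => (E x : Finset V)) (fun x => (E x).2) (fun x y e => E.injective (Subtype.ext e)) s hs
    ((V₁ \ O) \ Us) hLoc (disjoint_left.2 fun v hv => disjoint_left.1 hdisj
      (mem_sdiff.1 (mem_sdiff.1 hv).1).1)
  have hQl : ∀ i k v, v ∈ Q i → v ∉ l k := by
    intro i k v hv hv'
    rcases (hQ1 i).2.2.1 v hv with h | h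
    · exact (hl1 k).2.2.1 v hv' (mem_union_left _ h)
    · exact (mem_sdiff.1 h).2 (mem_biUnion.2 ⟨k, mem_univ _, List.mem_toFinset.2 hv'⟩)
  have hQI : ∀ i v, v ∈ Q i → v ∉ I := by
    intro i v hv hvI
    rcases (hQ1 i).2.2.1 v hv with h | h
    · exact disjoint_left.1 hdisj (hI hvI) h
    · exact (mem_sdiff.1 (mem_sdiff.1 h).1).2 (mem_union_right _ hvI)
  let owner : J₁ ⊕ (J₂ × Bool) → W := Sum.elim (fun t => t) (fun x => x.1)
  have hfin : ∀ t, ∃ L : List V, t ∈ J → L.length = 505 ∧ L.Nodup ∧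
      (ep t false :: L ++ [ep t true]).IsChain G.Adj ∧
      ∀ v ∈ L, (∃ i, owner i = t ∧ v ∈ l i) ∨ ∃ i : J₂, (i : W) = t ∧ v ∈ Q i := by
    intro t
    by_cases htJ : t ∈ J
    swap
    · exact ⟨[], fun h => absurd h htJ⟩
    by_cases ht2 : t ∈ J₂
    · obtain ⟨p1, p2, p3, p4⟩ := hl1 (Sum.inr (⟨t, ht2⟩, false))
      obtain ⟨q1, q2, q3, q4⟩ := hl1 (Sum.inr (⟨t, ht2⟩, true))
      obtain ⟨u1, u2, u3, u4, u5, u6⟩ := hQ1 ⟨t, ht2⟩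
      simp only [a, b, j, Sum.elim_inr] at p1 p4 q1 q4
      -- Connector, clique path, reversed connector: 2 + 501 + 2 = 505 vertices.
      refine ⟨l (Sum.inr (⟨t, ht2⟩, false)) ++ (Q ⟨t, ht2⟩ ++
        (l (Sum.inr (⟨t, ht2⟩, true))).reverse), fun _ => ⟨?_, ?_, ?_, ?_⟩⟩
      · simp [p1, q1, u1]
      · rw [List.nodup_append', List.nodup_append', List.nodup_reverse]
        refine ⟨p2, ⟨u2, q2, ?_⟩, ?_⟩
        · intro v hv hv'
          exact hQl _ _ v hv (List.mem_reverse.1 hv')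
        · intro v hv hv'
          rcases List.mem_append.1 hv' with h | h
          · exact hQl _ _ v h hv
          · have := hl2 _ _ v hv (List.mem_reverse.1 h)
            simp at this
      · obtain ⟨x, x', hx⟩ := List.length_eq_two.1 p1
        obtain ⟨y, y', hy⟩ := List.length_eq_two.1 q1
        rw [hx] at p4 ⊢
        rw [hy] at q4 ⊢
        simp only [List.cons_append, List.nil_append, List.isChain_cons_cons] at p4 q4
        have h1 : (Q ⟨t, ht2⟩ ++ [y', y]).IsChain G.Adj :=
          isChain_append_of_ends u4 (by simpa using q4.2.1.symm) u6 rfl q4.2.2.1.symm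
        have h2 : ([x, x'] ++ (Q ⟨t, ht2⟩ ++ [y', y])).IsChain G.Adj :=
          isChain_append_of_ends (by simpa using p4.2.1) h1 rfl (by simp [u5]) p4.2.2.1
        exact isChain_cons_append_singleton (x := x) (y := y) h2 rfl
          (by
            change ([x, x'] ++ (_ ++ ([y'] ++ [y]))).getLast? = _
            rw [← List.append_assoc, ← List.append_assoc]
            exact List.getLast?_concat) p4.1 q4.1.symm
      · intro v hv
        rcases List.mem_append.1 hv with h | h
        · exact Or.inl ⟨_, rfl, h⟩
        · rcases List.mem_append.1 h with h | h
          · exact Or.inr ⟨_, rfl, h⟩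
          · exact Or.inl ⟨Sum.inr (⟨t, ht2⟩, true), rfl, List.mem_reverse.1 h⟩
    · have ht1 : t ∈ J₁ := mem_sdiff.2 ⟨htJ, ht2⟩
      obtain ⟨p1, p2, p3, p4⟩ := hl1 (Sum.inl ⟨t, ht1⟩)
      exact ⟨l (Sum.inl ⟨t, ht1⟩), fun _ => ⟨p1, p2, p4, fun v hv => Or.inl ⟨_, rfl, hv⟩⟩⟩
  choose L hL using hfin
  refine ⟨L, fun t ht => ⟨(hL t ht).1, (hL t ht).2.1, (hL t ht).2.2.1, fun v hv hvI => ?_⟩, ?_⟩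
  · rcases (hL t ht).2.2.2 v hv with ⟨i, _, h⟩ | ⟨i, _, h⟩
    · exact (hl1 i).2.2.1 v h (mem_union_right _ hvI)
    · exact hQI i v h hvI
  · intro t ht t' ht' v hv hv'
    rcases (hL t ht).2.2.2 v hv with ⟨i, h1, h⟩ | ⟨i, h1, h⟩ <;>
      rcases (hL t' ht').2.2.2 v hv' with ⟨i', h1', h'⟩ | ⟨i', h1', h'⟩
    · rw [← h1, ← h1', hl2 i i' v h h']
    · exact absurd h (hQl _ _ v h')
    · exact absurd h' (hQl _ _ v h)
    · rw [← h1, ← h1', hQ2 i i' v h h']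

variable [Fintype W] {T : SimpleGraph W}

/-- Trees with few leaves. -/
lemma isContained_of_few_leaves {V : Type*} [Fintype V] {G : SimpleGraph V} {n m D d : ℕ} {γ : ℝ}
    {V₁ V₂ : Finset V} {𝒦 good bad : Finset (Finset V)} (hV : Fintype.card V = n)
    (hK : IsSuitableCliqueFactor G n γ V₂ 𝒦 good bad) (hV₂ : V₂.card = 500 * ⌊γ * n⌋₊)
    (hdisj : Disjoint V₁ V₂) (hcov : ∀ v, v ∈ V₁ ∨ v ∈ V₂) (hJoin : Joined G m V₁) (hm : 1 ≤ m)
    (hg : 2 * m * m + 4 * m < ⌊γ * n⌋₊) (hd : ∀ v, d ≤ degIn G v V₁)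
    (hdD : (D + 2 * m * m) * (2 * m) + 1 ≤ d)
    (hroom : 3 * ((D + 2 * m * m) * (2 * m) + 2 * m + 500 * ⌊γ * n⌋₊ + 2) ≤ n)
    (hT : T.IsTree) (hW : Fintype.card W = n) (hD : ∀ t, degIn T t univ ≤ D)
    (hL : 7098 * (leafSet T).card ≤ n) : T.IsContained G := by
  have hn2 : 2 ≤ n := by omega
  have : Nontrivial W := Fintype.one_lt_card_iff_nontrivial.1 (by omega)
  -- Rooting at a leaf keeps the root off the bare paths, whose vertices all have degree two.
  obtain ⟨r, hr⟩ := hT.exists_vert_degree_one_of_nontrivial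
  rw [← degIn_univ_eq_degree] at hr
  obtain ⟨par, h, R⟩ := exists_rooting hT r
  obtain ⟨k, hk⟩ : ∃ k, k = 505 := ⟨_, rfl⟩
  -- Both ends included, a bare path has 507 vertices; 2·507·7 = 7098 is the leaf bound. The family
  -- has |J| ≥ n/1014, which exceeds g because `hroom` gives 1500g < n.
  obtain ⟨J, hJ1, hJ2, hJ3⟩ := R.exists_bare_paths hT (by omega) hr (k + 1) (by rw [hk]; omega)
  have B : IsBareFamily T par k J := ⟨hJ2, hJ3⟩
  have hcore := B.card_core
  have hcore' : k * J.card = 505 * J.card := by rw [hk]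
  rw [hk] at hJ1
  have hVc : V₁.card + V₂.card = n := by
    rw [← card_union_of_disjoint hdisj, ← hV, ← card_univ]
    congr 1; ext v; simp [hcov v]
  obtain ⟨φ, h1, h2, h3, h4⟩ := B.exists_core_embedding (D' := 2 * m * m) R hr (by omega) hJoin hm
    hdisj hcov hD hd hdD (card_pos.1 (by omega)) (by omega)
  have hmem : ∀ t ∈ J, ∀ b : Bool, (if b then par^[k + 1] t else t) ∈ bareCore par k J := by
    intro t ht b
    cases b
    · exact B.mem_core_of_mem ht (i := 0) (Or.inl rfl)
    · exact B.mem_core_of_mem ht (i := k + 1) (Or.inr rfl)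
  obtain ⟨L, hL1, hL2⟩ := exists_bare_path_lists hK hV₂ hdisj hcov hJoin hm hg (J := J) (by omega)
    (I := (bareCore par k J).image φ) (by
      intro v hv
      obtain ⟨t, ht, rfl⟩ := mem_image.1 hv
      exact h3 t ht) (by rw [card_image_of_injOn h1]; omega) h4
    (fun t b => φ (if b then par^[k + 1] t else t))
    (fun t ht b => mem_image_of_mem _ (hmem t ht b))
    (by
      intro t ht t' ht' b b' he
      have he' := h1 (hmem t ht b) (hmem t' ht' b') he
      have key : ∀ i ≤ k + 1, ∀ i' ≤ k + 1, par^[i] t = par^[i'] t' → i = i' ∧ t = t' :=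
        hJ3 t ht t' ht'
      cases b <;> cases b'
      · exact ⟨by simpa using he', rfl⟩
      · have := (key 0 (by omega) (k + 1) le_rfl (by simpa using he')).1; omega
      · have := (key (k + 1) le_rfl 0 (by omega) (by simpa using he')).1; omega
      · exact ⟨(key (k + 1) le_rfl (k + 1) le_rfl (by simpa using he')).2, rfl⟩)
  refine R.isContained_of_lists (k := k) (J := J) (C := bareCore par k J) hJ3
    (fun w => notMem_bareCore) (fun t ht htJ htr => B.par_mem_core R hr ht htJ htr) h1 ?_
    (fun t ht => (hL1 t ht).1.trans hk.symm) (fun t ht => (hL1 t ht).2.1)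
    (fun t ht => (hL1 t ht).2.2.1)
    (fun t ht w hw hwL => (hL1 t ht).2.2.2 _ hwL (mem_image_of_mem _ hw)) hL2
  intro t ht htJ htr
  have := h2 t ht htr
  rwa [barePar, if_neg htJ] at this

end FewLeaves
end TreeUniversality

/-! ### Trees with many leaves: placing the leaves by Hall's theorem -/

namespace TreeUniversality

open Finset
open scoped Classical

section ManyLeaves

variable {V W : Type*} [Fintype V] [Fintype W] {G : SimpleGraph V} {T : SimpleGraph W} {r : W}
  {par : W → W} {h : W → ℕ}

lemma Rooting.par_notMem_leafSet (R : Rooting T r par h) (hr : degIn T r univ ≠ 1) {t : W}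
    (ht : t ≠ r) : par t ∉ leafSet T := by
  simp only [leafSet, mem_filter, mem_univ, true_and]
  intro h1
  have hpr : par t ≠ r := fun e => hr (by rw [← e]; exact h1)
  have h2 := R.card_children_lt hpr
  have h3 : 0 < (univ.filter fun x => x ≠ r ∧ par x = par t).card :=
    card_pos.2 ⟨t, by simp [ht]⟩
  omega

/-- An embedding of the tree without some of its leaves extends to the whole tree, by Hall's
theorem. -/
lemma Rooting.isContained_of_leaves (R : Rooting T r par h) (hr : degIn T r univ ≠ 1)
    (hcard : Fintype.card V = Fintype.card W) {m D : ℕ} {V₁ : Finset V} (hJoin : Joined G m V₁)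
    (hm : 1 ≤ m) (hD : ∀ t, degIn T t univ ≤ D) {C S : Finset W} (hC : (leafSet T)ᶜ ⊆ C) {φ : W → V}
    (hφ : Set.InjOn φ C) (hadj : ∀ t ∈ C, t ≠ r → G.Adj (φ (par t)) (φ t)) (hrS : r ∈ S)
    {O : Finset V} (hO : C.image φ ⊆ O)
    (hExt : Extendable G (2 * m) O fun v =>
      D - ((leafSet T)ᶜ.filter fun x => x ∉ S ∧ φ (par x) = v).card)
    (hmany : ∀ w, w ∉ C.image φ → m ≤ (Cᶜ.filter fun l => G.Adj w (φ (par l))).card)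
    (x : V) (hV₁ : ∀ l, l ∉ C → φ (par l) = x ∨ φ (par l) ∈ V₁) : T.IsContained G := by
  have hrC : r ∈ C := hC (by simp [leafSet, hr])
  have hCr : ∀ l, l ∉ C → l ≠ r := fun l hl e => hl (e ▸ hrC)
  have hCl : ∀ l, l ∉ C → l ∈ leafSet T := fun l hl => by
    by_contra hcon
    exact hl (hC (mem_compl.2 hcon))
  have hparC : ∀ t, t ≠ r → par t ∈ C := fun t ht => hC (mem_compl.2 (R.par_notMem_leafSet hr ht))
  set F := (C.image φ)ᶜ with hF
  have hFc : F.card = Cᶜ.card := by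
    rw [hF, card_compl, card_compl, card_image_of_injOn hφ, hcard]
  -- The residual demand at an image subtracts from D only non-leaf children outside S. It therefore
  -- still covers the leaf children outside C.
  have hdem : ∀ U : Finset V, U.card ≤ 2 * m →
      (Cᶜ.filter fun l => φ (par l) ∈ U).card ≤ (nbrs G U ∩ F).card := by
    intro U hU
    have h1 := hExt U hU
    have h2 : nbrs G U \ O ⊆ nbrs G U ∩ F := by
      intro v
      simp only [mem_sdiff, mem_inter, hF, mem_compl]
      exact fun h => ⟨h.1, fun h' => h.2 (hO h')⟩
    refine le_trans ?_ (h1.trans (card_le_card h2))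
    rw [card_eq_sum_card_fiberwise (f := fun l => φ (par l)) (t := U)
      (fun l hl => by simpa using (mem_filter.1 hl).2)]
    apply sum_le_sum
    intro u _
    by_cases hex : ∃ p ∈ C, φ p = u
    swap
    · rw [card_eq_zero.2]
      · exact Nat.zero_le _
      · rw [filter_eq_empty_iff]
        intro l hl he
        exact hex ⟨par l, hparC l (hCr l (mem_compl.1 (mem_filter.1 hl).1)), he⟩
    obtain ⟨p, hp, rfl⟩ := hex
    apply Nat.le_sub_of_add_le
    rw [← card_union_of_disjoint]
    · refine le_trans (card_le_card ?_) ((R.card_children_le p).trans (hD p))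
      intro l
      simp only [mem_union, mem_filter, mem_compl, mem_univ, true_and]
      rintro (h | h)
      · exact ⟨hCr l h.1.1, hφ (hparC l (hCr l h.1.1)) hp h.2⟩
      · have hlr : l ≠ r := fun e => h.2.1 (e ▸ hrS)
        exact ⟨hlr, hφ (hparC l hlr) hp h.2.2⟩
    · rw [disjoint_left]
      intro l hl hl'
      simp only [mem_filter, mem_compl] at hl hl'
      exact hl'.1 (hCl l hl.1.1)
  obtain ⟨f, hf, hf'⟩ := (Finset.all_card_le_biUnion_card_iff_exists_injective
    (fun l : {l : W // l ∉ C} => F.filter fun v => G.Adj (φ (par l)) v)).1 (by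
    intro X
    set Y : Finset W := X.image Subtype.val with hY
    have hYc : Y.card = X.card := card_image_of_injective _ Subtype.val_injective
    have hYC : Y ⊆ Cᶜ := by
      intro l hl
      obtain ⟨l, _, rfl⟩ := mem_image.1 hl
      exact mem_compl.2 l.2
    set U : Finset V := Y.image fun l => φ (par l) with hU
    have hun : (X.biUnion fun l => F.filter fun v => G.Adj (φ (par l)) v) = nbrs G U ∩ F := by
      ext v
      simp only [mem_biUnion, mem_filter, mem_inter, mem_nbrs, hU, hY, mem_image]
      constructor
      · rintro ⟨l, hl, hv, hadj⟩
        exact ⟨⟨_, ⟨l, ⟨l, hl, rfl⟩, rfl⟩, hadj⟩, hv⟩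
      · rintro ⟨⟨_, ⟨_, ⟨l, hl, rfl⟩, rfl⟩, hadj⟩, hv⟩
        exact ⟨l, hl, hv, hadj⟩
    rw [hun, ← hYc]
    by_cases hUc : U.card ≤ 2 * m
    · refine le_trans (card_le_card ?_) (hdem U hUc)
      intro l hl
      exact mem_filter.2 ⟨hYC hl, mem_image_of_mem _ hl⟩
    by_contra hlt
    have hYF := card_le_card hYC
    -- If Hall's condition fails, some unused w is missed by U. The parents of at least m leaves are
    -- adjacent to w, so these leaves are not in Y and |Y| ≤ |F| − m.
    obtain ⟨w, hwF, hwU⟩ : ∃ w ∈ F, w ∉ nbrs G U := by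
      by_contra hcon
      push Not at hcon
      rw [inter_eq_right.2 hcon] at hlt
      omega
    have h1 := hmany w (mem_compl.1 hwF)
    have h2 : Disjoint Y (Cᶜ.filter fun l => G.Adj w (φ (par l))) := by
      rw [disjoint_left]
      intro l hl hl'
      exact hwU (mem_nbrs.2 ⟨_, mem_image_of_mem _ hl, (mem_filter.1 hl').2.symm⟩)
    have h3 := card_le_card (union_subset hYC (filter_subset (fun l => G.Adj w (φ (par l))) Cᶜ))
    rw [card_union_of_disjoint h2] at h3
    -- U has more than 2m members, all in V₁ except possibly x, so m of them remain after erasing x.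
    -- Then U misses fewer than m vertices of F, which contradicts the bound on Y.
    have h4 : (F \ nbrs G U).card < m := by
      by_contra hge
      obtain ⟨B, hB, hBc⟩ := exists_subset_card_eq (not_lt.1 hge)
      have h5 := pred_card_le_card_erase (s := U) (a := x)
      obtain ⟨A, hA, hAc⟩ := exists_subset_card_eq (show m ≤ (U.erase x).card by omega)
      have hAU : ∀ a ∈ A, a ∈ U := fun a ha => mem_of_mem_erase (hA ha)
      obtain ⟨a, ha, b, hb, hab⟩ := hJoin A B (by
          intro a ha
          obtain ⟨l, hl, he⟩ := mem_image.1 (hAU a ha)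
          have := hV₁ l (mem_compl.1 (hYC hl))
          rw [he] at this
          exact this.resolve_left (mem_erase.1 (hA ha)).1)
        (by
          rw [disjoint_left]
          intro a ha hb
          obtain ⟨l, hl, rfl⟩ := mem_image.1 (hAU a ha)
          have := (mem_sdiff.1 (hB hb)).1
          rw [hF, mem_compl] at this
          exact this (mem_image_of_mem _ (hparC l (hCr l (mem_compl.1 (hYC hl)))))) hAc hBc
      exact (mem_sdiff.1 (hB hb)).2 (mem_nbrs.2 ⟨a, hAU a ha, hab⟩)
    have h5 := card_sdiff_add_card_inter F (nbrs G U)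
    rw [inter_comm] at h5
    omega)
  have hf' : ∀ l, f l ∉ C.image φ ∧ G.Adj (φ (par l)) (f l) := fun l => by
    have := hf' l
    rw [mem_filter, hF, mem_compl] at this
    exact this
  refine R.isContained (ψ := fun w => if hw : w ∈ C then φ w else f ⟨w, hw⟩) ?_ ?_
  · intro w w' he
    simp only at he
    split_ifs at he with h1 h2 h2
    · exact hφ h1 h2 he
    · exact absurd (he ▸ mem_image_of_mem φ h1) (hf' _).1
    · exact absurd (he ▸ mem_image_of_mem φ h2) (hf' _).1
    · have := hf he
      simpa using this
  · intro t ht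
    simp only [dif_pos (hparC t ht)]
    split_ifs with h1
    · exact hadj t h1 ht
    · exact (hf' ⟨t, h1⟩).2

end ManyLeaves
end TreeUniversality

/-! ### Trees with many leaves: the suitable star -/

namespace TreeUniversality

open Finset
open scoped Classical

section ManyLeaves

variable {V W : Type*}

lemma card_sdiff_union_of_disjoint {V₁ V₂ X : Finset V} (hdisj : Disjoint V₁ V₂) :
    V₁.card ≤ (V₁ \ (V₂ ∪ X)).card + X.card := by
  have h2 : V₁ \ X ⊆ V₁ \ (V₂ ∪ X) := by
    intro x
    simp only [mem_sdiff, mem_union, not_or]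
    exact fun h => ⟨h.1, disjoint_left.1 hdisj h.1, h.2⟩
  have h3 := card_le_card h2
  have h4 := le_card_sdiff X V₁
  omega

variable [Fintype V] [Fintype W] {G : SimpleGraph V} {T : SimpleGraph W} {r : W}
  {par : W → W} {h : W → ℕ}

lemma extendable_of_degree {m D d : ℕ} {V₁ V₂ X : Finset V} (hdisj : Disjoint V₁ V₂)
    (hd : ∀ v, d ≤ degIn G v V₁) (hX : D * (2 * m) + X.card ≤ d) :
    Extendable G (2 * m) (V₂ ∪ X) fun _ => D := by
  apply extendable_const_of_degree
  intro v
  have h1 := hd v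
  rw [nbrs_singleton_inter] at h1
  have h2 : (nbrs G {v} ∩ V₁) \ X ⊆ nbrs G {v} \ (V₂ ∪ X) := by
    intro x
    simp only [mem_inter, mem_sdiff, mem_union, not_or]
    exact fun h => ⟨h.1.1, disjoint_left.1 hdisj h.1.2, h.2⟩
  have h3 := card_le_card h2
  have h4 := le_card_sdiff X (nbrs G {v} ∩ V₁)
  omega

/-- The children of `q` that have a leaf as a child. -/
noncomputable def leafParentChildren (T : SimpleGraph W) (r : W) (par : W → W) (q : W) : Finset W :=
  univ.filter fun p => p ≠ r ∧ par p = q ∧ ∃ l ∈ leafSet T, l ≠ r ∧ par l = p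

/-- Trees with many leaves in which the root has many children with leaf children. -/
lemma isContained_of_star (R : Rooting T r par h) (hr : degIn T r univ ≠ 1)
    (hcard : Fintype.card V = Fintype.card W) {m D d : ℕ} {V₁ V₂ : Finset V}
    (hJoin : Joined G m V₁) (hm : 1 ≤ m) (hdisj : Disjoint V₁ V₂) (hcov : ∀ v, v ∈ V₁ ∨ v ∈ V₂)
    (hD : ∀ t, degIn T t univ ≤ D) (hd : ∀ v, d ≤ degIn G v V₁) {n : ℕ} {C₀ : ℝ} {x : V}
    {S Rx : Finset V} (hstar : IsSuitableStar G n C₀ V₁ x S Rx)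
    (hS : ∀ w, w ∉ Rx → w ∉ S → m + 25 ≤ degIn G w S)
    (hdD : D * (2 * m) + (S.card + 26) ≤ d)
    (hroom : D * (2 * m) + 2 * m + (leafSet T)ᶜ.card + (S.card + 26) < V₁.card)
    (hPC : S.card + 25 ≤ (leafParentChildren T r par r).card) : T.IsContained G := by
  set C := (leafSet T)ᶜ with hC
  have hrC : r ∈ C := by simp [hC, leafSet, hr]
  have hparC : ∀ t, t ≠ r → par t ∈ C := fun t ht => mem_compl.2 (R.par_notMem_leafSet hr ht)
  set R1 := Rx.filter fun v => G.Adj x v with hR1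
  -- The centre x is not adjacent to itself but is used by the root, so it must not be treated as an
  -- exceptional vertex awaiting a leaf.
  set R2 := (Rx.erase x).filter fun v => ¬ G.Adj v x with hR2
  have hRc := hstar.card_R
  have hSRc : (S ∪ R1).card ≤ (leafParentChildren T r par r).card := by
    have h1 := card_union_le S R1
    have h2 : R1.card ≤ Rx.card := card_filter_le _ _
    omega
  obtain ⟨e⟩ : Nonempty ((S ∪ R1 : Finset V) ↪ leafParentChildren T r par r) :=
    Function.Embedding.nonempty_of_card_le (by
      rw [Fintype.card_coe, Fintype.card_coe]; exact hSRc)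
  have he : ∀ s, (e s : W) ≠ r ∧ par (e s) = r ∧ ∃ l ∈ leafSet T, l ≠ r ∧ par l = e s := by
    intro s
    have := (e s).2
    simpa only [leafParentChildren, mem_filter, mem_univ, true_and] using this
  choose her hepar lf hlf hlfr hlfp using he
  have heinj : ∀ s s', (e s : W) = e s' → s = s' := fun s s' h => e.injective (Subtype.ext h)
  have hadjx : ∀ s : (S ∪ R1 : Finset V), G.Adj x s := by
    rintro ⟨s, hs⟩
    rcases mem_union.1 hs with h | h
    · exact hstar.S_adj s h
    · exact (mem_filter.1 h).2
  have hVs : ∀ s : (S ∪ R1 : Finset V), (s : V) ∈ V₁ := by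
    rintro ⟨s, hs⟩
    rcases mem_union.1 hs with h | h
    · exact hstar.S_subset h
    · exact hstar.R_subset (mem_filter.1 h).1
  -- the vertices embedded in advance
  set Sp : Finset W := insert r (univ.image fun s => (e s : W)) with hSp
  obtain ⟨φ₀, hφ₀r, hφ₀e⟩ : ∃ φ₀ : W → V, φ₀ r = x ∧ ∀ s, φ₀ (e s) = s := by
    refine ⟨fun t => if ht : ∃ s, (e s : W) = t then ht.choose else x, ?_, ?_⟩
    · exact dif_neg fun ⟨s, hs⟩ => her s hs
    · intro s
      have hex : ∃ s', (e s' : W) = e s := ⟨s, rfl⟩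
      simp only [dif_pos hex]
      rw [heinj _ _ hex.choose_spec]
  have hSpcases : ∀ t ∈ Sp, t = r ∨ ∃ s, (e s : W) = t := by
    intro t ht
    rcases mem_insert.1 ht with h | h
    · exact Or.inl h
    · obtain ⟨s, _, h⟩ := mem_image.1 h; exact Or.inr ⟨s, h⟩
  have hφ₀inj : ∀ t ∈ Sp, ∀ t' ∈ Sp, φ₀ t = φ₀ t' → t = t' := by
    intro t ht t' ht' heq
    rcases hSpcases t ht with rfl | ⟨s, rfl⟩ <;> rcases hSpcases t' ht' with rfl | ⟨s', rfl⟩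
    · rfl
    · rw [hφ₀r, hφ₀e] at heq
      exact absurd (hadjx s') (by rw [← heq]; exact G.loopless.irrefl _)
    · rw [hφ₀r, hφ₀e] at heq
      exact absurd (hadjx s) (by rw [heq]; exact G.loopless.irrefl _)
    · rw [hφ₀e, hφ₀e] at heq
      rw [Subtype.ext heq]
  set X := insert x (S ∪ Rx) with hX
  have hXc : X.card ≤ S.card + 26 := by
    have h1 : X.card ≤ (S ∪ Rx).card + 1 := card_insert_le _ _
    have h2 := card_union_le S Rx
    omega
  have hφ₀X : ∀ t ∈ Sp, φ₀ t ∈ X := by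
    intro t ht
    rcases hSpcases t ht with rfl | ⟨⟨s, hs⟩, rfl⟩
    · rw [hφ₀r]; exact mem_insert_self _ _
    · rw [hφ₀e]
      apply mem_insert_of_mem
      rcases mem_union.1 hs with h | h
      · exact mem_union_left _ h
      · exact mem_union_right _ (mem_filter.1 h).1
  have hSpC : ∀ t ∈ Sp, t ∈ C := by
    intro t ht
    rcases hSpcases t ht with rfl | ⟨s, rfl⟩
    · exact hrC
    · rw [← hlfp s]; exact hparC _ (hlfr s)
  have hdeg' : ∀ t, (C.filter fun x => x ∉ Sp ∧ par x = t).card ≤ D := by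
    intro t
    refine le_trans (card_le_card ?_) ((R.card_children_le t).trans (hD t))
    intro y
    simp only [mem_filter, mem_univ, true_and]
    exact fun h => ⟨fun e => h.2.1 (e ▸ mem_insert_self _ _), h.2.2⟩
  have hV₁X := card_sdiff_union_of_disjoint (X := X) hdisj
  obtain ⟨φ, h1, h2, h3, -, h5, h6, h7⟩ := exists_embedding hJoin hm
    (extendable_of_degree hdisj hd (X := X) (D := D) (by omega)) par h r C Sp hrC
    (mem_insert_self _ _) (fun t ht htr => ⟨hparC t htr, by have := R.height t htr; omega⟩)
    (fun t _ => hdeg' t) (by omega) (fun s φ => ∀ t ∈ s, t ∈ Sp → φ t = φ₀ t) x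
    (mem_union_right _ (mem_insert_self _ _))
    (by
      intro t ht _
      rw [mem_singleton.1 ht, hφ₀r])
    (by
      intro s φ t y _ _ htSp hts _ _ hInv t' ht' ht'Sp
      rcases mem_insert.1 ht' with rfl | ht'
      · exact absurd ht'Sp htSp
      · rw [Function.update_of_ne (fun e => hts (by rw [← e]; exact ht'))]
        exact hInv t' ht' ht'Sp)
    (by
      intro s φ t hrs _ _ htSp hts hpt _ hInv
      refine ⟨φ₀ t, mem_union_right _ (hφ₀X t htSp), ?_, ?_, ?_⟩
      · intro y hy hySp heq
        rw [hInv y hy hySp] at heq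
        exact hts (hφ₀inj y hySp t htSp heq ▸ hy)
      · rcases hSpcases t htSp with rfl | ⟨s', rfl⟩
        · exact absurd hrs hts
        · rw [hepar, hInv r hrs (mem_insert_self _ _), hφ₀r, hφ₀e]
          exact hadjx s'
      · intro y hy hySp
        rcases mem_insert.1 hy with rfl | hy
        · rw [Function.update_self]
        · rw [Function.update_of_ne (fun e => hts (by rw [← e]; exact hy))]
          exact hInv y hy hySp)
  have hφe : ∀ s, φ (e s) = s := fun s => by
    have hs : (e s : W) ∈ Sp := mem_insert_of_mem (mem_image_of_mem _ (mem_univ s))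
    rw [h5 _ (hSpC _ hs) hs, hφ₀e]
  -- the leaves embedded in advance
  obtain ⟨rep, hrep, hrepinj⟩ := hstar.exists_rep
  have hR2rep : ∀ v ∈ R2, rep v ∈ S ∧ G.Adj v (rep v) := fun v hv => by
    rw [hR2, mem_filter, mem_erase] at hv
    exact hrep v hv.1.2 hv.2
  -- An exceptional non-neighbour v of x receives the designated leaf below its representative in S.
  -- Distinct representatives give distinct leaves; elsewhere the value r is a dummy.
  obtain ⟨lv, hlv⟩ : ∃ lv : V → W, ∀ v (hv : v ∈ R2),
      lv v = lf ⟨rep v, mem_union_left _ (hR2rep v hv).1⟩ := by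
    refine ⟨fun v => if hv : v ∈ R2 then lf ⟨rep v, mem_union_left _ (hR2rep v hv).1⟩ else r, ?_⟩
    intro v hv
    simp only [dif_pos hv]
  have hlvpar : ∀ v ∈ R2, ∀ s, par (lv v) = e s → (s : V) = rep v := by
    intro v hv s hs
    rw [hlv v hv, hlfp] at hs
    rw [← heinj _ _ hs]
  have hlvC : ∀ v ∈ R2, lv v ∉ C := fun v hv => by
    rw [hlv v hv, hC, mem_compl, not_not]; exact hlf _
  have hlvinj : Set.InjOn lv R2 := by
    intro v hv v' hv' heq
    by_contra hne
    have h1 : rep v = rep v' := by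
      apply hlvpar v' hv' ⟨rep v, mem_union_left _ (hR2rep v hv).1⟩
      rw [← heq, hlv v hv, hlfp]
    rw [hR2, mem_coe, mem_filter, mem_erase] at hv hv'
    exact hrepinj v hv.1.2 v' hv'.1.2 hv.2 hv'.2 hne h1
  have hR2φ : ∀ v ∈ R2, ∀ t ∈ C, φ t ≠ v := by
    intro v hv t ht heq
    rw [hR2, mem_filter, mem_erase] at hv
    by_cases htSp : t ∈ Sp
    · rcases hSpcases t htSp with rfl | ⟨⟨s, hs⟩, rfl⟩
      · exact hv.1.1 (heq ▸ h6)
      · rw [hφe] at heq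
        simp only at heq
        rw [heq] at hs
        rcases mem_union.1 hs with h | h
        · exact disjoint_left.1 hstar.disjoint hv.1.2 h
        · exact hv.2 (mem_filter.1 h).2.symm
    · exact h3 t ht htSp (heq ▸ mem_union_right _ (mem_insert_of_mem (mem_union_right _ hv.1.2)))
  set ψ : W → V := fun w => if w ∈ C then φ w else
    if hw : ∃ v ∈ R2, lv v = w then hw.choose else x with hψ
  have hψC : ∀ w ∈ C, ψ w = φ w := fun w hw => by simp [hψ, hw]
  have hψl : ∀ v ∈ R2, ψ (lv v) = v := by
    intro v hv
    have hex : ∃ v' ∈ R2, lv v' = lv v := ⟨v, hv, rfl⟩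
    simp only [hψ, if_neg (hlvC v hv), dif_pos hex]
    exact hlvinj hex.choose_spec.1 hv hex.choose_spec.2
  have hψpar : ∀ t, t ≠ r → ψ (par t) = φ (par t) := fun t ht => hψC _ (hparC t ht)
  set C' := C ∪ R2.image lv with hC'
  have hC'r : ∀ l, l ∉ C' → l ≠ r := fun l hl e => hl (mem_union_left _ (e ▸ hrC))
  have himg : C'.image ψ = C.image φ ∪ R2 := by
    rw [hC', image_union, image_congr (g := φ) (fun w hw => hψC w hw), image_image]
    congr 1
    ext v
    simp only [mem_image, Function.comp]
    constructor
    · rintro ⟨v', hv', rfl⟩; rw [hψl v' hv']; exact hv'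
    · intro hv; exact ⟨v, hv, hψl v hv⟩
  refine R.isContained_of_leaves hr hcard hJoin hm hD (C := C') (S := Sp) (φ := ψ)
    subset_union_left ?_ ?_ (mem_insert_self _ _) (O := V₂ ∪ X ∪ C.image φ) ?_ ?_ ?_ x ?_
  · intro w hw w' hw' heq
    rw [hC', mem_coe, mem_union] at hw hw'
    rcases hw with hw | hw <;> rcases hw' with hw' | hw'
    · rw [hψC w hw, hψC w' hw'] at heq; exact h1 hw hw' heq
    · obtain ⟨v, hv, rfl⟩ := mem_image.1 hw'
      rw [hψC w hw, hψl v hv] at heq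
      exact absurd heq (hR2φ v hv w hw)
    · obtain ⟨v, hv, rfl⟩ := mem_image.1 hw
      rw [hψC w' hw', hψl v hv] at heq
      exact absurd heq.symm (hR2φ v hv w' hw')
    · obtain ⟨v, hv, rfl⟩ := mem_image.1 hw
      obtain ⟨v', hv', rfl⟩ := mem_image.1 hw'
      rw [hψl v hv, hψl v' hv'] at heq
      rw [heq]
  · intro t ht htr
    rw [hψpar t htr]
    rcases mem_union.1 ht with ht | ht
    · rw [hψC t ht]; exact h2 t ht htr
    · obtain ⟨v, hv, rfl⟩ := mem_image.1 ht
      rw [hψl v hv, hlv v hv, hlfp, hφe]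
      exact (hR2rep v hv).2.symm
  · rw [himg]
    apply union_subset subset_union_right
    intro v hv
    rw [hR2, mem_filter, mem_erase] at hv
    exact mem_union_left _ (mem_union_right _ (mem_insert_of_mem (mem_union_right _ hv.1.2)))
  · refine h7.mono fun v => le_of_eq ?_
    congr 2
    apply filter_congr
    intro y _
    constructor
    · rintro ⟨hy, he⟩
      exact ⟨hy, by rwa [hψpar y (fun e => hy (e ▸ mem_insert_self _ _))] at he⟩
    · rintro ⟨hy, he⟩
      exact ⟨hy, by rwa [hψpar y (fun e => hy (e ▸ mem_insert_self _ _))]⟩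
  · intro w hw
    rw [himg, mem_union, not_or] at hw
    have hwx : w ≠ x := fun e => hw.1 (mem_image.2 ⟨r, hrC, by rw [h6, e]⟩)
    have hSR1 : ∀ s ∈ S ∪ R1, s ∈ C.image φ := by
      intro s hs
      rw [mem_image]
      refine ⟨e ⟨s, hs⟩, ?_, hφe _⟩
      rw [← hlfp]; exact hparC _ (hlfr _)
    have hwS : w ∉ S := fun hh => hw.1 (hSR1 w (mem_union_left _ hh))
    have hwR : w ∉ Rx := by
      intro hh
      by_cases hadj : G.Adj x w
      · exact hw.1 (hSR1 w (mem_union_right _ (mem_filter.2 ⟨hh, hadj⟩)))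
      · exact hw.2 (mem_filter.2 ⟨mem_erase.2 ⟨hwx, hh⟩, fun h' => hadj h'.symm⟩)
    have h8 := hS w hwR hwS
    -- At most 25 representatives have had their designated leaf placed, so at least m of the m + 25
    -- neighbours of w in S still offer an unplaced leaf.
    set N := (S.filter fun u => G.Adj w u) \ R2.image rep with hN
    have hNc : m ≤ N.card := by
      have h9 : (S.filter fun u => G.Adj w u).card - (R2.image rep).card ≤ N.card :=
        le_card_sdiff _ _
      have h10 : (R2.image rep).card ≤ 25 :=
        card_image_le.trans ((card_filter_le _ _).trans ((card_erase_le).trans hRc))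
      unfold degIn at h8
      omega
    refine hNc.trans ?_
    have hNS : ∀ u ∈ N, u ∈ S ∪ R1 := fun u hu =>
      mem_union_left _ (mem_filter.1 (mem_sdiff.1 hu).1).1
    apply card_le_card_of_injOn (fun u => if hu : u ∈ S ∪ R1 then lf ⟨u, hu⟩ else r)
    · intro u hu
      simp only [dif_pos (hNS u hu)]
      rw [mem_coe, mem_filter, mem_compl, hlfp, hψC _ (by rw [← hlfp]; exact hparC _ (hlfr _)), hφe]
      refine ⟨?_, (mem_filter.1 (mem_sdiff.1 hu).1).2⟩
      rw [hC', mem_union, not_or]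
      refine ⟨fun hh => mem_compl.1 hh (hlf _), fun hh => ?_⟩
      obtain ⟨v, hv, hvl⟩ := mem_image.1 hh
      have := hlvpar v hv ⟨u, hNS u hu⟩ (by rw [hvl, hlfp])
      exact (mem_sdiff.1 hu).2 (mem_image.2 ⟨v, hv, this.symm⟩)
    · intro u hu u' hu' heq
      simp only [dif_pos (hNS u hu), dif_pos (hNS u' hu')] at heq
      have h11 := congrArg par heq
      rw [hlfp, hlfp] at h11
      simpa using heinj _ _ h11
  · intro l hl
    rw [hψpar l (hC'r l hl)]
    have hpC := hparC l (hC'r l hl)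
    by_cases hSp' : par l ∈ Sp
    · rcases hSpcases _ hSp' with h | ⟨s, h⟩
      · left; rw [h, h6]
      · right; rw [← h, hφe]; exact hVs s
    · right
      have := h3 _ hpC hSp'
      rw [mem_union, not_or] at this
      exact (hcov _).resolve_right this.1

end ManyLeaves
end TreeUniversality

/-! ### Derandomised greedy choices and reservoirs -/

namespace TreeUniversality

open Finset
open scoped Classical

section Greedy

/-- If every good `j` is hit by a proportion at least `δ` of the points of `X`, then some point of
`X` does not increase the total weight, where hits halve a weight and good weights are scaled
up. -/
lemma exists_sum_weight_le {ι V : Type*} (J : Finset ι) (X : Finset V) (hX : X.Nonempty)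
    (w : ι → ℝ) (hw : ∀ j, 0 ≤ w j) (H : V → ι → Prop) (good : ι → Prop) {δ : ℝ}
    (hδ : δ ≤ 1)
    (hgood : ∀ j ∈ J, good j → δ * X.card ≤ (X.filter fun x => H x j).card) :
    ∃ x ∈ X, ∑ j ∈ J, w j * ((if H x j then 1 / 2 else 1) * if good j then (1 - δ / 2)⁻¹ else 1) ≤
      ∑ j ∈ J, w j := by
  -- Averaging over X: a good weight is multiplied on average by at most 1 − δ/2 before scaling,
  -- which the factor (1 − δ/2)⁻¹ cancels.
  apply exists_le_of_sum_le hX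
  rw [sum_comm, sum_const, nsmul_eq_mul, mul_sum]
  apply sum_le_sum
  intro j hj
  rw [← mul_sum, ← sum_mul, mul_comm (X.card : ℝ)]
  refine mul_le_mul_of_nonneg_left ?_ (hw j)
  have h1 : ∑ x ∈ X, (if H x j then (1 / 2 : ℝ) else 1) =
      X.card - (X.filter fun x => H x j).card / 2 := by
    have h2 : ∀ x ∈ X, (if H x j then (1 / 2 : ℝ) else 1) = 1 - (if H x j then 1 else 0) / 2 := by
      intro x _
      split_ifs <;> norm_num
    rw [sum_congr rfl h2, sum_sub_distrib, ← sum_div, sum_boole]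
    simp
  rw [h1]
  have h3 : (0 : ℝ) ≤ (X.filter fun x => H x j).card := Nat.cast_nonneg _
  split_ifs with hg
  · have := hgood j hj hg
    rw [mul_inv_le_iff₀ (by linarith)]
    linarith
  · linarith

/-- A small set meeting each of not too many large sets in many points. -/
lemma exists_reservoir {ι V : Type*} [Fintype ι] (V₁ : Finset V) (A : ι → Finset V) {δ : ℝ}
    (hδ : δ ≤ 1) {b : ℕ} (hb : b ≤ V₁.card)
    (hAV : ∀ j, A j ⊆ V₁) (hA : ∀ j, δ * V₁.card + b ≤ (A j).card) (hδ₀ : 0 ≤ δ) :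
    ∃ B ⊆ V₁, B.card = b ∧
      ∀ j, ((1 - δ / 2)⁻¹) ^ b ≤ Fintype.card ι * (2 : ℝ) ^ (A j ∩ B).card := by
  have hρ : 0 ≤ (1 - δ / 2)⁻¹ := inv_nonneg.2 (by linarith)
  -- The potential starts at |ι| and never increases. After b steps, any single term is bounded by
  -- it, which gives the conclusion.
  suffices H : ∀ i ≤ b, ∃ B ⊆ V₁, B.card = i ∧
      ∑ j, (1 / 2 : ℝ) ^ (A j ∩ B).card * ((1 - δ / 2)⁻¹) ^ i ≤ Fintype.card ι by
    obtain ⟨B, hB, hBc, hs⟩ := H b le_rfl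
    refine ⟨B, hB, hBc, fun j => ?_⟩
    have h1 := (single_le_sum (f := fun j => (1 / 2 : ℝ) ^ (A j ∩ B).card * ((1 - δ / 2)⁻¹) ^ b)
      (fun j _ => by positivity) (mem_univ j)).trans hs
    have h2 : (0 : ℝ) < 2 ^ (A j ∩ B).card := by positivity
    calc ((1 - δ / 2)⁻¹) ^ b
        = (1 / 2 : ℝ) ^ (A j ∩ B).card * ((1 - δ / 2)⁻¹) ^ b * 2 ^ (A j ∩ B).card := by
          rw [mul_right_comm, ← mul_pow]; norm_num
      _ ≤ _ := by gcongr
  intro i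
  induction i with
  | zero => exact fun _ => ⟨∅, by simp, by simp, by simp⟩
  | succ i ih =>
    intro hi
    obtain ⟨B, hB, hBc, hs⟩ := ih (by omega)
    have hXc : (V₁ \ B).card = V₁.card - i := by rw [card_sdiff_of_subset hB, hBc]
    obtain ⟨x, hx, hxs⟩ := exists_sum_weight_le univ (V₁ \ B) (card_pos.1 (by omega))
      (fun j => (1 / 2 : ℝ) ^ (A j ∩ B).card * ((1 - δ / 2)⁻¹) ^ i) (fun j => by positivity)
      (fun x j => x ∈ A j) (fun _ => True) hδ (by
        intro j _ _
        -- The summand b in `hA` pays for the points already chosen, so the proportion δ persists at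
        -- every step.
        have h1 : A j \ B ⊆ (V₁ \ B).filter fun x => x ∈ A j := by
          intro x hx
          rw [mem_sdiff] at hx
          exact mem_filter.2 ⟨mem_sdiff.2 ⟨hAV j hx.1, hx.2⟩, hx.1⟩
        have h2 := card_le_card h1
        have h3 := le_card_sdiff B (A j)
        have h4 : ((A j).card : ℝ) ≤ ((V₁ \ B).filter fun x => x ∈ A j).card + b := by
          exact_mod_cast (by omega : (A j).card ≤ ((V₁ \ B).filter fun x => x ∈ A j).card + b)
        have h5 : ((V₁ \ B).card : ℝ) ≤ V₁.card := by exact_mod_cast card_le_card sdiff_subset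
        have h6 := mul_le_mul_of_nonneg_left h5 hδ₀
        have h7 : δ * (V₁ \ B).card ≤ ((V₁ \ B).filter fun x => x ∈ A j).card := by
          linarith [hA j]
        convert h7)
    rw [mem_sdiff] at hx
    refine ⟨insert x B, insert_subset hx.1 hB, by rw [card_insert_of_notMem hx.2, hBc],
      le_trans (le_of_eq ?_) (hxs.trans hs)⟩
    apply sum_congr rfl
    intro j _
    rw [if_pos trivial, pow_succ]
    by_cases hj : x ∈ A j
    · rw [inter_insert_of_mem hj, card_insert_of_notMem (fun h => hx.2 (mem_inter.1 h).2),
        if_pos hj, pow_succ]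
      ring
    · rw [inter_insert_of_notMem hj, if_neg hj]
      ring

end Greedy
end TreeUniversality

/-! ### Trees with many leaves: spreading the leaf parents -/

namespace TreeUniversality

open Finset
open scoped Classical

section Spread

variable {V W : Type*}

/-- The potential of `w` with respect to the partial embedding `φ` of `s`: every neighbour of `w`
among the images of `P` halves it, every member of `P` whose parent's image is not in conflict with
`w` scales it by `ρ`. -/
noncomputable def spreadWeight (G : SimpleGraph V) (Bad : V → V → Prop) (P : Finset W)
    (par : W → W) (ρ : ℝ) (s : Finset W) (φ : W → V) (w : V) : ℝ :=
  (1 / 2) ^ (s.filter fun p => p ∈ P ∧ G.Adj w (φ p)).card *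
    ρ ^ (s.filter fun p => p ∈ P ∧ ¬ Bad w (φ (par p))).card

variable {G : SimpleGraph V} {Bad : V → V → Prop} {P : Finset W} {par : W → W} {ρ : ℝ}
  {s : Finset W} {φ : W → V} {t : W} {y w : V}

/-- The weight reads only images of members of P and of their parents, all of which lie in s
already. -/
lemma spreadWeight_insert_of_notMem (htP : t ∉ P) (hts : t ∉ s) (hs : ∀ p ∈ s, p ∈ P → par p ∈ s) :
    spreadWeight G Bad P par ρ (insert t s) (Function.update φ t y) w =
      spreadWeight G Bad P par ρ s φ w := by
  unfold spreadWeight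
  rw [filter_insert, if_neg (by tauto), filter_insert, if_neg (by tauto)]
  congr 3
  · apply filter_congr
    intro p hp
    rw [Function.update_of_ne (ne_of_mem_of_not_mem hp hts)]
  · apply filter_congr
    intro p hp
    refine and_congr_right fun hpP => ?_
    rw [Function.update_of_ne (ne_of_mem_of_not_mem (hs p hp hpP) hts)]

lemma spreadWeight_insert_of_mem (htP : t ∈ P) (hts : t ∉ s) (hpt : par t ∈ s)
    (hs : ∀ p ∈ s, p ∈ P → par p ∈ s) :
    spreadWeight G Bad P par ρ (insert t s) (Function.update φ t y) w =
      spreadWeight G Bad P par ρ s φ w *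
        ((if G.Adj w y then 1 / 2 else 1) * if ¬ Bad w (φ (par t)) then ρ else 1) := by
  have h1 : (s.filter fun p => p ∈ P ∧ G.Adj w (Function.update φ t y p)) =
      s.filter fun p => p ∈ P ∧ G.Adj w (φ p) := by
    apply filter_congr
    intro p hp
    rw [Function.update_of_ne (ne_of_mem_of_not_mem hp hts)]
  have h2 : (s.filter fun p => p ∈ P ∧ ¬ Bad w (Function.update φ t y (par p))) =
      s.filter fun p => p ∈ P ∧ ¬ Bad w (φ (par p)) := by
    apply filter_congr
    intro p hp
    refine and_congr_right fun hpP => ?_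
    rw [Function.update_of_ne (ne_of_mem_of_not_mem (hs p hp hpP) hts)]
  have h3 : Function.update φ t y (par t) = φ (par t) :=
    Function.update_of_ne (ne_of_mem_of_not_mem hpt hts) _ _
  unfold spreadWeight
  rw [filter_insert, filter_insert, h1, h2, h3, Function.update_self]
  simp only [htP, true_and]
  have h4 : t ∉ s.filter fun p => p ∈ P ∧ G.Adj w (φ p) := fun h => hts (mem_filter.1 h).1
  have h5 : t ∉ s.filter fun p => p ∈ P ∧ ¬ Bad w (φ (par p)) := fun h => hts (mem_filter.1 h).1
  split_ifs <;> (try simp only [card_insert_of_notMem h4, card_insert_of_notMem h5, pow_succ]) <;>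
    ring

variable [Fintype V] [Fintype W] {T : SimpleGraph W} {r : W} {h : W → ℕ}

/-- Trees with many leaves in which the parents of the leaves are spread over many vertices. -/
lemma isContained_of_spread (R : Rooting T r par h) (hr : degIn T r univ ≠ 1)
    (hcard : Fintype.card V = Fintype.card W) {m D d : ℕ} {V₁ V₂ B : Finset V}
    (hJoin : Joined G m V₁) (hm : 1 ≤ m) (hdisj : Disjoint V₁ V₂) (hcov : ∀ v, v ∈ V₁ ∨ v ∈ V₂)
    (hD : ∀ t, degIn T t univ ≤ D) (hd : ∀ v, d ≤ degIn G v V₁)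
    (hdD : D * (2 * m) + B.card ≤ d)
    (hroom : D * (2 * m) + 2 * m + (leafSet T)ᶜ.card + B.card < V₁.card)
    {L K k b : ℕ} (hsymm : ∀ v w, Bad v w → Bad w v)
    (hBad : ∀ v, (univ.filter fun w => Bad v w).card ≤ L) (hL : L < Fintype.card V)
    (hBV : B ⊆ V₁)
    (hB : ∀ v w, ¬ Bad v w → b ≤ (B.filter fun u => G.Adj v u ∧ G.Adj w u).card)
    (hP : ∀ p ∈ P, p ≠ r ∧ ∃ l ∈ leafSet T, l ≠ r ∧ par l = p)
    (hPc : P.card = k) (hK : ∀ q, (P.filter fun p => par p = q).card ≤ K)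
    (hb : 2 * (2 * k + 1 + k * (L * L)) ≤ b) {δ : ℝ} (hδ : δ ≤ 1) (hδ₀ : 0 ≤ δ)
    (hδB : 2 * (δ * B.card) ≤ b)
    (hfin : (Fintype.card V : ℝ) * 2 ^ m < ((1 - δ / 2)⁻¹) ^ (k - K)) : T.IsContained G := by
  set C := (leafSet T)ᶜ with hC
  have hrC : r ∈ C := by simp [hC, leafSet, hr]
  have hparC : ∀ t, t ≠ r → par t ∈ C := fun t ht => mem_compl.2 (R.par_notMem_leafSet hr ht)
  set ρ := (1 - δ / 2)⁻¹ with hρ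
  have hρ1 : 1 ≤ ρ := by
    rw [hρ]
    exact (one_le_inv₀ (by linarith)).2 (by linarith)
  set Q := P.image par with hQ
  -- The selected leaf parents P, their parents Q and the root are confined to B: choosing images
  -- for P controls the hits, and choosing images for Q controls the conflicts.
  set S := insert r (P ∪ Q) with hS
  have hPC : P ⊆ C := by
    intro p hp
    obtain ⟨_, l, _, hlr, rfl⟩ := hP p hp
    exact hparC l hlr
  have hPS : P ⊆ S := fun p hp => mem_insert_of_mem (mem_union_left _ hp)
  have hQS : Q ⊆ S := fun p hp => mem_insert_of_mem (mem_union_right _ hp)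
  have hQc : Q.card ≤ k := hPc ▸ card_image_le
  have hSc : S.card ≤ 2 * k + 1 := by
    have h1 : S.card ≤ (P ∪ Q).card + 1 := card_insert_le _ _
    have h2 := card_union_le P Q
    omega
  have hBv : ∀ v, b ≤ (B.filter fun u => G.Adj v u).card := by
    intro v
    obtain ⟨w, hw⟩ : ∃ w, ¬ Bad v w := by
      by_contra hcon
      push Not at hcon
      have := hBad v
      rw [filter_true_of_mem fun w _ => hcon w, card_univ] at this
      omega
    refine (hB v w hw).trans (card_le_card fun u hu => ?_)
    exact mem_filter.2 ⟨(mem_filter.1 hu).1, (mem_filter.1 hu).2.1⟩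
  obtain ⟨v₀, hv₀⟩ : B.Nonempty := by
    rw [← card_pos]
    have hV : 0 < Fintype.card V := by omega
    obtain ⟨v⟩ := Fintype.card_pos_iff.1 hV
    have h1 := (hBv v).trans (card_filter_le _ _)
    omega
  obtain ⟨φ, hφinj, hφadj, hφO, -, ⟨-, hφB, hφQ, hφw⟩, hφr, hφext⟩ :=
    exists_embedding hJoin hm (extendable_of_degree hdisj hd hdD) par h r C S hrC
      (mem_insert_self _ _) (fun t _ ht => ⟨hparC t ht, by have := R.height t ht; omega⟩)
      (by
        intro t _
        refine le_trans (card_le_card ?_) ((R.card_children_le t).trans (hD t))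
        intro x hx
        simp only [mem_filter, mem_univ, true_and] at hx ⊢
        exact ⟨fun e => hx.2.1 (e ▸ mem_insert_self _ _), hx.2.2⟩)
      (by
        have := card_sdiff_union_of_disjoint (X := B) hdisj
        omega)
      -- Invariant: the embedded set is parent-closed, S goes into B, no vertex conflicts with two
      -- images of Q, and the total potential is at most |V|.
      (fun s φ => (∀ t ∈ s, t ≠ r → par t ∈ s) ∧ (∀ t ∈ s, t ≠ r → t ∈ S → φ t ∈ B) ∧
        (∀ q ∈ s, ∀ q' ∈ s, q ∈ Q → q' ∈ Q → q ≠ q' → ∀ w, Bad (φ q) w → ¬ Bad (φ q') w) ∧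
        ∑ w, spreadWeight G Bad P par ρ s φ w ≤ Fintype.card V)
      v₀ (mem_union_right _ hv₀)
      (by
        refine ⟨by simp, by simp, ?_, ?_⟩
        · intro q hq q' hq' _ _ hne
          rw [mem_singleton.1 hq, mem_singleton.1 hq'] at hne
          exact absurd rfl hne
        · have hrP : r ∉ P := fun hh => (hP r hh).1 rfl
          simp [spreadWeight, filter_singleton, hrP])
      (by
        rintro s φ t y - - htS hts hpt - ⟨h1, h2, h3, h4⟩
        have hne : ∀ x ∈ s, x ≠ t := fun x hx => ne_of_mem_of_not_mem hx hts
        refine ⟨?_, ?_, ?_, ?_⟩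
        · intro x hx hxr
          rcases mem_insert.1 hx with rfl | hx
          · exact mem_insert_of_mem hpt
          · exact mem_insert_of_mem (h1 x hx hxr)
        · intro x hx hxr hxS
          rcases mem_insert.1 hx with rfl | hx
          · exact absurd hxS htS
          · rw [Function.update_of_ne (hne x hx)]
            exact h2 x hx hxr hxS
        · intro q hq q' hq' hqQ hq'Q
          rcases mem_insert.1 hq with rfl | hq
          · exact absurd (hQS hqQ) htS
          rcases mem_insert.1 hq' with rfl | hq'
          · exact absurd (hQS hq'Q) htS
          rw [Function.update_of_ne (hne q hq), Function.update_of_ne (hne q' hq')]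
          exact h3 q hq q' hq' hqQ hq'Q
        · rw [sum_congr rfl fun w _ => spreadWeight_insert_of_notMem (fun hh => htS (hPS hh)) hts
            fun p hp hpP => h1 p hp (hP p hpP).1]
          exact h4)
      (by
        rintro s φ t hrs - - htS hts hpt hsO ⟨h1, h2, h3, h4⟩
        have hne : ∀ x ∈ s, x ≠ t := fun x hx => ne_of_mem_of_not_mem hx hts
        have htr : t ≠ r := (hne r hrs).symm
        set v := φ (par t) with hv
        -- Forbidden positions are those already used and those two conflict steps from an image of
        -- Q. By `hb` they number at most b/2, so half of each common neighbourhood in B survives, a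
        -- proportion of at least δ.
        set Z := (s.filter fun x => x ∈ S).image φ ∪ (s.filter fun x => x ∈ Q).biUnion fun q =>
          (univ.filter fun w => Bad (φ q) w).biUnion fun w => univ.filter fun y => Bad w y with hZ
        have hZc : Z.card ≤ 2 * k + 1 + k * (L * L) := by
          refine (card_union_le _ _).trans (add_le_add ?_ ?_)
          · refine card_image_le.trans (le_trans (card_le_card ?_) hSc)
            exact fun x hx => (mem_filter.1 hx).2
          · refine (card_biUnion_le_card_mul _ _ (L * L) fun q _ => ?_).trans
              (Nat.mul_le_mul_right _ ((card_le_card fun x hx => (mem_filter.1 hx).2).trans hQc))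
            exact (card_biUnion_le_card_mul _ _ L fun w _ => hBad w).trans
              (Nat.mul_le_mul_right _ (hBad _))
        set X := (B.filter fun u => G.Adj v u) \ Z with hX
        have hXB : X ⊆ B := fun u hu => (mem_filter.1 (mem_sdiff.1 hu).1).1
        have hXne : X.Nonempty := by
          have h5 : (B.filter fun u => G.Adj v u).card - Z.card ≤ X.card := le_card_sdiff _ _
          have h6 := hBv v
          exact card_pos.1 (by omega)
        obtain ⟨y, hy, hyw⟩ : ∃ y ∈ X, ∑ w, spreadWeight G Bad P par ρ (insert t s)
            (Function.update φ t y) w ≤ ∑ w, spreadWeight G Bad P par ρ s φ w := by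
          by_cases htP : t ∈ P
          swap
          · obtain ⟨y, hy⟩ := hXne
            exact ⟨y, hy, (sum_congr rfl fun w _ => spreadWeight_insert_of_notMem htP hts
              fun p hp hpP => h1 p hp (hP p hpP).1).le⟩
          obtain ⟨y, hy, hyw⟩ := exists_sum_weight_le univ X hXne
            (spreadWeight G Bad P par ρ s φ)
            (fun w => by unfold spreadWeight; positivity) (fun y w => G.Adj w y)
            (fun w => ¬ Bad w v) hδ (by
              intro w _ hw
              have h5 := hB v w fun hh => hw (hsymm _ _ hh)
              have h6 : (B.filter fun u => G.Adj v u ∧ G.Adj w u) \ Z ⊆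
                  X.filter fun y => G.Adj w y := by
                intro u
                simp only [hX, mem_sdiff, mem_filter]
                tauto
              have h7 := card_le_card h6
              have h8 := le_card_sdiff Z (B.filter fun u => G.Adj v u ∧ G.Adj w u)
              have h9 : (b : ℝ) ≤ 2 * (X.filter fun y => G.Adj w y).card := by
                exact_mod_cast (by omega : b ≤ 2 * (X.filter fun y => G.Adj w y).card)
              have h10 : (X.card : ℝ) ≤ B.card := by exact_mod_cast card_le_card hXB
              have h11 := mul_le_mul_of_nonneg_left h10 hδ₀
              have h12 : δ * X.card ≤ (X.filter fun y => G.Adj w y).card := by linarith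
              convert h12)
          refine ⟨y, hy, le_trans (le_of_eq (sum_congr rfl fun w _ => ?_)) hyw⟩
          rw [spreadWeight_insert_of_mem htP hts hpt fun p hp hpP => h1 p hp (hP p hpP).1]
          congr!
        have hyZ := (mem_sdiff.1 hy).2
        have hyB := hXB hy
        rw [hZ, mem_union, not_or] at hyZ
        have hyQ : ∀ q ∈ s, q ∈ Q → ∀ w, Bad (φ q) w → ¬ Bad w y := by
          intro q hq hqQ w hw hwy
          exact hyZ.2 (mem_biUnion.2 ⟨q, mem_filter.2 ⟨hq, hqQ⟩,
            mem_biUnion.2 ⟨w, by simpa using hw, by simpa using hwy⟩⟩)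
        refine ⟨y, mem_union_right _ hyB, ?_, (mem_filter.1 (mem_sdiff.1 hy).1).2, ?_, ?_, ?_,
          hyw.trans h4⟩
        · intro x hx hxS he
          exact hyZ.1 (mem_image.2 ⟨x, mem_filter.2 ⟨hx, hxS⟩, he⟩)
        · intro x hx hxr
          rcases mem_insert.1 hx with rfl | hx
          · exact mem_insert_of_mem hpt
          · exact mem_insert_of_mem (h1 x hx hxr)
        · intro x hx hxr hxS
          rcases mem_insert.1 hx with rfl | hx
          · rw [Function.update_self]; exact hyB
          · rw [Function.update_of_ne (hne x hx)]
            exact h2 x hx hxr hxS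
        · intro q hq q' hq' hqQ hq'Q hqq
          rcases mem_insert.1 hq with rfl | hqs <;> rcases mem_insert.1 hq' with rfl | hqs'
          · exact absurd rfl hqq
          · rw [Function.update_self, Function.update_of_ne (hne q' hqs')]
            exact fun w hw hw' => hyQ q' hqs' hq'Q w hw' (hsymm _ _ hw)
          · rw [Function.update_self, Function.update_of_ne (hne q hqs)]
            exact fun w hw hw' => hyQ q hqs hqQ w hw (hsymm _ _ hw')
          · rw [Function.update_of_ne (hne q hqs), Function.update_of_ne (hne q' hqs')]
            exact h3 q hqs q' hqs' hqQ hq'Q hqq)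
  have hQC : Q ⊆ C := by
    intro q hq
    obtain ⟨p, hp, rfl⟩ := mem_image.1 hq
    exact hparC p (hP p hp).1
  refine R.isContained_of_leaves hr hcard hJoin hm hD (subset_refl _) hφinj hφadj
    (mem_insert_self _ _) subset_union_right hφext ?_ (φ r) ?_
  · intro w _
    have hits : m ≤ (P.filter fun p => G.Adj w (φ p)).card := by
      by_contra hlt
      push Not at hlt
      -- A vertex w conflicts with at most one image of Q, so all these p share a parent.
      have h1 : (P.filter fun p => Bad w (φ (par p))).card ≤ K := by
        rcases (P.filter fun p => Bad w (φ (par p))).eq_empty_or_nonempty with he | ⟨p, hp⟩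
        · rw [he, card_empty]; exact Nat.zero_le _
        · refine le_trans (card_le_card fun p' hp' => ?_) (hK (par p))
          rw [mem_filter] at hp hp' ⊢
          refine ⟨hp'.1, ?_⟩
          by_contra hne
          have hq := mem_image_of_mem par hp.1
          have hq' := mem_image_of_mem par hp'.1
          exact hφQ _ (hQC hq') _ (hQC hq) hq' hq hne w (hsymm _ _ hp'.2) (hsymm _ _ hp.2)
      have h2 : k - K ≤ (C.filter fun p => p ∈ P ∧ ¬ Bad w (φ (par p))).card := by
        have h3 := card_filter_add_card_filter_not (s := P) fun p => Bad w (φ (par p))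
        have h4 : (P.filter fun p => ¬ Bad w (φ (par p))).card ≤
            (C.filter fun p => p ∈ P ∧ ¬ Bad w (φ (par p))).card := by
          apply card_le_card
          intro p hp
          rw [mem_filter] at hp ⊢
          exact ⟨hPC hp.1, hp⟩
        omega
      have h3 : (C.filter fun p => p ∈ P ∧ G.Adj w (φ p)).card ≤ m := by
        refine le_trans (card_le_card fun p hp => ?_) hlt.le
        exact mem_filter.2 (mem_filter.1 hp).2
      have h4 := (single_le_sum (f := spreadWeight G Bad P par ρ C φ)
        (fun w _ => by unfold spreadWeight; positivity) (mem_univ w)).trans hφw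
      unfold spreadWeight at h4
      have h5 : (1 / 2 : ℝ) ^ m ≤ (1 / 2) ^ (C.filter fun p => p ∈ P ∧ G.Adj w (φ p)).card :=
        pow_le_pow_of_le_one (by norm_num) (by norm_num) h3
      have h6 : ρ ^ (k - K) ≤ ρ ^ (C.filter fun p => p ∈ P ∧ ¬ Bad w (φ (par p))).card :=
        pow_le_pow_right₀ hρ1 h2
      -- With at most m hits and at least k − K scalings, the single weight of w would already
      -- exceed the bound on the total potential, by `hfin`.
      have h7 := (mul_le_mul h5 h6 (by positivity) (by positivity)).trans h4
      have h8 : ρ ^ (k - K) ≤ Fintype.card V * 2 ^ m := by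
        calc ρ ^ (k - K) = (1 / 2) ^ m * ρ ^ (k - K) * 2 ^ m := by
              rw [mul_right_comm, ← mul_pow]; norm_num
          _ ≤ _ := by gcongr
      linarith
    choose! lf hlf using fun p hp => (hP p hp).2
    refine hits.trans (card_le_card_of_injOn lf ?_ ?_)
    · intro p hp
      rw [mem_coe, mem_filter] at hp
      have h1 := hlf p hp.1
      rw [mem_coe, mem_filter, mem_compl, mem_compl, not_not, h1.2.2]
      exact ⟨h1.1, hp.2⟩
    · intro p hp p' hp' he
      rw [← (hlf p (mem_filter.1 hp).1).2.2, he, (hlf p' (mem_filter.1 hp').1).2.2]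
  · intro l hl
    have hlr : l ≠ r := fun e => hl (e ▸ hrC)
    by_cases hpr : par l = r
    · exact Or.inl (by rw [hpr])
    right
    by_cases hpS : par l ∈ S
    · exact hBV (hφB _ (hparC l hlr) hpr hpS)
    · have := hφO _ (hparC l hlr) hpS
      rw [mem_union, not_or] at this
      exact (hcov _).resolve_right this.1

end Spread
end TreeUniversality

/-! ### Trees with many leaves: star or spread -/

namespace TreeUniversality

open Finset
open scoped Classical

section ManyLeavesCases

variable {V W : Type*} [Fintype W] {T : SimpleGraph W} {r : W} {par : W → W}
  {h : W → ℕ}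

/-- The neighbours of `q` that are adjacent to a leaf. -/
noncomputable def leafParentNeighbors (T : SimpleGraph W) (q : W) : Finset W :=
  univ.filter fun p => T.Adj q p ∧ ∃ l ∈ leafSet T, T.Adj p l

lemma Rooting.leafParentNeighbors_root_subset (R : Rooting T r par h) (hr : r ∉ leafSet T) :
    leafParentNeighbors T r ⊆ leafParentChildren T r par r := by
  intro p hp
  obtain ⟨-, hrp, l, hl, hpl⟩ := mem_filter.1 hp
  have hlr : l ≠ r := fun e => hr (e ▸ hl)
  have hpp : p ≠ r ∧ par p = r := (R.edge r p hrp).resolve_left fun h => h.1 rfl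
  refine mem_filter.2 ⟨mem_univ _, hpp.1, hpp.2, l, hl, hlr, ?_⟩
  rcases R.edge p l hpl with h1 | h1
  · exact absurd (h1.2.symm.trans hpp.2) hlr
  · exact h1.2

lemma exists_notMem_leafSet (hT : T.IsTree) (hcard : 3 ≤ Fintype.card W) : ∃ r, r ∉ leafSet T := by
  by_contra! hcon
  have h1 := sum_degIn_of_isTree hT
  rw [sum_congr rfl fun t _ => (mem_filter.1 (hcon t)).2, sum_const, card_univ, smul_eq_mul] at h1
  omega

variable [Fintype V] {G : SimpleGraph V}

/-- Trees with many leaves. -/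
lemma isContained_of_many_leaves (hT : T.IsTree) (h3 : 3 ≤ Fintype.card W)
    (hcard : Fintype.card V = Fintype.card W) {m D d : ℕ} {V₁ V₂ B : Finset V}
    (hJoin : Joined G m V₁) (hm : 1 ≤ m) (hdisj : Disjoint V₁ V₂) (hcov : ∀ v, v ∈ V₁ ∨ v ∈ V₂)
    (hD : ∀ t, degIn T t univ ≤ D) (hd : ∀ v, d ≤ degIn G v V₁) {n : ℕ} {C₀ : ℝ} {x : V}
    {S Rx : Finset V} (hstar : IsSuitableStar G n C₀ V₁ x S Rx)
    (hS : ∀ w, w ∉ Rx → w ∉ S → m + 25 ≤ degIn G w S)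
    (hdS : D * (2 * m) + (S.card + 26) ≤ d)
    (hroomS : D * (2 * m) + 2 * m + (leafSet T)ᶜ.card + (S.card + 26) < V₁.card)
    (hdB : D * (2 * m) + B.card ≤ d)
    (hroomB : D * (2 * m) + 2 * m + (leafSet T)ᶜ.card + B.card < V₁.card)
    {Bad : V → V → Prop} {L k b : ℕ} (hsymm : ∀ v w, Bad v w → Bad w v)
    (hBad : ∀ v, (univ.filter fun w => Bad v w).card ≤ L) (hL : L < Fintype.card V)
    (hBV : B ⊆ V₁)
    (hB : ∀ v w, ¬ Bad v w → b ≤ (B.filter fun u => G.Adj v u ∧ G.Adj w u).card)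
    (hk : D * k < (leafSet T).card)
    (hb : 2 * (2 * k + 1 + k * (L * L)) ≤ b) {δ : ℝ} (hδ : δ ≤ 1) (hδ₀ : 0 ≤ δ)
    (hδB : 2 * (δ * B.card) ≤ b)
    (hfin : (Fintype.card V : ℝ) * 2 ^ m < ((1 - δ / 2)⁻¹) ^ (k - (S.card + 25))) :
    T.IsContained G := by
  have hdeg : ∀ r, r ∉ leafSet T → degIn T r univ ≠ 1 := fun r hr h =>
    hr (mem_filter.2 ⟨mem_univ _, h⟩)
  -- Either such a q becomes the root at the star centre, or every vertex has fewer than |S| + 25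
  -- children among the leaf parents, the bound K for spreading.
  by_cases hq : ∃ q, q ∉ leafSet T ∧ S.card + 25 ≤ (leafParentNeighbors T q).card
  · obtain ⟨q, hq, hqc⟩ := hq
    obtain ⟨par, h, R⟩ := exists_rooting hT q
    exact isContained_of_star R (hdeg q hq) hcard hJoin hm hdisj hcov hD hd hstar hS hdS hroomS
      (hqc.trans (card_le_card (R.leafParentNeighbors_root_subset hq)))
  push Not at hq
  obtain ⟨r, hr⟩ := exists_notMem_leafSet hT h3
  obtain ⟨par, h, R⟩ := exists_rooting hT r
  have hlr : ∀ l ∈ leafSet T, l ≠ r := fun l hl e => hr (e ▸ hl)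
  have h1 : (leafSet T).card ≤ D * ((leafSet T).image par).card := by
    apply card_le_mul_card_image
    intro p _
    refine le_trans (card_le_card fun l hl => ?_) ((R.card_children_le p).trans (hD p))
    rw [mem_filter] at hl ⊢
    exact ⟨mem_univ _, hlr l hl.1, hl.2⟩
  -- One leaf parent beyond k is needed, because the root may be among them and is discarded.
  have h2 : k < ((leafSet T).image par).card := lt_of_mul_lt_mul_left' (hk.trans_le h1)
  have h3 := pred_card_le_card_erase (s := (leafSet T).image par) (a := r)
  obtain ⟨P, hP, hPc⟩ := exists_subset_card_eq
    (show k ≤ (((leafSet T).image par).erase r).card by omega)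
  have hP' : ∀ p ∈ P, p ≠ r ∧ ∃ l ∈ leafSet T, l ≠ r ∧ par l = p := by
    intro p hp
    obtain ⟨hpr, hp⟩ := mem_erase.1 (hP hp)
    obtain ⟨l, hl, hlp⟩ := mem_image.1 hp
    exact ⟨hpr, l, hl, hlr l hl, hlp⟩
  refine isContained_of_spread R (hdeg r hr) hcard hJoin hm hdisj hcov hD hd hdB hroomB hsymm hBad
    hL hBV hB hP' hPc (fun q => ?_) hb hδ hδ₀ hδB hfin
  by_cases hql : q ∈ leafSet T
  · rw [card_eq_zero.2]
    · exact Nat.zero_le _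
    · rw [filter_eq_empty_iff]
      intro p hp he
      exact R.par_notMem_leafSet (hdeg r hr) (hP' p hp).1 (he ▸ hql)
  · refine (card_le_card fun p hp => ?_).trans (hq q hql).le
    obtain ⟨hpP, rfl⟩ := mem_filter.1 hp
    obtain ⟨hpr, l, hl, hlr, hlp⟩ := hP' p hpP
    have h4 := R.adj l hlr
    rw [hlp] at h4
    exact mem_filter.2 ⟨mem_univ _, R.adj p hpr, l, hl, h4⟩

end ManyLeavesCases
end TreeUniversality

/-! ### Exponential estimates and the common reservoir -/

namespace TreeUniversality

open Finset
open scoped Classical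

section Asymptotics

lemma pairDegIn_comm {V : Type*} (G : SimpleGraph V) (v w : V) (A : Finset V) :
    pairDegIn G v w A = pairDegIn G w v A := by
  unfold pairDegIn
  congr 1
  ext u
  simp only [mem_filter]
  tauto

lemma pairDegIn_le_degIn {V : Type*} (G : SimpleGraph V) (v w : V) (A : Finset V) :
    pairDegIn G v w A ≤ degIn G v A := by
  apply card_le_card
  intro u hu
  rw [mem_filter] at hu ⊢
  exact ⟨hu.1, hu.2.1⟩

lemma eventually_mul_log_pow_le (A : ℝ) :
    ∀ᶠ n : ℕ in Filter.atTop, A * Real.log n ^ 3 ≤ n := by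
  have h1 := (Real.isLittleO_pow_log_id_atTop (n := 3)).comp_tendsto
    tendsto_natCast_atTop_atTop (k := fun n : ℕ => (n : ℝ))
  have h2 := h1.def (show 0 < (|A| + 1)⁻¹ by positivity)
  filter_upwards [h2] with n hn
  simp only [Function.comp_apply, id, Real.norm_eq_abs, abs_pow, Nat.abs_cast] at hn
  rw [inv_mul_eq_div, le_div_iff₀ (by positivity)] at hn
  calc A * Real.log n ^ 3 ≤ |A * Real.log n ^ 3| := le_abs_self _
    _ = |Real.log n| ^ 3 * |A| := by rw [abs_mul, abs_pow]; ring
    _ ≤ |Real.log n| ^ 3 * (|A| + 1) := by gcongr; linarith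
    _ ≤ n := hn

lemma exp_le_inv_one_sub {x : ℝ} (hx : x < 1) : Real.exp x ≤ (1 - x)⁻¹ := by
  rw [← inv_inv (Real.exp x), ← Real.exp_neg]
  apply inv_anti₀ (by linarith)
  linarith [Real.add_one_le_exp (-x)]

lemma two_pow_le_exp (k : ℕ) : (2 : ℝ) ^ k ≤ Real.exp k := by
  rw [← Real.exp_one_pow]
  exact pow_le_pow_left₀ (by norm_num) (by linarith [Real.add_one_le_exp (1 : ℝ)]) k

/-- A small set in which all pairs with many common neighbours keep linearly many of them. -/
lemma exists_common_reservoir {V : Type*} [Fintype V] {G : SimpleGraph V} {n : ℕ} {α ε : ℝ}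
    {V₁ : Finset V} (hV : Fintype.card V = n) (hα₀ : 0 < α) (hα₁ : α < 1) (hn : 1 ≤ n)
    (hε : ε ≤ α / 2) (hV₁ : ε * n ≤ V₁.card)
    (hlarge : 1 + 2 * Real.log n ≤ α * ε * n / 8) :
    ∃ B ⊆ V₁, B.card = ⌊ε * n⌋₊ ∧ ∀ v w, ¬ (pairDegIn G v w V₁ : ℝ) < α * n →
      ⌈α * ε * n / 8⌉₊ ≤ (B.filter fun u => G.Adj v u ∧ G.Adj w u).card := by
  have hn' : (1 : ℝ) ≤ n := by exact_mod_cast hn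
  have hlog : 0 ≤ Real.log n := Real.log_nonneg hn'
  have hεn : 0 < ε * n := by
    by_contra hcon
    nlinarith
  have hb := Nat.floor_le hεn.le
  have hVn : (V₁.card : ℝ) ≤ n := by
    rw [← hV]; exact_mod_cast card_le_univ V₁
  obtain ⟨B, hB, hBc, hBh⟩ := exists_reservoir
    (ι := {p : V × V // ¬ (pairDegIn G p.1 p.2 V₁ : ℝ) < α * n}) V₁
    (fun p => V₁.filter fun u => G.Adj p.1.1 u ∧ G.Adj p.1.2 u) (δ := α / 2) (by linarith)
    (b := ⌊ε * n⌋₊) (by exact_mod_cast hb.trans hV₁) (fun _ => filter_subset _ _)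
    (by
      rintro ⟨⟨v, w⟩, hp⟩
      simp only [not_lt] at hp ⊢
      unfold pairDegIn at hp
      refine le_trans ?_ hp
      nlinarith) (by linarith)
  refine ⟨B, hB, hBc, fun v w hvw => ?_⟩
  have h1 := hBh ⟨(v, w), hvw⟩
  simp only at h1
  set k := ((V₁.filter fun u => G.Adj v u ∧ G.Adj w u) ∩ B).card with hk
  have h2 : k ≤ (B.filter fun u => G.Adj v u ∧ G.Adj w u).card := by
    apply card_le_card
    intro u
    simp only [mem_inter, mem_filter]
    tauto
  refine le_trans (Nat.ceil_le.2 ?_) h2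
  have h3 : (Fintype.card {p : V × V // ¬ (pairDegIn G p.1 p.2 V₁ : ℝ) < α * n} : ℝ) ≤
      Real.exp (2 * Real.log n) := by
    have h4 := Fintype.card_subtype_le fun p : V × V => ¬ (pairDegIn G p.1 p.2 V₁ : ℝ) < α * n
    rw [Fintype.card_prod, hV] at h4
    rw [two_mul, Real.exp_add, Real.exp_log (by linarith)]
    exact_mod_cast h4
  -- At most n² pairs are tracked. Comparing exponents gives k ≥ α⌊εn⌋/4 − 2 log n, and `hlarge`
  -- absorbs the rounding and the logarithm.
  have h5 : Real.exp (⌊ε * n⌋₊ * (α / 4)) ≤ Real.exp (2 * Real.log n + k) := by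
    rw [Real.exp_nat_mul, Real.exp_add]
    calc _ ≤ ((1 - α / 2 / 2)⁻¹) ^ ⌊ε * n⌋₊ := by
          gcongr
          rw [show α / 2 / 2 = α / 4 by ring]
          exact exp_le_inv_one_sub (by linarith)
      _ ≤ _ := h1
      _ ≤ _ := by
          gcongr
          exact two_pow_le_exp k
  have h6 := Real.exp_le_exp.1 h5
  have h7 := Nat.lt_floor_add_one (ε * n)
  nlinarith

end Asymptotics
end TreeUniversality

/-! ### Choice of constants and conclusion -/

namespace TreeUniversality

open Finset
open scoped Classical

section Universality

/-- In K, the part 25C₀ + 25 pays for s + 25. The rest gains α/32 per factor in the exponent, in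
total (2 + C₀) log n, which beats log n + m. -/
lemma mul_two_pow_lt_pow {α C₀ K : ℝ} {n m k s : ℕ} (hα₀ : 0 < α) (hα₁ : α < 1)
    (hC₀ : 0 < C₀) (hK : K = 25 * C₀ + 25 + 32 / α * (2 + C₀)) (hlog : 1 ≤ Real.log n)
    (hm : (m : ℝ) ≤ C₀ * Real.log n) (hk : K * Real.log n ≤ k)
    (hs : (s : ℝ) ≤ 25 * C₀ * Real.log n) :
    (n : ℝ) * 2 ^ m < ((1 - α / 16 / 2)⁻¹) ^ (k - (s + 25)) := by
  have hn : (0 : ℝ) < n := by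
    rcases Nat.eq_zero_or_pos n with rfl | h
    · norm_num at hlog
    · exact_mod_cast h
  have h1 : 32 / α * (2 + C₀) * Real.log n ≤ (k - (s + 25) : ℕ) := by
    have h2 : (k : ℝ) ≤ (k - (s + 25) : ℕ) + (s + 25) := by
      exact_mod_cast (by omega : k ≤ (k - (s + 25)) + (s + 25))
    rw [hK] at hk
    linarith
  have h3 : Real.log n + m < 32 / α * (2 + C₀) * Real.log n * (α / 32) := by
    rw [show 32 / α * (2 + C₀) * Real.log n * (α / 32) = (2 + C₀) * Real.log n by field_simp]
    linarith
  calc (n : ℝ) * 2 ^ m ≤ Real.exp (Real.log n) * Real.exp m := by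
        rw [Real.exp_log hn]
        exact mul_le_mul_of_nonneg_left (two_pow_le_exp m) hn.le
    _ = Real.exp (Real.log n + m) := (Real.exp_add _ _).symm
    _ < Real.exp ((k - (s + 25) : ℕ) * (α / 32)) := by
        rw [Real.exp_lt_exp]
        exact h3.trans_le (mul_le_mul_of_nonneg_right h1 (by linarith))
    _ = Real.exp (α / 32) ^ (k - (s + 25)) := Real.exp_nat_mul _ _
    _ ≤ _ := by
        rw [show α / 16 / 2 = α / 32 by ring]
        exact pow_le_pow_left₀ (Real.exp_pos _).le (exp_le_inv_one_sub (by linarith)) _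

set_option maxHeartbeats 800000 in
/-- The theorem with all the requirements on the constants spelled out. -/
lemma isContained_of_condition {α C₀ γ c K ε : ℝ} {n : ℕ} (hα₀ : 0 < α) (hα₁ : α < 1)
    (hC₀ : 0 < C₀) (hε : ε = α / 100000) (hK : K = 25 * C₀ + 25 + 32 / α * (2 + C₀)) (hc : 0 ≤ c)
    (hcε : 2 * c * C₀ ≤ ε) (hcK : 7098 * c * (K + 1) ≤ 1) (hγ : 0 < γ) (hγε : 500 * γ ≤ ε)
    (hlog : 1 ≤ Real.log n) (hC₀log : 25 ≤ C₀ * Real.log n)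
    (hstarn : (25 * C₀ + 26) * Real.log n ^ 3 ≤ ε * n)
    (hγn : (2 * C₀ ^ 2 + 4 * C₀ + 1) * Real.log n ^ 3 < γ * n)
    (hpathn : (4 * C₀ ^ 3 + 2 * C₀ + 3) * Real.log n ^ 3 ≤ ε * n)
    (hbn : 3 * Real.log n ^ 3 ≤ α * ε * n / 8)
    (hKn : (6 * K + 8) * Real.log n ^ 3 ≤ α * ε * n / 8)
    {V : Type*} [Fintype V] {G : SimpleGraph V} (hV : Fintype.card V = n)
    (hG : UniversalityCondition G n α C₀ γ) {W : Type*} [Fintype W] {T : SimpleGraph W}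
    (hW : Fintype.card W = n) (hT : T.IsTree)
    (hΔ : ∀ t, (degIn T t univ : ℝ) ≤ c * n / Real.log n) : T.IsContained G := by
  obtain ⟨V₁, V₂, ⟨hdisj, hcov, hV₂⟩, ⟨x, S, Rx, hstar⟩, hpair, hedge, 𝒦, good, bad, hcliques⟩ := hG
  have hn0 : n ≠ 0 := by
    rintro rfl
    norm_num at hlog
  have hn1 : 1 ≤ n := Nat.one_le_iff_ne_zero.2 hn0
  have hn1' : (1 : ℝ) ≤ n := by exact_mod_cast hn1
  have hlogn : Real.log n < n := by
    have := Real.log_le_sub_one_of_pos (show (0 : ℝ) < n by linarith)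
    linarith
  have h3 : 3 ≤ n := by
    by_contra hcon
    have h4 : (n : ℝ) ≤ 2 := by exact_mod_cast (by omega : n ≤ 2)
    have := Real.log_le_sub_one_of_pos (show (0 : ℝ) < n by linarith)
    have h5 := Real.log_le_log (by linarith) h4
    linarith [Real.log_two_lt_d9]
  set ℓ := Real.log n with hℓ
  have hℓ2 : ℓ ^ 2 ≤ ℓ ^ 3 := pow_le_pow_right₀ hlog (by norm_num)
  have hℓ1 : ℓ ≤ ℓ ^ 3 := le_self_pow₀ hlog (by norm_num)
  have hℓ0 : 1 ≤ ℓ ^ 3 := hlog.trans hℓ1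
  have hεpos : 0 < ε := by rw [hε]; positivity
  obtain ⟨m, hm⟩ : ∃ m, m = ⌊C₀ * ℓ⌋₊ := ⟨_, rfl⟩
  obtain ⟨D, hDdef⟩ : ∃ D, D = ⌊c * n / ℓ⌋₊ := ⟨_, rfl⟩
  obtain ⟨d, hddef⟩ : ∃ d, d = ⌈α * n⌉₊ := ⟨_, rfl⟩
  have hmr : (m : ℝ) ≤ C₀ * ℓ := hm ▸ Nat.floor_le (by positivity)
  have hm1 : 1 ≤ m := by
    rw [hm]
    exact Nat.le_floor (by push_cast; linarith)
  have hJoin : Joined G m V₁ := fun A B hA hAB hAc hBc =>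
    hedge A B hA hAB (hAc.trans hm) (hBc.trans hm)
  have hD : ∀ t, degIn T t univ ≤ D := fun t => hDdef ▸ Nat.le_floor (hΔ t)
  have hDr : (D : ℝ) * ℓ ≤ c * n := by
    rw [← le_div_iff₀ (by linarith)]
    exact hDdef ▸ Nat.floor_le (by positivity)
  have hDm : (D : ℝ) * (2 * m) ≤ ε * n := by
    calc (D : ℝ) * (2 * m) ≤ D * (2 * (C₀ * ℓ)) := by gcongr
      _ = 2 * C₀ * (D * ℓ) := by ring
      _ ≤ 2 * C₀ * (c * n) := by gcongr
      _ = 2 * c * C₀ * n := by ring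
      _ ≤ ε * n := by gcongr
  have hdr : α * n ≤ d := hddef ▸ Nat.le_ceil _
  have hBadc : ∀ v, (univ.filter fun w => (pairDegIn G v w V₁ : ℝ) < α * n).card ≤ ⌊ℓ⌋₊ := by
    intro v
    refine Nat.le_floor ((le_of_eq ?_).trans (hpair v))
    congr!
  have hL : ⌊ℓ⌋₊ < Fintype.card V := by
    rw [hV]
    exact (Nat.floor_lt (by linarith)).2 hlogn
  -- A vertex with fewer than αn neighbours in V₁ would form a deficient pair with all n vertices,
  -- but only log n are allowed.
  have hd : ∀ v, d ≤ degIn G v V₁ := by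
    intro v
    rw [hddef]
    refine Nat.ceil_le.2 ?_
    by_contra! hcon
    have h4 := hBadc v
    rw [filter_true_of_mem, card_univ] at h4
    · omega
    · intro w _
      refine lt_of_le_of_lt ?_ hcon
      exact_mod_cast pairDegIn_le_degIn G v w V₁
  have hgr : (⌊γ * n⌋₊ : ℝ) ≤ γ * n := Nat.floor_le (by positivity)
  have hg5 : 500 * (⌊γ * n⌋₊ : ℝ) ≤ ε * n := by
    calc 500 * (⌊γ * n⌋₊ : ℝ) ≤ 500 * (γ * n) := by gcongr
      _ = 500 * γ * n := by ring
      _ ≤ _ := by gcongr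
  have hVc : V₁.card + V₂.card = n := by
    rw [← card_union_of_disjoint hdisj, ← hV, ← card_univ]
    congr 1; ext v; simp [hcov v]
  have hm2 : (m : ℝ) ^ 2 ≤ C₀ ^ 2 * ℓ ^ 3 := by
    calc (m : ℝ) ^ 2 ≤ (C₀ * ℓ) ^ 2 := by gcongr
      _ = C₀ ^ 2 * ℓ ^ 2 := by ring
      _ ≤ _ := by gcongr
  have hm3 : (m : ℝ) ^ 3 ≤ C₀ ^ 3 * ℓ ^ 3 := by
    calc (m : ℝ) ^ 3 ≤ (C₀ * ℓ) ^ 3 := by gcongr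
      _ = _ := by ring
  have hmℓ : (m : ℝ) ≤ C₀ * ℓ ^ 3 := hmr.trans (by gcongr)
  have hεn : 100000 * (ε * n) = α * n := by rw [hε]; ring
  have hαn : α * n ≤ n := by nlinarith
  have hpath : 4 * (m : ℝ) ^ 3 + 2 * m + 3 ≤ ε * n := by linarith
  have hm₀ : 0 ≤ (m : ℝ) ^ 3 := by positivity
  by_cases hleaf : 7098 * (leafSet T).card ≤ n
  · refine isContained_of_few_leaves hV hcliques hV₂ hdisj hcov hJoin hm1 ?_ hd ?_ ?_ hT hW hD hleaf
    · have h4 : (2 * m * m + 4 * m : ℕ) + (1 : ℝ) ≤ (2 * C₀ ^ 2 + 4 * C₀ + 1) * ℓ ^ 3 := by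
        push_cast
        linarith
      rw [Nat.lt_iff_add_one_le]
      exact Nat.le_floor (by push_cast at h4 ⊢; linarith)
    · have h4 : (((D + 2 * m * m) * (2 * m) + 1 : ℕ) : ℝ) ≤ d := by
        push_cast
        linarith
      exact_mod_cast h4
    · have h4 : ((3 * ((D + 2 * m * m) * (2 * m) + 2 * m + 500 * ⌊γ * n⌋₊ + 2) : ℕ) : ℝ) ≤ n := by
        push_cast
        linarith
      exact_mod_cast h4
  push Not at hleaf
  have hleafr : (n : ℝ) < 7098 * (leafSet T).card := by exact_mod_cast hleaf
  have hCc : (leafSet T)ᶜ.card + (leafSet T).card = n := by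
    rw [card_compl, hW]
    have := card_le_univ (leafSet T)
    omega
  have hCr : ((leafSet T)ᶜ.card : ℝ) + (leafSet T).card = n := by exact_mod_cast hCc
  have hVr : (V₁.card : ℝ) + 500 * ⌊γ * n⌋₊ = n := by exact_mod_cast hV₂ ▸ hVc
  have hSr : (S.card : ℝ) ≤ 25 * C₀ * ℓ := by
    rw [hstar.card_S]
    exact Nat.floor_le (by positivity)
  have hSn : (S.card : ℝ) + 26 ≤ ε * n := by
    refine le_trans ?_ hstarn
    linarith [mul_le_mul_of_nonneg_left hℓ1 hC₀.le]
  -- More than n/7098 leaves are left out of the core. That exceeds the four losses 2mD, 2m, X and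
  -- 500g, each at most εn, since ε < 10⁻⁵.
  have hroom : ∀ X : ℕ, (X : ℝ) ≤ ε * n →
      D * (2 * m) + 2 * m + (leafSet T)ᶜ.card + X < V₁.card ∧ D * (2 * m) + X ≤ d := by
    intro X hX
    have hmn : 2 * (m : ℝ) ≤ ε * n := by linarith
    have h4 : ((D * (2 * m) + 2 * m + (leafSet T)ᶜ.card + X : ℕ) : ℝ) < V₁.card := by
      push_cast
      linarith
    have h5 : ((D * (2 * m) + X : ℕ) : ℝ) ≤ d := by
      push_cast
      linarith
    exact ⟨by exact_mod_cast h4, by exact_mod_cast h5⟩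
  obtain ⟨B, hBV, hBc, hB⟩ := exists_common_reservoir (ε := ε) hV hα₀ hα₁ hn1 (by linarith)
    (G := G) (V₁ := V₁) (by linarith) (by linarith)
  have hBr : (B.card : ℝ) ≤ ε * n := by
    rw [hBc]
    exact Nat.floor_le (by positivity)
  obtain ⟨hroomS, hdS⟩ := hroom (S.card + 26) (by push_cast; exact hSn)
  obtain ⟨hroomB, hdB⟩ := hroom B.card hBr
  have hb := Nat.le_ceil (α * ε * n / 8)
  have hK₀ : 0 ≤ K := by rw [hK]; positivity
  obtain ⟨k, hk⟩ : ∃ k, k = ⌈K * ℓ⌉₊ := ⟨_, rfl⟩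
  have hk1 : K * ℓ ≤ k := hk ▸ Nat.le_ceil _
  have hk2 : (k : ℝ) ≤ (K + 1) * ℓ := by
    have : (k : ℝ) < K * ℓ + 1 := hk ▸ Nat.ceil_lt_add_one (by positivity)
    linarith
  refine isContained_of_many_leaves hT (by omega) (by omega) hJoin hm1 hdisj hcov hD hd hstar ?_ hdS
    hroomS hdB hroomB (Bad := fun v w => (pairDegIn G v w V₁ : ℝ) < α * n) (L := ⌊ℓ⌋₊) (k := k)
    (fun v w h => by rwa [pairDegIn_comm]) hBadc hL hBV hB ?_ ?_
    -- B has at most εn vertices, and common neighbourhoods in it have at least αεn/8. The half left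
    -- after exclusions is a proportion α/16.
    (δ := α / 16) (by linarith) (by linarith) ?_ ?_
  · intro w hwR hwS
    have h4 := hstar.degIn_S w hwR hwS
    have h5 : ((m + 25 : ℕ) : ℝ) ≤ degIn G w S := by
      push_cast
      linarith
    exact_mod_cast h5
  · have h4 : ((D * k : ℕ) : ℝ) * 7098 < (leafSet T).card * 7098 := by
      push_cast
      calc (D * k : ℝ) * 7098 ≤ D * ((K + 1) * ℓ) * 7098 := by gcongr
        _ = 7098 * (K + 1) * (D * ℓ) := by ring
        _ ≤ 7098 * (K + 1) * (c * n) := by gcongr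
        _ = 7098 * c * (K + 1) * n := by ring
        _ ≤ 1 * n := by gcongr
        _ < _ := by linarith
    exact_mod_cast lt_of_mul_lt_mul_right h4 (by norm_num)
  · have hLr : (⌊ℓ⌋₊ : ℝ) ≤ ℓ := Nat.floor_le (by linarith)
    have h4 : ((2 * (2 * k + 1 + k * (⌊ℓ⌋₊ * ⌊ℓ⌋₊)) : ℕ) : ℝ) ≤ ⌈α * ε * n / 8⌉₊ := by
      refine le_trans ?_ (hKn.trans hb)
      push_cast
      have h5 : (k : ℝ) * (⌊ℓ⌋₊ * ⌊ℓ⌋₊) ≤ (K + 1) * ℓ * (ℓ * ℓ) := by gcongr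
      have h6 : (k : ℝ) ≤ (K + 1) * ℓ ^ 3 := hk2.trans (by gcongr)
      linarith
    exact_mod_cast h4
  · linarith [mul_le_mul_of_nonneg_left hBr hα₀.le]
  · exact hV ▸ mul_two_pow_lt_pow hα₀ hα₁ hC₀ hK hlog hmr hk1 hSr

end Universality
end TreeUniversality

theorem theorem3p1 (α C₀ : ℝ) (hα₀ : 0 < α) (hα₁ : α < 1) (hC₀ : 0 < C₀) :
    ∃ γ' c : ℝ, 0 < γ' ∧ 0 < c ∧
      ∀ γ : ℝ, 0 < γ → γ < γ' →
        ∃ n₀ : ℕ, ∀ n : ℕ, n₀ ≤ n →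
          ∀ (V : Type*) [Fintype V] (G : SimpleGraph V), Fintype.card V = n →
            TreeUniversality.UniversalityCondition G n α C₀ γ →
              ∀ (W : Type*) [Fintype W] (T : SimpleGraph W) [DecidableRel T.Adj],
                Fintype.card W = n → T.IsTree →
                (T.maxDegree : ℝ) ≤ c * n / Real.log n →
                T.IsContained G := by
  obtain ⟨ε, hε⟩ : ∃ ε, ε = α / 100000 := ⟨_, rfl⟩
  obtain ⟨K, hK⟩ : ∃ K, K = 25 * C₀ + 25 + 32 / α * (2 + C₀) := ⟨_, rfl⟩
  have hε₀ : 0 < ε := by rw [hε]; positivity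
  have hK₀ : 0 < K := by rw [hK]; positivity
  -- The first bound keeps the total demand 2mD below εn; the second makes D·k smaller than the
  -- number of leaves.
  obtain ⟨c, hc⟩ : ∃ c, c = min (ε / (2 * C₀)) (1 / (7098 * (K + 1))) := ⟨_, rfl⟩
  have hc₀ : 0 < c := by rw [hc]; positivity
  have hcε : 2 * c * C₀ ≤ ε := by
    have h1 : c ≤ ε / (2 * C₀) := hc ▸ min_le_left _ _
    rw [le_div_iff₀ (by positivity)] at h1
    linarith
  have hcK : 7098 * c * (K + 1) ≤ 1 := by
    have h1 : c ≤ 1 / (7098 * (K + 1)) := hc ▸ min_le_right _ _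
    rw [le_div_iff₀ (by positivity)] at h1
    linarith
  refine ⟨ε / 500, c, by positivity, hc₀, fun γ hγ hγ' => ?_⟩
  have hlog : Filter.Tendsto (fun n : ℕ => Real.log n) Filter.atTop Filter.atTop :=
    Real.tendsto_log_atTop.comp tendsto_natCast_atTop_atTop
  have key : ∀ A x : ℝ, 0 < x → ∀ᶠ n : ℕ in Filter.atTop, A * Real.log n ^ 3 ≤ x * n := by
    intro A x hx
    filter_upwards [TreeUniversality.eventually_mul_log_pow_le (A / x)] with n hn
    rw [div_mul_eq_mul_div, div_le_iff₀ hx] at hn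
    linarith
  have hαε : 0 < α * ε / 8 := by positivity
  obtain ⟨n₀, hn₀⟩ := Filter.eventually_atTop.1
    ((hlog.eventually_ge_atTop 1).and ((hlog.eventually_ge_atTop (25 / C₀)).and
      -- The constant + 2 in the second estimate, against + 1 where it is used, turns the weak
      -- inequality into a strict one.
      ((key (25 * C₀ + 26) ε hε₀).and ((key (2 * C₀ ^ 2 + 4 * C₀ + 2) γ hγ).and
        ((key (4 * C₀ ^ 3 + 2 * C₀ + 3) ε hε₀).and
          ((key 3 _ hαε).and (key (6 * K + 8) _ hαε)))))))
  refine ⟨n₀, fun n hn V _ G hV hG W _ T _ hW hT hΔ => ?_⟩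
  obtain ⟨h1, h2, h3, h4, h5, h6, h7⟩ := hn₀ n hn
  have h8 : 1 ≤ Real.log n ^ 3 := one_le_pow₀ h1
  refine TreeUniversality.isContained_of_condition hα₀ hα₁ hC₀ hε hK hc₀.le hcε hcK hγ
    (by linarith) h1 ?_ h3 (by linarith) h5 (by linarith) (by linarith) hV hG hW hT fun t => ?_
  · rw [div_le_iff₀ hC₀] at h2
    linarith
  · rw [TreeUniversality.degIn_univ_eq_degree]
    exact le_trans (by exact_mod_cast T.degree_le_maxDegree t) hΔ
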